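/- Theorem 1.3. Let $n\ge 2$ and let $\mathbb R^{n+1}_1$ be $\mathbb R^{n+1}$ with the Lorentzian product $\langle X,Y\rangle=X_1Y_1+\dots+X_nY_n-X_{n+1}Y_{n+1}$. Let $x:M^n\to\mathbb R^{n+1}_1$ be a smooth space-like immersion of a connected smooth $n$-manifold (second countable, without boundary) whose induced Riemannian metric is complete, and let $N$ be a smooth unit normal field, $\langle N,N\rangle=-1$. Let $h(v,w)=\langle dN(v),dx(w)\rangle$ be the second fundamental form, $A$ the shape operator (the self-adjoint operator with $\langle Av,w\rangle=h(v,w)$), $H=\operatorname{tr}A$ the mean curvature, $S=|h|^2=\operatorname{tr}A^2$ and $B=S-\frac{H^2}{n}$. Let $\nabla$, $\Delta$ and $dV$ be the gradient, Laplacian and volume element of the induced metric, and let $$\tilde{\mathcal L}v=\Delta v-\langle x,x\rangle\langle x,\nabla v\rangle .$$ Suppose that $x$ is a $\lambda$-hypersurface with weight $s=\langle x,x\rangle$, that is, for a constant $\lambda\in\mathbb R$, $$H-\langle x,x\rangle\langle x,N\rangle=\lambda\quad\text{on } M,$$ that $$\int_M\left(|\nabla B|+|\tilde{\mathcal L}B|\right)e^{-\frac{\langle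 x,x\rangle^2}{4}}\,dV<+\infty,\tag{1.4}$$ and that at every point of $M$ the operator $$4A^2-\frac{4H}{n}A+B\,I$$ is positive semidefinite. Then at least one of the following holds. (a) $x$ is totally umbilical (at each point $A$ is a multiple of $I$) and, up to a linear isometry of $\mathbb R^{n+1}_1$, $x$ is an isometric embedding onto one of the following two hypersurfaces: the hyperbolic space $\mathbb H^n(c)=\{y:\langle y,y\rangle=\frac1c,\ y_{n+1}>0\}$ for some $c<0$, or the Euclidean space $\mathbb R^n=\{y:y_{n+1}=0\}$. (b) There is a point $p\in M$ such that $$\left(\sqrt{S(p)-\frac{H(p)^2}{n}}-|\lambda|\frac{n-2}{2\sqrt{n(n-1)}}\right)^2+\frac1n\left(H(p)-\lambda\right)^2-\frac{n\lambda^2}{4(n-1)}<0.\tag{1.6}$$ -/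

import Mathlib

open Set MeasureTheory Manifold Bundle
open scoped ContDiff Manifold ENNReal InnerProductSpace

noncomputable section

/-- The coordinate vector space underlying the Lorentzian space `ℝ^{n+1}_1`. Its Euclidean norm is
only used for the topology and the smooth structure. -/
abbrev LorentzSpace (n : ℕ) : Type := EuclideanSpace ℝ (Fin (n + 1))

/-- The Lorentzian product `X₁Y₁ + ⋯ + XₙYₙ - Xₙ₊₁Yₙ₊₁`. -/
def lorentz {n : ℕ} (X Y : LorentzSpace n) : ℝ :=
  ∑ i : Fin n, X i.castSucc * Y i.castSucc - X (Fin.last n) * Y (Fin.last n)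

/-! ### Riemannian manifolds: gradient, Laplacian, volume -/

section Riemannian

variable {n : ℕ} {M : Type*} [TopologicalSpace M] [ChartedSpace (EuclideanSpace ℝ (Fin n)) M]

/-- The differential at `p` of a map from a manifold to a vector space. -/
def differential {F : Type*} [NormedAddCommGroup F] [NormedSpace ℝ F]
    (f : M → F) (p : M) : TangentSpace (𝓡 n) p →L[ℝ] F :=
  mfderiv (𝓡 n) 𝓘(ℝ, F) f p

/-- The differential at `y` of the inverse `φ⁻¹` of the preferred chart `φ` at `q`. -/
def chartSymmDifferential (q : M) (y : EuclideanSpace ℝ (Fin n)) :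
    EuclideanSpace ℝ (Fin n) →L[ℝ]
      TangentSpace (𝓡 n) ((chartAt (EuclideanSpace ℝ (Fin n)) q).symm y) :=
  mfderiv (𝓡 n) (𝓡 n) (chartAt (EuclideanSpace ℝ (Fin n)) q).symm y

/-- The coordinate vector field `∂ᵢ` of the preferred chart `φ` at `q`, at the point `φ⁻¹ y`. -/
def coordVector (q : M) (y : EuclideanSpace ℝ (Fin n)) (i : Fin n) :
    TangentSpace (𝓡 n) ((chartAt (EuclideanSpace ℝ (Fin n)) q).symm y) :=
  chartSymmDifferential q y (EuclideanSpace.single i (1 : ℝ))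

variable [RiemannianBundle (fun p : M => TangentSpace (𝓡 n) p)]

/-- The matrix `gᵢⱼ = ⟨∂ᵢ, ∂ⱼ⟩` of the metric in the preferred chart at `q`. -/
def metricMatrix (q : M) (y : EuclideanSpace ℝ (Fin n)) : Matrix (Fin n) (Fin n) ℝ :=
  Matrix.of fun i j => ⟪coordVector q y i, coordVector q y j⟫_ℝ

/-- The volume measure of the preferred chart at `q`: the image in `M` of the measure
`√(det g) dy¹ ⋯ dyⁿ` on the target of the chart. -/
def chartVolume [MeasurableSpace M] (q : M) : Measure M :=
  ((volume.restrict (chartAt (EuclideanSpace ℝ (Fin n)) q).target).withDensity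
    (fun y => ENNReal.ofReal (Real.sqrt (metricMatrix q y).det))).map
      (chartAt (EuclideanSpace ℝ (Fin n)) q).symm

variable (n M) in
/-- The Riemannian volume measure. It restricts to `chartVolume q` on the domain of the preferred
chart at `q`, for each `q`, and is thus the least measure that dominates all of these. -/
def riemannianVolume [MeasurableSpace M] : Measure M :=
  ⨆ q : M, chartVolume (n := n) q

/-- An orthonormal basis of the tangent space at `p`. -/
def orthoFrame (p : M) :
    OrthonormalBasis (Fin (Module.finrank ℝ (TangentSpace (𝓡 n) p))) ℝ (TangentSpace (𝓡 n) p) :=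
  haveI : FiniteDimensional ℝ (TangentSpace (𝓡 n) p) :=
    inferInstanceAs (FiniteDimensional ℝ (EuclideanSpace ℝ (Fin n)))
  stdOrthonormalBasis ℝ (TangentSpace (𝓡 n) p)

variable (n) in
/-- The gradient `∇f = ∑ᵢ df(eᵢ) eᵢ`. -/
def riemannianGradient (f : M → ℝ) (p : M) : TangentSpace (𝓡 n) p :=
  ∑ i, differential f p (orthoFrame p i) • orthoFrame p i

variable (n) in
/-- The Laplace-Beltrami operator
`Δf = (det g)^{-1/2} ∑ᵢ ∂ᵢ ((det g)^{1/2} ∑ⱼ gⁱʲ ∂ⱼ f)`,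
evaluated at `p` in the preferred chart at `p`. -/
def riemannianLaplacian (f : M → ℝ) (p : M) : ℝ :=
  let φ := chartAt (EuclideanSpace ℝ (Fin n)) p
  let ρ : EuclideanSpace ℝ (Fin n) → ℝ := fun y => Real.sqrt (metricMatrix p y).det
  (ρ (φ p))⁻¹ * ∑ i,
    fderiv ℝ
      (fun y => ρ y * ∑ j, (metricMatrix p y)⁻¹ i j *
        fderiv ℝ (fun z => f (φ.symm z)) y (EuclideanSpace.single j (1 : ℝ)))
      (φ p) (EuclideanSpace.single i (1 : ℝ))

/-! ### Space-like hypersurfaces of the Lorentzian space -/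

/-- `x` is a smooth isometric immersion of the Riemannian manifold `M` in the Lorentzian space,
that is, `M` carries the metric induced by `x` (and `x` is an immersion and space-like, because
this metric is positive definite), and `N` is a smooth unit normal field of `x`. -/
structure IsSpacelikeHypersurface (x N : M → LorentzSpace n) : Prop where
  smooth : ContMDiff (𝓡 n) 𝓘(ℝ, LorentzSpace n) ∞ x
  smooth_normal : ContMDiff (𝓡 n) 𝓘(ℝ, LorentzSpace n) ∞ N
  isometric : ∀ (p : M) (v w : TangentSpace (𝓡 n) p),
    lorentz (differential x p v) (differential x p w) = ⟪v, w⟫_ℝ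
  normal : ∀ (p : M) (v : TangentSpace (𝓡 n) p), lorentz (N p) (differential x p v) = 0
  unit : ∀ p : M, lorentz (N p) (N p) = -1

/-- The second fundamental form, with the sign convention `h(v, w) = ⟨dN(v), dx(w)⟩`, for which
`dN = ∑ hᵢⱼ ωʲ eᵢ`. -/
def secondForm (x N : M → LorentzSpace n) (p : M) (v w : TangentSpace (𝓡 n) p) : ℝ :=
  lorentz (differential N p v) (differential x p w)

/-- The mean curvature `H = ∑ᵢ hᵢᵢ` (the trace, without a factor `1/n`). -/
def meanCurvature (x N : M → LorentzSpace n) (p : M) : ℝ :=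
  ∑ i, secondForm x N p (orthoFrame p i) (orthoFrame p i)

/-- The squared norm `S = ∑ᵢⱼ hᵢⱼ²` of the second fundamental form. -/
def normSqSecondForm (x N : M → LorentzSpace n) (p : M) : ℝ :=
  ∑ i, ∑ j, secondForm x N p (orthoFrame p i) (orthoFrame p j) ^ 2

/-- The shape operator `A`, with `⟨A v, w⟩ = h(v, w)`. -/
def shapeOperator (x N : M → LorentzSpace n) (p : M) (v : TangentSpace (𝓡 n) p) :
    TangentSpace (𝓡 n) p :=
  ∑ i, secondForm x N p v (orthoFrame p i) • orthoFrame p i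

/-- `B = S - H² / n`. -/
def tracelessNormSq (x N : M → LorentzSpace n) (p : M) : ℝ :=
  normSqSecondForm x N p - meanCurvature x N p ^ 2 / n

/-- `x` is a `λ`-hypersurface with weight function `s`: `H - s ⟨x, N⟩ = λ`. -/
def IsLambdaHypersurface (x N : M → LorentzSpace n) (s : M → ℝ) (lam : ℝ) : Prop :=
  ∀ p : M, meanCurvature x N p - s p * lorentz (x p) (N p) = lam

/-- The operator `Δv - ⟨x, x⟩ ⟨x, ∇v⟩`, where `∇v` is seen as a vector of the ambient space. -/
def driftLaplacian (x : M → LorentzSpace n) (v : M → ℝ) (p : M) : ℝ :=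
  riemannianLaplacian n v p -
    lorentz (x p) (x p) * lorentz (x p) (differential x p (riemannianGradient n v p))

/-- `x` is totally umbilical: at each point the shape operator is a multiple of the identity. -/
def IsTotallyUmbilical (x N : M → LorentzSpace n) : Prop :=
  ∀ p : M, ∃ κ : ℝ, ∀ v : TangentSpace (𝓡 n) p, shapeOperator x N p v = κ • v

end Riemannian

/-- The hyperbolic space `ℍⁿ(c)` of sectional curvature `c < 0`, as the sheet `yₙ₊₁ > 0` of the
hyperboloid `⟨y, y⟩ = 1 / c`. -/
def hyperbolicSpace (n : ℕ) (c : ℝ) : Set (LorentzSpace n) :=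
  {y | lorentz y y = 1 / c ∧ 0 < y (Fin.last n)}

/-- The Euclidean space `ℝⁿ` as the space-like hyperplane `yₙ₊₁ = 0`. -/
def euclideanHyperplane (n : ℕ) : Set (LorentzSpace n) :=
  {y | y (Fin.last n) = 0}

/-- `x` is an embedding and a linear isometry of the Lorentzian space carries its image onto `Q`.
Since `M` carries the metric induced by `x`, if `Q` is an embedded hypersurface then `M` is in
particular isometric to `Q`. -/
def IsIsometricToHypersurface {n : ℕ} {M : Type*} [TopologicalSpace M]
    (x : M → LorentzSpace n) (Q : Set (LorentzSpace n)) : Prop :=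
  Topology.IsEmbedding x ∧
    ∃ T : LorentzSpace n ≃ₗ[ℝ] LorentzSpace n,
      (∀ u v, lorentz (T u) (T v) = lorentz u v) ∧ T '' range x = Q

end

/-! Write `u = ⟨x, N⟩`, let `xᵀ` be the tangential part of `x`, and let `Q` be the expression whose
negativity alternative (b) asserts. Assume (b) fails, so that `Q ≥ 0` on `M`; the task is then to
prove (a).

Projection of the space-like hypersurface to `ℝⁿ` does not shorten tangent vectors. Since `M` is
complete, segments lift through it, so it is a diffeomorphism (`exists_smooth_inverse_of_expanding`)
and `M` is an entire graph (`IsSpacelikeHypersurface.exists_isGraphChart`). One chart therefore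
covers `M`. For local computations at a point, a Lorentz isometry makes the normal there vertical
and the principal directions the coordinate axes. The Christoffel symbols then vanish at that point,
and the third derivatives of the graph function are the components of `∇h`.

Differentiating `H - ⟨x, x⟩u = λ` twice at such a point gives a Simons identity (`simons_identity`):
`½ L̃B = (|∇h|² - |∇H|²/n) + SB - λ(tr A³ - HS/n) + u²B + ⟨(4A² - (4H/n)A + B)xᵀ, xᵀ⟩`. The first
bracket is nonnegative by Cauchy-Schwarz. Okumura's inequality for the trace-free part of `A` bounds
`SB - λ(tr A³ - HS/n)` below by `BQ` (`cubic_term_le`). The last term is the hypothesis on `4A² -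
(4H/n)A + B`. Hence `L̃B ≥ 0`.

Since `∇(⟨x, x⟩²/4) = ⟨x, x⟩xᵀ`, the function `e^{-⟨x, x⟩²/4} L̃B` is the divergence of `e^{-⟨x,
x⟩²/4}∇B`, a field with integrable length. Cutting off with the distance function, whose balls are
compact by Hopf-Rinow, shows that the divergence has integral zero, so `L̃B = 0`
(`IsGraphChart.driftLaplacian_eq_zero`).

Every term of the identity is then zero. A totally symmetric `∇h` with `|∇h|² = |∇H|²/n` vanishes
when `n ≥ 2`, so `H`, `S` and `B` are constant, and `u²B = 0`. If `B ≠ 0` then `u` vanishes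
identically, and its second derivatives force `A = 0`, a contradiction. So `B = 0` and `A = (H/n)I`.
With `H` constant, the first two derivatives of the `λ`-equation give `u = 0` when `H = 0`, so `M`
is a hyperplane through the origin. When `H ≠ 0` they give `xᵀ = 0`, so `M` is a sheet of a
hyperboloid centred at the origin. -/

section LengthEstimates

/-! ### Length and distance on a Riemannian manifold. -/

open Filter Topology

variable {n : ℕ} {M : Type*} [PseudoMetricSpace M]
    [ChartedSpace (EuclideanSpace ℝ (Fin n)) M]
    [RiemannianBundle (fun p : M => TangentSpace (𝓡 n) p)]
    [IsRiemannianManifold (𝓡 n) M]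

/-- A curve of speed at most `C` is `C`-Lipschitz for the Riemannian distance. -/
lemma dist_le_of_norm_mfderiv_le
    {γ : ℝ → M} {a b C : ℝ} (hab : a ≤ b) (hC : 0 ≤ C)
    (hγ : ContMDiffOn 𝓘(ℝ, ℝ) (𝓡 n) 1 γ (Icc a b))
    (hv : ∀ t ∈ Ioo a b, ‖(mfderiv 𝓘(ℝ, ℝ) (𝓡 n) γ t (1 : ℝ) : TangentSpace (𝓡 n) (γ t))‖ ≤ C) :
    dist (γ a) (γ b) ≤ C * (b - a) := by
  have h1 : edist (γ a) (γ b) ≤ ENNReal.ofReal (C * (b - a)) := by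
    rw [IsRiemannianManifold.out (I := 𝓡 n) (γ a) (γ b)]
    refine (riemannianEDist_le_pathELength hγ rfl rfl hab).trans ?_
    rw [pathELength_eq_lintegral_mfderiv_Ioo]
    calc ∫⁻ t in Ioo a b, ‖(mfderiv 𝓘(ℝ, ℝ) (𝓡 n) γ t (1 : ℝ) : TangentSpace (𝓡 n) (γ t))‖ₑ
        ≤ ∫⁻ t in Ioo a b, ENNReal.ofReal C := by
          refine setLIntegral_mono' measurableSet_Ioo fun t ht => ?_
          rw [← ofReal_norm]
          exact ENNReal.ofReal_le_ofReal (hv t ht)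
      _ = ENNReal.ofReal (C * (b - a)) := by
          rw [setLIntegral_const, Real.volume_Ioo, ENNReal.ofReal_mul hC]
  rw [edist_dist] at h1
  exact (ENNReal.ofReal_le_ofReal_iff (mul_nonneg hC (sub_nonneg.2 hab))).1 h1

end LengthEstimates

/-! ### Expanding maps from a complete manifold to Euclidean space are diffeomorphisms. -/

section GlobalInverse

open Filter Topology

variable {n : ℕ} {M : Type*}

/-- The inverse function theorem for maps from a manifold to its model space. -/
lemma exists_openPartialHomeomorph_of_injective_differential [TopologicalSpace M]
    [ChartedSpace (EuclideanSpace ℝ (Fin n)) M] [IsManifold (𝓡 n) ∞ M]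
    {P : M → EuclideanSpace ℝ (Fin n)}
    (hP : ContMDiff (𝓡 n) 𝓘(ℝ, EuclideanSpace ℝ (Fin n)) ∞ P) (p : M)
    (hinj : ∀ v : TangentSpace (𝓡 n) p, differential P p v = 0 → v = 0) :
    ∃ e : OpenPartialHomeomorph M (EuclideanSpace ℝ (Fin n)), p ∈ e.source ∧
      EqOn P e e.source ∧
      ContMDiffAt 𝓘(ℝ, EuclideanSpace ℝ (Fin n)) (𝓡 n) ∞ e.symm (P p) := by
  let E := EuclideanSpace ℝ (Fin n)
  set φ := chartAt E p with hφ
  have hps : p ∈ φ.source := mem_chart_source E p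
  have hsymm : ContMDiffAt 𝓘(ℝ, E) (𝓡 n) ∞ φ.symm (φ p) :=
    (contMDiffOn_chart_symm (I := 𝓡 n) (x := p)).contMDiffAt
      (φ.open_target.mem_nhds (φ.map_source hps))
  have hφd : ContMDiffAt (𝓡 n) 𝓘(ℝ, E) ∞ φ p :=
    (contMDiffOn_chart (I := 𝓡 n) (x := p)).contMDiffAt (φ.open_source.mem_nhds hps)
  have hpp : φ.symm (φ p) = p := φ.left_inv hps
  have hP' : ContMDiffAt (𝓡 n) 𝓘(ℝ, E) ∞ P (φ.symm (φ p)) := by rw [hpp]; exact hP p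
  have hcomp : ContMDiffAt 𝓘(ℝ, E) 𝓘(ℝ, E) ∞ (P ∘ φ.symm) (φ p) := hP'.comp _ hsymm
  have hcd : ContDiffAt ℝ ∞ (P ∘ φ.symm) (φ p) := hcomp.contDiffAt
  -- Both factors have injective differential: that of `P` by assumption, that of `φ.symm` because
  -- `φ` is a smooth left inverse of it near `φ p`.
  have hker : ∀ v : E, fderiv ℝ (P ∘ φ.symm) (φ p) v = 0 → v = 0 := by
    intro v hv
    rw [← mfderiv_eq_fderiv, mfderiv_comp (φ p) (hP'.mdifferentiableAt (by simp))
      (hsymm.mdifferentiableAt (by simp))] at hv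
    have h1 : mfderiv 𝓘(ℝ, E) (𝓡 n) φ.symm (φ p) v = 0 := by
      have := hinj
      rw [← hpp] at this
      exact this _ hv
    have h2 : mfderiv 𝓘(ℝ, E) 𝓘(ℝ, E) (φ ∘ φ.symm) (φ p) v = 0 := by
      rw [mfderiv_comp (I' := 𝓡 n) (φ p) (by rw [hpp]; exact hφd.mdifferentiableAt (by simp))
        (hsymm.mdifferentiableAt (by simp))]
      change mfderiv (𝓡 n) 𝓘(ℝ, E) φ (φ.symm (φ p)) (mfderiv 𝓘(ℝ, E) (𝓡 n) φ.symm (φ p) v) = 0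
      rw [h1]; exact map_zero _
    have h3 : (φ ∘ φ.symm) =ᶠ[𝓝 (φ p)] id := by
      filter_upwards [φ.open_target.mem_nhds (φ.map_source hps)] with y hy
      exact φ.right_inv hy
    rw [h3.mfderiv_eq, mfderiv_id] at h2
    exact h2
  let L : E ≃L[ℝ] E := (LinearEquiv.ofInjectiveEndo (fderiv ℝ (P ∘ φ.symm) (φ p) : E →ₗ[ℝ] E)
    ((injective_iff_map_eq_zero _).2 hker)).toContinuousLinearEquiv
  have hL : HasFDerivAt (P ∘ φ.symm) (L : E →L[ℝ] E) (φ p) := by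
    have := (hcd.differentiableAt (by simp)).hasFDerivAt
    convert this using 1
    all_goals (ext v; rfl)
  let e' := hcd.toOpenPartialHomeomorph (P ∘ φ.symm) hL (by simp)
  have hmem : φ p ∈ e'.source := hcd.mem_toOpenPartialHomeomorph_source hL (by simp)
  refine ⟨φ.trans e', ?_, ?_, ?_⟩
  · rw [OpenPartialHomeomorph.trans_source]; exact ⟨hps, hmem⟩
  · intro q hq
    rw [OpenPartialHomeomorph.trans_source] at hq
    change P q = P (φ.symm (φ q))
    rw [φ.left_inv hq.1]
  · have h1 : ContDiffAt ℝ ∞ e'.symm (P p) := by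
      have := hcd.to_localInverse hL (by simp)
      simp only [Function.comp, hpp] at this
      exact this
    have h2 : e'.symm (P p) = φ p := by
      have := e'.left_inv hmem
      change e'.symm (P (φ.symm (φ p))) = φ p at this
      rwa [hpp] at this
    have : ContMDiffAt 𝓘(ℝ, E) (𝓡 n) ∞ (φ.symm ∘ e'.symm) (P p) :=
      ContMDiffAt.comp _ (by rw [h2]; exact hsymm) h1.contMDiffAt
    exact this

variable [MetricSpace M] [ChartedSpace (EuclideanSpace ℝ (Fin n)) M]
    [RiemannianBundle (fun p : M => TangentSpace (𝓡 n) p)]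
    {P : M → EuclideanSpace ℝ (Fin n)}

lemma differential_injective_of_expanding
    (hexp : ∀ (p : M) (v : TangentSpace (𝓡 n) p), ‖v‖ ≤ ‖differential P p v‖)
    (p : M) (v : TangentSpace (𝓡 n) p) (hv : differential P p v = 0) : v = 0 := by
  have := hexp p v
  rw [hv, norm_zero] at this
  exact norm_le_zero_iff.1 this

variable [IsManifold (𝓡 n) ∞ M]

lemma isLocalHomeomorph_of_expanding
    (hP : ContMDiff (𝓡 n) 𝓘(ℝ, EuclideanSpace ℝ (Fin n)) ∞ P)
    (hexp : ∀ (p : M) (v : TangentSpace (𝓡 n) p), ‖v‖ ≤ ‖differential P p v‖) :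
    IsLocalHomeomorph P := by
  refine IsLocalHomeomorph.mk P fun p => ?_
  obtain ⟨e, he, heq, -⟩ := exists_openPartialHomeomorph_of_injective_differential hP p
    (differential_injective_of_expanding hexp p)
  exact ⟨e, he, heq⟩

/-- Continuous lifts of a smooth map through an expanding map are smooth. -/
lemma contMDiffWithinAt_lift_of_expanding {V : Type*} [NormedAddCommGroup V] [NormedSpace ℝ V]
    (hP : ContMDiff (𝓡 n) 𝓘(ℝ, EuclideanSpace ℝ (Fin n)) ∞ P)
    (hexp : ∀ (p : M) (v : TangentSpace (𝓡 n) p), ‖v‖ ≤ ‖differential P p v‖)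
    {γ : V → EuclideanSpace ℝ (Fin n)} {Γ : V → M} {s : Set V} {t : V} (ht : t ∈ s)
    (hγ : ContDiffAt ℝ ∞ γ t) (hΓ : ContinuousWithinAt Γ s t)
    (hlift : ∀ t ∈ s, P (Γ t) = γ t) :
    ContMDiffWithinAt 𝓘(ℝ, V) (𝓡 n) ∞ Γ s t := by
  obtain ⟨e, he, heq, hes⟩ := exists_openPartialHomeomorph_of_injective_differential hP (Γ t)
    (differential_injective_of_expanding hexp (Γ t))
  have h1 : ContMDiffWithinAt 𝓘(ℝ, V) (𝓡 n) ∞ (e.symm ∘ γ) s t := by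
    refine ContMDiffAt.comp_contMDiffWithinAt _ ?_ hγ.contMDiffAt.contMDiffWithinAt
    rw [← hlift t ht]; exact hes
  refine h1.congr_of_eventuallyEq ?_ ?_
  · filter_upwards [hΓ.preimage_mem_nhdsWithin (e.open_source.mem_nhds he),
      self_mem_nhdsWithin] with τ hτ hτs
    simp only [Function.comp]
    rw [← hlift τ hτs, heq hτ, e.left_inv hτ]
  · simp only [Function.comp]
    rw [← hlift t ht, heq he, e.left_inv he]

variable [IsRiemannianManifold (𝓡 n) M]

/-- Lifts of segments through an expanding map are Lipschitz. -/
lemma dist_lift_le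
    (hP : ContMDiff (𝓡 n) 𝓘(ℝ, EuclideanSpace ℝ (Fin n)) ∞ P)
    (hexp : ∀ (p : M) (v : TangentSpace (𝓡 n) p), ‖v‖ ≤ ‖differential P p v‖)
    {y v : EuclideanSpace ℝ (Fin n)} {Γ : ℝ → M} {T : ℝ} (hΓ : ContinuousOn Γ (Icc 0 T))
    (hlift : ∀ t ∈ Icc 0 T, P (Γ t) = y + t • v) {a b : ℝ} (ha : 0 ≤ a) (hab : a ≤ b)
    (hb : b ≤ T) : dist (Γ a) (Γ b) ≤ ‖v‖ * (b - a) := by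
  have hsm : ∀ t ∈ Icc (0 : ℝ) T, ContMDiffWithinAt 𝓘(ℝ, ℝ) (𝓡 n) ∞ Γ (Icc 0 T) t := fun t ht =>
    contMDiffWithinAt_lift_of_expanding hP hexp ht
      (γ := fun t : ℝ => y + t • v) (by fun_prop) (hΓ t ht) hlift
  refine dist_le_of_norm_mfderiv_le hab (norm_nonneg _)
    (fun t ht => ((hsm t ⟨ha.trans ht.1, ht.2.trans hb⟩).mono
      (Icc_subset_Icc ha hb)).of_le (by simp)) fun t ht => ?_
  have hnh : Icc (0 : ℝ) T ∈ 𝓝 t := Icc_mem_nhds (ha.trans_lt ht.1) (ht.2.trans_le hb)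
  have hd := ((hsm t (mem_of_mem_nhds hnh)).contMDiffAt hnh).mdifferentiableAt (by simp)
  refine (hexp _ _).trans (le_of_eq ?_)
  congr 1
  have h1 : mfderiv 𝓘(ℝ, ℝ) 𝓘(ℝ, EuclideanSpace ℝ (Fin n)) (P ∘ Γ) t (1 : ℝ) = v := by
    have : (P ∘ Γ) =ᶠ[𝓝 t] fun t => y + t • v := by
      filter_upwards [hnh] with τ hτ using hlift τ hτ
    rw [this.mfderiv_eq, mfderiv_eq_fderiv]
    have : HasFDerivAt (fun t : ℝ => y + t • v) ((1 : ℝ →L[ℝ] ℝ).smulRight v) t :=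
      ((1 : ℝ →L[ℝ] ℝ).smulRight v).hasFDerivAt.const_add y
    rw [this.fderiv]
    exact one_smul ℝ v
  rw [mfderiv_comp t ((hP _).mdifferentiableAt (by simp)) hd] at h1
  exact h1

/-- Segments lift through an expanding map of a complete manifold. -/
lemma exists_lift_segment [CompleteSpace M]
    (hP : ContMDiff (𝓡 n) 𝓘(ℝ, EuclideanSpace ℝ (Fin n)) ∞ P)
    (hexp : ∀ (p : M) (v : TangentSpace (𝓡 n) p), ‖v‖ ≤ ‖differential P p v‖)
    (p : M) (v : EuclideanSpace ℝ (Fin n)) :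
    ∃ Γ : ℝ → M, Γ 0 = p ∧ ContinuousOn Γ (Icc 0 1) ∧ ∀ t ∈ Icc (0 : ℝ) 1, P (Γ t) = P p + t • v := by
  have hloc := isLocalHomeomorph_of_expanding hP hexp
  let IsLift : (ℝ → M) → ℝ → Prop := fun Γ T =>
    Γ 0 = p ∧ ContinuousOn Γ (Icc 0 T) ∧ ∀ t ∈ Icc (0 : ℝ) T, P (Γ t) = P p + t • v
  let S : Set ℝ := {T | ∃ Γ, IsLift Γ T}
  have mono : ∀ {Γ T T'}, IsLift Γ T → T' ≤ T → IsLift Γ T' := fun h hT =>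
    ⟨h.1, h.2.1.mono (Icc_subset_Icc le_rfl hT), fun t ht => h.2.2 t ⟨ht.1, ht.2.trans hT⟩⟩
  -- Two lifts with the same origin agree on a connected interval, because `P` is locally injective
  -- and `M` is Hausdorff.
  have uniq : ∀ {Γ Γ' T}, 0 ≤ T → IsLift Γ T → IsLift Γ' T → Γ T = Γ' T := by
    intro Γ Γ' T hT h h'
    refine (T2Space.isSeparatedMap P).eqOn_of_comp_eqOn hloc.isLocallyInjective isPreconnected_Icc
      h.2.1 h'.2.1 (fun t ht => ?_) (left_mem_Icc.2 hT) (h.1.trans h'.1.symm) (right_mem_Icc.2 hT)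
    exact (h.2.2 t ht).trans (h'.2.2 t ht).symm
  have h0 : (0 : ℝ) ∈ S := ⟨fun _ => p, rfl, continuousOn_const, fun t ht => by
    have : t = 0 := le_antisymm ht.2 ht.1
    simp [this]⟩
  -- Openness of the set of lifting times: past `T` the lift is continued by a local inverse of `P`
  -- at its endpoint.
  have hext : ∀ T ∈ S, 0 ≤ T → ∃ T' > T, T' ∈ S := by
    rintro T ⟨Γ, hΓ⟩ hT
    obtain ⟨e, he, rfl⟩ := hloc (Γ T)
    have hPT := hΓ.2.2 T (right_mem_Icc.2 hT)
    have hev : ∀ᶠ t in 𝓝 T, e p + t • v ∈ e.target := by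
      have hc : ContinuousAt (fun t : ℝ => e p + t • v) T := by fun_prop
      refine hc (e.open_target.mem_nhds ?_)
      change e p + T • v ∈ e.target
      rw [← hPT]; exact e.map_source he
    obtain ⟨δ, hδ, hball⟩ := Metric.eventually_nhds_iff.1 hev
    refine ⟨T + δ / 2, by linarith, fun t => if t ≤ T then Γ t else e.symm (e p + t • v), ?_, ?_, ?_⟩
    · simp [hT, hΓ.1]
    · refine ContinuousOn.if ?_ ?_ ?_
      · rintro t ⟨ht, hfr⟩
        have : t = T := by
          have := frontier_le_subset_eq continuous_id continuous_const hfr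
          simpa using this
        subst this
        rw [← hPT, e.left_inv he]
      · refine hΓ.2.1.mono ?_
        rintro t ⟨ht, hcl⟩
        exact ⟨ht.1, (isClosed_Iic (a := T)).closure_subset hcl⟩
      · refine e.continuousOn_symm.comp (by fun_prop) ?_
        rintro t ⟨ht, hcl⟩
        have hTt : T ≤ t := by
          have : closure {t : ℝ | ¬ t ≤ T} ⊆ Ici T := by
            refine closure_minimal (fun s hs => (not_le.1 hs).le) isClosed_Ici
          exact this hcl
        refine hball ?_
        rw [Real.dist_eq, abs_of_nonneg (by linarith)]
        linarith [ht.2]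
    · intro t ht
      by_cases h : t ≤ T
      · simp only [h, if_true]; exact hΓ.2.2 t ⟨ht.1, h⟩
      · simp only [h, if_false]
        refine e.right_inv (hball ?_)
        rw [Real.dist_eq, abs_of_nonneg (by linarith)]
        linarith [ht.2]
  have hclosed : ∀ T, 0 < T → (∀ t, 0 ≤ t → t < T → t ∈ S) → T ∈ S := by
    intro T hT hS
    have : Nonempty (ℝ → M) := ⟨fun _ => p⟩
    choose! Γ hΓ using hS
    -- By uniqueness the lifts for different end times patch together, and their diagonal is one
    -- lift on `[0, T)`. It is `‖v‖`-Lipschitz, so completeness supplies the missing endpoint.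
    let G : ℝ → M := fun t => Γ t t
    have hG : ∀ {s t}, 0 ≤ s → s ≤ t → t < T → G s = Γ t s := fun {s t} hs hst htT =>
      (uniq hs (hΓ s hs (hst.trans_lt htT)) (mono (hΓ t (hs.trans hst) htT) hst) : Γ s s = Γ t s)
    have hlip : ∀ {s t}, 0 ≤ s → s ≤ t → t < T → dist (G s) (G t) ≤ ‖v‖ * (t - s) := by
      intro s t hs hst htT
      rw [hG hs hst htT]
      exact dist_lift_le hP hexp (hΓ t (hs.trans hst) htT).2.1 (hΓ t (hs.trans hst) htT).2.2
        hs hst le_rfl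
    -- A sequence in `[0, T)` converging to `T`; its first term is `0`.
    let τ : ℕ → ℝ := fun k => T - T / (k + 1)
    have hτ0 : ∀ k, 0 ≤ τ k := fun k => by
      have : T / (k + 1 : ℝ) ≤ T := div_le_self hT.le (by linarith [Nat.cast_nonneg (α := ℝ) k])
      simpa [τ] using this
    have hτT : ∀ k, τ k < T := fun k => by
      have : 0 < T / (k + 1 : ℝ) := by positivity
      simp only [τ]; linarith
    have hτl : Tendsto τ atTop (𝓝 T) := by
      have h1 : Tendsto (fun k : ℕ => T * (1 / ((k : ℝ) + 1))) atTop (𝓝 (T * 0)) :=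
        tendsto_one_div_add_atTop_nhds_zero_nat.const_mul T
      have h2 := h1.const_sub T
      simpa [τ, div_eq_mul_inv] using h2
    have hcauchy : CauchySeq fun k => G (τ k) := by
      have h3 : CauchySeq τ := hτl.cauchySeq
      rw [Metric.cauchySeq_iff] at h3 ⊢
      intro ε hε
      obtain ⟨K, hK⟩ := h3 (ε / (‖v‖ + 1)) (by positivity)
      have key : ∀ a b : ℝ, 0 ≤ a → a ≤ b → b < T → dist b a < ε / (‖v‖ + 1) →
          dist (G a) (G b) < ε := by
        intro a b ha hab hb hd
        rw [Real.dist_eq, abs_of_nonneg (by linarith), lt_div_iff₀ (by positivity)] at hd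
        refine (hlip ha hab hb).trans_lt ?_
        nlinarith
      refine ⟨K, fun i hi j hj => ?_⟩
      rcases le_total (τ i) (τ j) with h | h
      · exact key _ _ (hτ0 i) h (hτT j) (by rw [dist_comm]; exact hK i hi j hj)
      · rw [dist_comm]; exact key _ _ (hτ0 j) h (hτT i) (hK i hi j hj)
    obtain ⟨q, hq⟩ := cauchySeq_tendsto_of_complete hcauchy
    have hlipT : ∀ s, 0 ≤ s → s < T → dist (G s) q ≤ ‖v‖ * (T - s) := by
      intro s hs hsT
      have h1 : Tendsto (fun k => dist (G s) (G (τ k))) atTop (𝓝 (dist (G s) q)) :=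
        tendsto_const_nhds.dist hq
      have h2 : Tendsto (fun k => ‖v‖ * (τ k - s)) atTop (𝓝 (‖v‖ * (T - s))) :=
        (hτl.sub_const s).const_mul _
      refine le_of_tendsto_of_tendsto h1 h2 ?_
      filter_upwards [hτl.eventually (eventually_gt_nhds hsT)] with k hk
      exact hlip hs hk.le (hτT k)
    let F : ℝ → M := fun t => if t < T then G t else q
    have hFT : F T = q := by simp [F]
    have hFlt : ∀ {t}, t < T → F t = G t := fun {t} h => by simp [F, h]
    have hFlip : ∀ {s t}, 0 ≤ s → s ≤ t → t ≤ T → dist (F s) (F t) ≤ ‖v‖ * (t - s) := by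
      intro s t hs hst htT
      rcases htT.lt_or_eq with h | h
      · rw [hFlt h, hFlt (hst.trans_lt h)]; exact hlip hs hst h
      · subst h
        rcases hst.lt_or_eq with h' | h'
        · rw [hFT, hFlt h']; exact hlipT s hs h'
        · subst h'; simp
    refine ⟨F, ?_, ?_, ?_⟩
    · rw [hFlt hT]; exact (hΓ 0 le_rfl hT).1
    · have : LipschitzOnWith ‖v‖.toNNReal F (Icc 0 T) := by
        refine LipschitzOnWith.of_dist_le_mul fun a ha b hb => ?_
        rw [Real.coe_toNNReal _ (norm_nonneg v)]
        rcases le_total a b with h | h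
        · rw [Real.dist_eq, abs_sub_comm, abs_of_nonneg (by linarith)]
          exact hFlip ha.1 h hb.2
        · rw [dist_comm, Real.dist_eq, abs_of_nonneg (by linarith)]
          exact hFlip hb.1 h ha.2
      exact this.continuousOn
    · intro t ht
      rcases ht.2.lt_or_eq with h | h
      · rw [hFlt h]; exact (hΓ t ht.1 h).2.2 t ⟨ht.1, le_rfl⟩
      · subst h
        rw [hFT]
        have h1 : Tendsto (fun k => P (G (τ k))) atTop (𝓝 (P q)) :=
          (hP.continuous.tendsto q).comp hq
        have h2 : Tendsto (fun k => P p + τ k • v) atTop (𝓝 (P p + t • v)) :=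
          (hτl.smul_const v).const_add _
        refine tendsto_nhds_unique h1 (h2.congr fun k => ?_)
        exact ((hΓ _ (hτ0 k) (hτT k)).2.2 _ ⟨hτ0 k, le_rfl⟩).symm
  have hdown : ∀ {T T'}, T ∈ S → T' ≤ T → T' ∈ S := fun ⟨Γ, h⟩ hT => ⟨Γ, mono h hT⟩
  by_contra hne
  have h1 : (1 : ℝ) ∉ S := hne
  have hbdd : ∀ T ∈ S, T < 1 := fun T hT => by
    by_contra h
    exact h1 (hdown hT (not_lt.1 h))
  have hbd : BddAbove S := ⟨1, fun T hT => (hbdd T hT).le⟩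
  have hs0 : 0 ≤ sSup S := le_csSup hbd h0
  have hmem : sSup S ∈ S := by
    rcases hs0.lt_or_eq with h | h
    · refine hclosed _ h fun t _ ht => ?_
      obtain ⟨T, hT, htT⟩ := exists_lt_of_lt_csSup ⟨0, h0⟩ ht
      exact hdown hT htT.le
    · rw [← h]; exact h0
  obtain ⟨T', hgt, hT'⟩ := hext _ hmem hs0
  exact absurd (le_csSup hbd hT') (not_le.2 hgt)

/-- An expanding map from a complete connected manifold to its model space is a diffeomorphism, and
its inverse is `1`-Lipschitz. -/
theorem exists_smooth_inverse_of_expanding [CompleteSpace M] [ConnectedSpace M]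
    (hP : ContMDiff (𝓡 n) 𝓘(ℝ, EuclideanSpace ℝ (Fin n)) ∞ P)
    (hexp : ∀ (p : M) (v : TangentSpace (𝓡 n) p), ‖v‖ ≤ ‖differential P p v‖) :
    ∃ σ : EuclideanSpace ℝ (Fin n) → M, (∀ y, P (σ y) = y) ∧ (∀ p, σ (P p) = p) ∧
      ContMDiff 𝓘(ℝ, EuclideanSpace ℝ (Fin n)) (𝓡 n) ∞ σ := by
  obtain ⟨p₀⟩ : Nonempty M := inferInstance
  have hloc := isLocalHomeomorph_of_expanding hP hexp
  choose Γ hΓ0 hΓc hΓl using exists_lift_segment hP hexp p₀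
  -- Each lift is continuous in time only. Homotopy lifting for local homeomorphisms makes the
  -- family jointly continuous, hence the endpoint continuous in the direction.
  have hcont : Continuous fun a : unitInterval × EuclideanSpace ℝ (Fin n) => Γ a.2 a.1 := by
    refine hloc.continuous_lift (T2Space.isSeparatedMap P)
      ⟨fun a : unitInterval × EuclideanSpace ℝ (Fin n) => P p₀ + (a.1 : ℝ) • a.2, by fun_prop⟩
      ?_ ?_ ?_
    · ext1 a
      exact hΓl a.2 a.1 a.1.2
    · exact continuous_const.congr fun v => (hΓ0 v).symm
    · intro v
      exact continuousOn_iff_continuous_domRestrict.1 (hΓc v)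
  let σ : EuclideanSpace ℝ (Fin n) → M := fun y => Γ (y - P p₀) 1
  have hσ : Continuous σ :=
    hcont.comp (f := fun y => ((1 : unitInterval), y - P p₀)) (by fun_prop)
  have hPσ : ∀ y, P (σ y) = y := fun y => by
    simp only [σ]
    rw [hΓl _ 1 (by simp)]; simp
  have hp₀ : σ (P p₀) = p₀ := by
    -- The lift of the constant segment has speed bound `0`, so it does not leave `p₀`.
    have h := dist_lift_le hP hexp (hΓc (P p₀ - P p₀)) (hΓl (P p₀ - P p₀)) le_rfl zero_le_one le_rfl
    rw [hΓ0] at h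
    have h2 : dist p₀ (Γ (P p₀ - P p₀) 1) = 0 := le_antisymm (by simpa using h) dist_nonneg
    exact (dist_eq_zero.1 h2).symm
  -- Surjectivity of `P` is now clear; injectivity comes from connectedness, the set where `σ ∘ P`
  -- is the identity being clopen and containing `p₀`.
  have huniv : {q | σ (P q) = q} = univ := by
    refine IsClopen.eq_univ ⟨isClosed_eq (hσ.comp hP.continuous) continuous_id, ?_⟩ ⟨p₀, hp₀⟩
    rw [isOpen_iff_mem_nhds]
    intro q hq
    obtain ⟨e, he, rfl⟩ := hloc q
    have hc : ContinuousAt (fun q => σ (e q)) q := (hσ.comp hP.continuous).continuousAt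
    have hm : ∀ᶠ q' in 𝓝 q, σ (e q') ∈ e.source := by
      refine hc (e.open_source.mem_nhds ?_)
      change σ (e q) ∈ e.source
      rw [show σ (e q) = q from hq]; exact he
    filter_upwards [hm, e.open_source.mem_nhds he] with q' h1 h2
    exact e.injOn h1 h2 (hPσ _)
  refine ⟨σ, hPσ, fun p => (huniv ▸ mem_univ p : p ∈ {q | σ (P q) = q}), fun y => ?_⟩
  rw [← contMDiffWithinAt_univ]
  exact contMDiffWithinAt_lift_of_expanding hP hexp (mem_univ y) (γ := id) contDiffAt_id
    hσ.continuousAt.continuousWithinAt fun t _ => hPσ t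

end GlobalInverse

/-! ### The Hopf-Rinow theorem. -/

section HopfRinow

open Filter Topology

variable {n : ℕ} {M : Type*}

/-- Riemannian manifolds are length spaces. -/
lemma exists_dist_le_dist_le [PseudoMetricSpace M] [ChartedSpace (EuclideanSpace ℝ (Fin n)) M]
    [RiemannianBundle (fun p : M => TangentSpace (𝓡 n) p)] [IsRiemannianManifold (𝓡 n) M]
    {p q : M} {r R : ℝ} (hr : 0 ≤ r) (hrR : r ≤ R) (hpq : dist p q < R) :
    ∃ z, dist p z ≤ r ∧ dist z q ≤ R - r := by
  rcases le_total (dist p q) r with h | h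
  · exact ⟨q, h, by simpa using hrR⟩
  have h1 : riemannianEDist (𝓡 n) p q < ENNReal.ofReal R := by
    rw [← IsRiemannianManifold.out, edist_dist]
    exact ENNReal.ofReal_lt_ofReal_iff_of_nonneg dist_nonneg |>.2 hpq
  obtain ⟨γ, h0, h1', hγ, hlen⟩ := exists_lt_of_riemannianEDist_lt h1
  have hc : ContinuousOn (fun t => dist p (γ t)) (Icc 0 1) :=
    (continuous_const.dist continuous_id).comp_continuousOn hγ.continuousOn
  -- The curve has length below `R` and leaves the ball of radius `r`. At a point of it at distance
  -- exactly `r` from `p`, the first piece has length at least `r`, which leaves less than `R - r`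
  -- for the second.
  obtain ⟨t, ht, htr⟩ : r ∈ (fun t => dist p (γ t)) '' Icc 0 1 :=
    intermediate_value_Icc zero_le_one hc (by simp [h0, h1', hr, h])
  refine ⟨γ t, htr.le, ?_⟩
  have ha : edist p (γ t) ≤ pathELength (𝓡 n) γ 0 t := by
    rw [IsRiemannianManifold.out (I := 𝓡 n)]
    exact riemannianEDist_le_pathELength (hγ.mono (Icc_subset_Icc le_rfl ht.2)) h0 rfl ht.1
  have hb : edist (γ t) q ≤ pathELength (𝓡 n) γ t 1 := by
    rw [IsRiemannianManifold.out (I := 𝓡 n)]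
    exact riemannianEDist_le_pathELength (hγ.mono (Icc_subset_Icc ht.1 le_rfl)) rfl h1' ht.2
  rw [← pathELength_add ht.1 ht.2] at hlen
  have hab := (add_le_add ha hb).trans_lt hlen
  rw [edist_dist, edist_dist, ← ENNReal.ofReal_add dist_nonneg dist_nonneg] at hab
  have := (ENNReal.ofReal_lt_ofReal_iff_of_nonneg (by positivity)).1 hab
  have htr' : dist p (γ t) = r := htr
  linarith

/-- The Hopf-Rinow theorem: closed balls of complete Riemannian manifolds are compact. -/
theorem isCompact_closedBall_of_completeSpace [MetricSpace M]
    [ChartedSpace (EuclideanSpace ℝ (Fin n)) M]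
    [RiemannianBundle (fun p : M => TangentSpace (𝓡 n) p)] [IsRiemannianManifold (𝓡 n) M]
    [CompleteSpace M] (p : M) (r : ℝ) : IsCompact (Metric.closedBall p r) := by
  have : LocallyCompactSpace M := Manifold.locallyCompact_of_finiteDimensional (𝓡 n)
  let S : Set ℝ := {r | IsCompact (Metric.closedBall p r)}
  have hdown : ∀ {r s}, r ∈ S → s ≤ r → s ∈ S := fun {r s} hr hs =>
    IsCompact.of_isClosed_subset hr Metric.isClosed_closedBall (Metric.closedBall_subset_closedBall hs)
  have h0 : (0 : ℝ) ∈ S := by simp [S]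
  have hext : ∀ {r}, 0 ≤ r → r ∈ S → ∃ s > r, s ∈ S := by
    intro r hr hrS
    -- In a length space a slightly larger ball lies in a thickening of the smaller one, and by
    -- local compactness some thickening of a compact set is compact.
    obtain ⟨δ, hδ, hδc⟩ := IsCompact.exists_isCompact_cthickening hrS
    refine ⟨r + δ / 2, by linarith, IsCompact.of_isClosed_subset hδc Metric.isClosed_closedBall ?_⟩
    intro q hq
    obtain ⟨z, hz1, hz2⟩ := exists_dist_le_dist_le (n := n) (p := p) (q := q) (r := r) (R := r + δ)
      hr (by linarith) (by rw [dist_comm]; exact (Metric.mem_closedBall.1 hq).trans_lt (by linarith))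
    refine Metric.mem_cthickening_of_dist_le q z δ _ (by rwa [Metric.mem_closedBall, dist_comm]) ?_
    rw [dist_comm]; linarith
  have hclosed : ∀ {r}, 0 < r → (∀ s, 0 ≤ s → s < r → s ∈ S) → r ∈ S := by
    intro r hr hS
    refine TotallyBounded.isCompact_of_isClosed ?_ Metric.isClosed_closedBall
    rw [Metric.totallyBounded_iff]
    intro ε hε
    -- A point of the `r`-ball is within `r + ε/8 - s ≤ 3ε/8` of the `s`-ball, so an `ε/2`-net of
    -- the latter is an `ε`-net of the former.
    set s := max 0 (r - ε / 4) with hs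
    have hsS : s ∈ S := hS s (le_max_left _ _) (max_lt hr (by linarith))
    obtain ⟨t, htf, ht⟩ := Metric.totallyBounded_iff.1 hsS.totallyBounded (ε / 2) (by linarith)
    refine ⟨t, htf, fun q hq => ?_⟩
    have hsr : s ≤ r := max_le hr.le (by linarith)
    obtain ⟨z, hz1, hz2⟩ := exists_dist_le_dist_le (n := n) (p := p) (q := q) (r := s)
      (R := r + ε / 8) (le_max_left _ _) (by linarith)
      (by rw [dist_comm]; exact (Metric.mem_closedBall.1 hq).trans_lt (by linarith))
    obtain ⟨c, hc, hzc⟩ := mem_iUnion₂.1 (ht (Metric.mem_closedBall.2 (by rwa [dist_comm] at hz1)))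
    refine mem_iUnion₂.2 ⟨c, hc, ?_⟩
    rw [Metric.mem_ball] at hzc ⊢
    have h1 := dist_triangle q z c
    rw [dist_comm q z] at h1
    have h2 : r - ε / 4 ≤ s := le_max_right _ _
    linarith
  by_contra hne
  have hlt : ∀ s ∈ S, s < r := fun s hs => by
    by_contra h
    exact hne (hdown hs (not_lt.1 h))
  have hbd : BddAbove S := ⟨r, fun s hs => (hlt s hs).le⟩
  have hs0 : 0 ≤ sSup S := le_csSup hbd h0
  have hmem : sSup S ∈ S := by
    rcases hs0.lt_or_eq with h | h
    · refine hclosed h fun s _ hs => ?_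
      obtain ⟨T, hT, hsT⟩ := exists_lt_of_lt_csSup ⟨0, h0⟩ hs
      exact hdown hT hsT.le
    · rw [← h]; exact h0
  obtain ⟨s, hgt, hs⟩ := hext hs0 hmem
  exact absurd (le_csSup hbd hs) (not_le.2 hgt)

end HopfRinow

/-! ### Okumura's inequality for trace-free vectors. -/

section Algebra

open Finset

/-- Okumura's inequality, with the square root kept in the form of a bound `β`. -/
lemma sum_pow_three_le {ι : Type*} [Fintype ι] {μ : ι → ℝ} {n : ℝ} (hn : 2 ≤ n)
    (hcard : (Fintype.card ι : ℝ) = n) (h0 : ∑ i, μ i = 0) :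
    ∑ i, μ i ^ 3 ≤ (n - 2) / Real.sqrt (n * (n - 1)) * (∑ i, μ i ^ 2) * Real.sqrt (∑ i, μ i ^ 2) := by
  classical
  set B := ∑ i, μ i ^ 2 with hB
  have hB0 : 0 ≤ B := sum_nonneg fun i _ => sq_nonneg _
  set b := Real.sqrt B with hb
  have hb2 : b ^ 2 = B := Real.sq_sqrt hB0
  have hb0 : 0 ≤ b := Real.sqrt_nonneg _
  set R := Real.sqrt (n * (n - 1)) with hR
  have hRpos : 0 < R := Real.sqrt_pos.2 (by nlinarith)
  have hR2 : R ^ 2 = n * (n - 1) := Real.sq_sqrt (by nlinarith)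
  -- Cauchy-Schwarz for the other `n - 1` entries, whose sum is `-μ i`.
  have hbound : ∀ i, μ i * R ≤ b * (n - 1) := by
    intro i
    have h1 : μ i = - ∑ j ∈ univ.erase i, μ j := by
      have := add_sum_erase univ μ (mem_univ i)
      linarith
    have h2 : ∑ j ∈ univ.erase i, μ j ^ 2 = B - μ i ^ 2 := by
      have := add_sum_erase univ (fun j => μ j ^ 2) (mem_univ i)
      linarith
    have h3 : (∑ j ∈ univ.erase i, μ j) ^ 2 ≤ (n - 1) * (B - μ i ^ 2) := by
      have := sq_sum_le_card_mul_sum_sq (s := univ.erase i) (f := μ)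
      rw [h2, card_erase_of_mem (mem_univ i), card_univ] at this
      have hc : ((Fintype.card ι - 1 : ℕ) : ℝ) = n - 1 := by
        rw [Nat.cast_sub (Fintype.card_pos_iff.2 ⟨i⟩), hcard]; simp
      rwa [hc] at this
    have h4 : n * μ i ^ 2 ≤ (n - 1) * B := by
      have : μ i ^ 2 = (∑ j ∈ univ.erase i, μ j) ^ 2 := by rw [h1]; ring
      nlinarith
    refine le_of_sq_le_sq ?_ (mul_nonneg hb0 (by linarith))
    rw [mul_pow, mul_pow, hR2, hb2]
    nlinarith
  -- The cubic is chosen to vanish in the case of equality, where one entry is `b(n - 1)/R` and the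
  -- others are `-b/R`. Summing it over the entries leaves the power sums of order up to three.
  have hsum : 0 ≤ ∑ i, (b * (n - 1) - μ i * R) * (μ i * R + b) ^ 2 :=
    sum_nonneg fun i _ => mul_nonneg (sub_nonneg.2 (hbound i)) (sq_nonneg _)
  have hexpand : ∑ i, (b * (n - 1) - μ i * R) * (μ i * R + b) ^ 2 =
      (b * (n - 1) * R ^ 2 - 2 * R ^ 2 * b) * B - R ^ 3 * ∑ i, μ i ^ 3 + n * (b ^ 3 * (n - 1))
        + (2 * b ^ 2 * (n - 1) * R - R * b ^ 2) * ∑ i, μ i := by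
    rw [hB, mul_sum, mul_sum, mul_sum, ← hcard, ← nsmul_eq_mul, ← card_univ, ← sum_const,
      ← sum_sub_distrib, ← sum_add_distrib, ← sum_add_distrib]
    exact sum_congr rfl fun i _ => by ring
  rw [hexpand, h0] at hsum
  have h5 : R ^ 3 * ∑ i, μ i ^ 3 ≤ (n - 2) * R ^ 2 * (B * b) := by
    have : n * (b ^ 3 * (n - 1)) = R ^ 2 * (B * b) := by rw [hR2, ← hb2]; ring
    nlinarith
  rw [div_mul_eq_mul_div, div_mul_eq_mul_div, le_div_iff₀ hRpos]
  refine le_of_mul_le_mul_left ?_ (pow_pos hRpos 2)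
  nlinarith

lemma abs_sum_pow_three_le {ι : Type*} [Fintype ι] {μ : ι → ℝ} {n : ℝ} (hn : 2 ≤ n)
    (hcard : (Fintype.card ι : ℝ) = n) (h0 : ∑ i, μ i = 0) :
    |∑ i, μ i ^ 3| ≤ (n - 2) / Real.sqrt (n * (n - 1)) * (∑ i, μ i ^ 2) * Real.sqrt (∑ i, μ i ^ 2) := by
  refine abs_le'.2 ⟨sum_pow_three_le hn hcard h0, ?_⟩
  have h := sum_pow_three_le (μ := fun i => -μ i) hn hcard (by simp [h0])
  have h3 : ∑ i, (-μ i) ^ 3 = -∑ i, μ i ^ 3 := by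
    rw [← sum_neg_distrib]; exact sum_congr rfl fun i _ => by ring
  simpa only [h3, neg_sq] using h

end Algebra

/-! ### A divergence theorem for fields of integrable length. -/

section Divergence

open Filter Topology

variable {n : ℕ}

/-- The cutoff function equal to `1` on `[0, R]` and to `0` on `[2R, ∞)`. -/
noncomputable def cutoff (R t : ℝ) : ℝ := max 0 (min 1 (2 - t / R))

lemma cutoff_nonneg (R t : ℝ) : 0 ≤ cutoff R t := le_max_left _ _

lemma cutoff_eq_one {R t : ℝ} (hR : 0 < R) (ht : t ≤ R) : cutoff R t = 1 := by
  have : t / R ≤ 1 := (div_le_one hR).2 ht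
  rw [cutoff, min_eq_left (by linarith), max_eq_right zero_le_one]

lemma cutoff_eq_zero {R t : ℝ} (hR : 0 < R) (ht : 2 * R ≤ t) : cutoff R t = 0 := by
  have : 2 ≤ t / R := (le_div_iff₀ hR).2 ht
  rw [cutoff, max_eq_left]
  exact (min_le_right _ _).trans (by linarith)

lemma cutoff_mono {R R' t : ℝ} (hR : 0 < R) (hRR' : R ≤ R') (ht : 0 ≤ t) :
    cutoff R t ≤ cutoff R' t := by
  unfold cutoff
  gcongr

lemma abs_cutoff_sub_le {R : ℝ} (hR : 0 < R) (s t : ℝ) :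
    |cutoff R s - cutoff R t| ≤ R⁻¹ * |s - t| := by
  unfold cutoff
  refine (abs_max_sub_max_le_max _ _ _ _).trans ?_
  rw [sub_self, abs_zero, max_eq_right (abs_nonneg _)]
  refine (abs_min_sub_min_le_max _ _ _ _).trans ?_
  rw [sub_self, abs_zero, max_eq_right (abs_nonneg _)]
  rw [show 2 - s / R - (2 - t / R) = R⁻¹ * -(s - t) by ring, abs_mul, abs_neg,
    abs_of_pos (inv_pos.2 hR)]

/-- The divergence of a vector field on Euclidean space. -/
noncomputable def divergence (X : EuclideanSpace ℝ (Fin n) → Fin n → ℝ)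
    (y : EuclideanSpace ℝ (Fin n)) : ℝ :=
  ∑ i, fderiv ℝ (fun y => X y i) y (EuclideanSpace.single i (1 : ℝ))

lemma continuous_divergence {X : EuclideanSpace ℝ (Fin n) → Fin n → ℝ}
    (hX : ∀ i, ContDiff ℝ 1 fun y => X y i) : Continuous (divergence X) :=
  continuous_finsetSum _ fun i _ =>
    ((hX i).continuous_fderiv (by simp)).clm_apply continuous_const

/-- Integration by parts against a compactly supported Lipschitz function. -/
lemma integral_mul_divergence_le {X : EuclideanSpace ℝ (Fin n) → Fin n → ℝ}
    (hX : ∀ i, ContDiff ℝ 1 fun y => X y i) {η : EuclideanSpace ℝ (Fin n) → ℝ} {C : NNReal}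
    (hη : LipschitzWith C η) (hηc : HasCompactSupport η)
    {q : EuclideanSpace ℝ (Fin n) → ℝ} (hq : Integrable q)
    (hbd : ∀ y, DifferentiableAt ℝ η y →
      |fderiv ℝ η y (∑ i, X y i • EuclideanSpace.single i (1 : ℝ))| ≤ q y) :
    ∫ y, η y * divergence X y ≤ ∫ y, q y := by
  obtain ⟨ρ, hρ⟩ := hηc.isBounded.subset_closedBall 0
  -- A bump equal to `1` around the support of `η`: it replaces `X` by a compactly supported field,
  -- as the Lipschitz integration by parts requires, without changing the integral.
  let χ : ContDiffBump (0 : EuclideanSpace ℝ (Fin n)) :=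
    ⟨max ρ 0 + 1, max ρ 0 + 2, by positivity, by linarith⟩
  have hzero : ∀ y, y ∉ tsupport η → η y = 0 := fun y hy => image_eq_zero_of_notMem_tsupport hy
  have hχ1 : ∀ y ∈ tsupport η, (χ : EuclideanSpace ℝ (Fin n) → ℝ) =ᶠ[𝓝 y] fun _ => 1 := by
    intro y hy
    have hlt : dist y 0 < max ρ 0 + 1 :=
      (Metric.mem_closedBall.1 (hρ hy)).trans_lt (by linarith [le_max_left ρ 0])
    exact χ.eventuallyEq_one_of_mem_ball hlt
  let g : Fin n → EuclideanSpace ℝ (Fin n) → ℝ := fun i y => χ y * X y i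
  have hgc : ∀ i, ContDiff ℝ 1 (g i) := fun i => χ.contDiff.mul (hX i)
  have hgs : ∀ i, HasCompactSupport (g i) := fun i => χ.hasCompactSupport.mul_right
  have hint1 : ∀ i, Integrable fun y => lineDeriv ℝ η y (EuclideanSpace.single i (1 : ℝ)) * g i y := by
    intro i
    refine Integrable.bdd_mul (c := C * ‖EuclideanSpace.single i (1 : ℝ)‖)
      ((hgc i).continuous.integrable_of_hasCompactSupport (hgs i)) ?_
      (ae_of_all _ fun y => norm_lineDeriv_le_of_lipschitz ℝ hη)
    exact aestronglyMeasurable_lineDeriv hη.continuous _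
  have hparts : ∀ i, ∫ y, lineDeriv ℝ η y (EuclideanSpace.single i (1 : ℝ)) * g i y =
      - ∫ y, η y * fderiv ℝ (fun y => X y i) y (EuclideanSpace.single i (1 : ℝ)) := by
    intro i
    obtain ⟨D, hD⟩ := (hgc i).lipschitzWith_of_hasCompactSupport (hgs i) (by simp)
    rw [hη.integral_lineDeriv_mul_eq hD (hgs i), ← integral_neg]
    refine integral_congr_ae (ae_of_all _ fun y => ?_)
    simp only
    by_cases hy : y ∈ tsupport η
    · have heq : g i =ᶠ[𝓝 y] fun y => X y i := by
        filter_upwards [hχ1 y hy] with z hz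
        simp [g, hz]
      rw [((hgc i).differentiable (by simp) y).lineDeriv_eq_fderiv, heq.fderiv_eq, map_neg]
      ring
    · rw [hzero y hy]; ring
  have hint2 : ∀ i, Integrable fun y =>
      η y * fderiv ℝ (fun y => X y i) y (EuclideanSpace.single i (1 : ℝ)) := by
    intro i
    refine Continuous.integrable_of_hasCompactSupport ?_ hηc.mul_right
    exact hη.continuous.mul (((hX i).continuous_fderiv (by simp)).clm_apply continuous_const)
  have hsum : ∫ y, η y * divergence X y =
      - ∫ y, ∑ i, lineDeriv ℝ η y (EuclideanSpace.single i (1 : ℝ)) * g i y := by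
    rw [integral_finsetSum _ fun i _ => hint1 i]
    simp only [divergence, Finset.mul_sum]
    rw [integral_finsetSum _ fun i _ => hint2 i, ← Finset.sum_neg_distrib]
    exact Finset.sum_congr rfl fun i _ => by rw [hparts i, neg_neg]
  rw [hsum, ← integral_neg]
  refine integral_mono_ae (integrable_finsetSum _ fun i _ => hint1 i).neg hq ?_
  -- By Rademacher's theorem the bound, known only at points of differentiability, suffices.
  filter_upwards [hη.ae_differentiableAt] with y hy
  have h1 : ∑ i, lineDeriv ℝ η y (EuclideanSpace.single i (1 : ℝ)) * g i y =
      χ y * fderiv ℝ η y (∑ i, X y i • EuclideanSpace.single i (1 : ℝ)) := by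
    rw [map_sum, Finset.mul_sum]
    refine Finset.sum_congr rfl fun i _ => ?_
    rw [hy.lineDeriv_eq_fderiv, map_smul, smul_eq_mul]
    simp only [g]; ring
  rw [h1]
  refine (neg_le_abs _).trans ?_
  rw [abs_mul, abs_of_nonneg χ.nonneg]
  exact (mul_le_of_le_one_left (abs_nonneg _) χ.le_one).trans (hbd y hy)

/-- A vector field with nonnegative divergence and with integrable length is divergence free. The
length is measured by the increments of an exhaustion function `d`. -/
theorem divergence_eq_zero_of_nonneg {X : EuclideanSpace ℝ (Fin n) → Fin n → ℝ}
    (hX : ∀ i, ContDiff ℝ 1 fun y => X y i) (hdiv : ∀ y, 0 ≤ divergence X y)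
    {d : EuclideanSpace ℝ (Fin n) → ℝ} (hd0 : ∀ y, 0 ≤ d y) (hd : LipschitzWith 1 d)
    (hdc : ∀ r, IsCompact {y | d y ≤ r})
    {q : EuclideanSpace ℝ (Fin n) → ℝ} (hq : Integrable q)
    (hdq : ∀ y, ∀ ε > 0, ∀ᶠ t in 𝓝[>] (0 : ℝ),
      |d (y + t • ∑ i, X y i • EuclideanSpace.single i (1 : ℝ)) - d y| ≤ t * (q y + ε))
    (y : EuclideanSpace ℝ (Fin n)) : divergence X y = 0 := by
  let η : ℝ → EuclideanSpace ℝ (Fin n) → ℝ := fun R y => cutoff R (d y)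
  have hlip : ∀ {R : ℝ}, 0 < R → LipschitzWith R⁻¹.toNNReal (η R) := fun {R} hR => by
    refine LipschitzWith.of_dist_le_mul fun a b => ?_
    rw [Real.coe_toNNReal _ (inv_pos.2 hR).le, Real.dist_eq]
    refine (abs_cutoff_sub_le hR _ _).trans ?_
    gcongr
    simpa [Real.dist_eq] using hd.dist_le_mul a b
  have hsupp : ∀ {R : ℝ}, 0 < R → HasCompactSupport (η R) := fun {R} hR => by
    refine HasCompactSupport.intro (hdc (2 * R)) fun y hy => ?_
    exact cutoff_eq_zero hR (not_le.1 hy).le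
  have hle : ∀ {R : ℝ}, 0 < R → ∫ y, η R y * divergence X y ≤ R⁻¹ * ∫ y, q y := by
    intro R hR
    rw [← integral_const_mul]
    refine integral_mul_divergence_le hX (hlip hR) (hsupp hR) (hq.const_mul _) fun y hy => ?_
    set v := ∑ i, X y i • EuclideanSpace.single i (1 : ℝ) with hv
    refine le_of_forall_pos_le_add fun ε hε => ?_
    -- The function `d` need not be differentiable where its cutoff is, so the derivative of the
    -- cutoff is bounded through difference quotients: the increments of `d` are controlled by `q`,
    -- and the cutoff contributes the factor `R⁻¹`.
    have hlim : Tendsto (fun t : ℝ => |t⁻¹ • (η R (y + t • v) - η R y)|) (𝓝[>] 0)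
        (𝓝 |fderiv ℝ (η R) y v|) :=
      ((hy.hasFDerivAt.hasLineDerivAt v).tendsto_slope_zero_right).abs
    refine le_of_tendsto hlim ?_
    filter_upwards [hdq y (ε * R) (mul_pos hε hR), self_mem_nhdsWithin] with t ht htpos
    have htpos : 0 < t := htpos
    rw [smul_eq_mul, abs_mul, abs_of_pos (inv_pos.2 htpos), inv_mul_le_iff₀ htpos]
    refine (abs_cutoff_sub_le hR _ _).trans ?_
    rw [inv_mul_le_iff₀ hR]
    refine ht.trans (le_of_eq ?_)
    field_simp
  have hηd : ∀ {R : ℝ}, 0 < R → Continuous fun y => η R y * divergence X y := fun {R} hR =>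
    (hlip hR).continuous.mul (continuous_divergence hX)
  have hηi : ∀ {R : ℝ}, 0 < R → Integrable fun y => η R y * divergence X y := fun {R} hR =>
    (hηd hR).integrable_of_hasCompactSupport (hsupp hR).mul_right
  have hR₀ : 0 < d y + 1 := by linarith [hd0 y]
  -- The cutoffs increase with `R`, so a fixed one is dominated by all later ones, whose integrals
  -- are at most `R⁻¹ ∫ q → 0`. The radius `d y + 1` makes the cutoff equal to `1` at `y`.
  have hzero : ∫ z, η (d y + 1) z * divergence X z ≤ 0 := by
    have hlim : Tendsto (fun R : ℝ => R⁻¹ * ∫ y, q y) atTop (𝓝 (0 * ∫ y, q y)) :=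
      tendsto_inv_atTop_zero.mul_const _
    rw [zero_mul] at hlim
    refine ge_of_tendsto hlim ?_
    filter_upwards [eventually_ge_atTop (d y + 1)] with R hR
    refine (integral_mono (hηi hR₀) (hηi (hR₀.trans_le hR)) fun z => ?_).trans (hle (hR₀.trans_le hR))
    exact mul_le_mul_of_nonneg_right (cutoff_mono hR₀ hR (hd0 z)) (hdiv z)
  by_contra hne
  have hpos := (hηd hR₀).integral_pos_of_hasCompactSupport_nonneg_nonzero (hsupp hR₀).mul_right
    (fun z => mul_nonneg (cutoff_nonneg _ _) (hdiv z)) (x := y) (μ := volume)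
    (by simp only [η]; rw [cutoff_eq_one hR₀ (by linarith), one_mul]; exact hne)
  linarith

end Divergence

/-! ### The Lorentzian product. -/

section LorentzForm

variable {n : ℕ}

/-- The projection of the Lorentzian space onto the first `n` coordinates. -/
noncomputable def spatial (n : ℕ) : LorentzSpace n →L[ℝ] EuclideanSpace ℝ (Fin n) :=
  LinearMap.toContinuousLinearMap
    { toFun := fun X => WithLp.toLp 2 fun i => X i.castSucc
      map_add' := fun _ _ => rfl
      map_smul' := fun _ _ => rfl }

@[simp] lemma spatial_apply (X : LorentzSpace n) (i : Fin n) : spatial n X i = X i.castSucc := rfl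

/-- The last coordinate of the Lorentzian space. -/
noncomputable def temporal (n : ℕ) : LorentzSpace n →L[ℝ] ℝ :=
  EuclideanSpace.proj (Fin.last n)

@[simp] lemma temporal_apply (X : LorentzSpace n) : temporal n X = X (Fin.last n) := rfl

lemma lorentz_eq (X Y : LorentzSpace n) :
    lorentz X Y = ⟪spatial n X, spatial n Y⟫_ℝ - temporal n X * temporal n Y := by
  simp [lorentz, PiLp.inner_apply, mul_comm]

/-- The Lorentzian product as a continuous bilinear form. -/
noncomputable def lorentzL (n : ℕ) : LorentzSpace n →L[ℝ] LorentzSpace n →L[ℝ] ℝ :=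
  ∑ i : Fin n, (ContinuousLinearMap.mul ℝ ℝ).bilinearComp
      (EuclideanSpace.proj i.castSucc) (EuclideanSpace.proj i.castSucc) -
    (ContinuousLinearMap.mul ℝ ℝ).bilinearComp (temporal n) (temporal n)

@[simp] lemma lorentzL_apply (X Y : LorentzSpace n) : lorentzL n X Y = lorentz X Y := by
  simp [lorentzL, lorentz]

lemma lorentz_comm (X Y : LorentzSpace n) : lorentz X Y = lorentz Y X := by
  simp [lorentz, mul_comm]

lemma lorentz_add_left (X Y Z : LorentzSpace n) : lorentz (X + Y) Z = lorentz X Z + lorentz Y Z := by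
  simp [← lorentzL_apply]

lemma lorentz_smul_left (c : ℝ) (X Z : LorentzSpace n) : lorentz (c • X) Z = c * lorentz X Z := by
  simp [← lorentzL_apply]

lemma lorentz_add_right (X Y Z : LorentzSpace n) : lorentz X (Y + Z) = lorentz X Y + lorentz X Z := by
  simp [← lorentzL_apply]

lemma lorentz_smul_right (c : ℝ) (X Z : LorentzSpace n) : lorentz X (c • Z) = c * lorentz X Z := by
  simp [← lorentzL_apply]

lemma lorentz_sum_left {ι : Type*} (s : Finset ι) (X : ι → LorentzSpace n) (Z : LorentzSpace n) :
    lorentz (∑ i ∈ s, X i) Z = ∑ i ∈ s, lorentz (X i) Z := by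
  simp [← lorentzL_apply]

lemma lorentz_sum_right {ι : Type*} (s : Finset ι) (X : ι → LorentzSpace n) (Z : LorentzSpace n) :
    lorentz Z (∑ i ∈ s, X i) = ∑ i ∈ s, lorentz Z (X i) := by
  simp [← lorentzL_apply]

end LorentzForm

/-! ### Derivatives of determinants and inverses, and basis independence of traces. -/

section MatrixCalculus

open Matrix

/-- Jacobi's formula for the derivative of a determinant. -/
lemma HasFDerivAt.matrix_det {W : Type*} [NormedAddCommGroup W] [NormedSpace ℝ W] {n : ℕ}
    {A : W → Matrix (Fin n) (Fin n) ℝ} {A' : Fin n → Fin n → W →L[ℝ] ℝ} {y : W}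
    (hA : ∀ i j, HasFDerivAt (fun y => A y i j) (A' i j) y) :
    HasFDerivAt (fun y => (A y).det)
      (∑ i, ∑ j, (A y).adjugate i j • A' j i) y := by
  have h1 : HasFDerivAt (fun y => ∑ σ : Equiv.Perm (Fin n), ((Equiv.Perm.sign σ : ℤ) : ℝ) * ∏ i, A y (σ i) i)
      (∑ σ : Equiv.Perm (Fin n), ((Equiv.Perm.sign σ : ℤ) : ℝ) •
        ∑ i, (∏ j ∈ Finset.univ.erase i, A y (σ j) j) • A' (σ i) i) y := by
    refine HasFDerivAt.fun_sum fun σ _ => HasFDerivAt.const_mul ?_ _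
    exact HasFDerivAt.finsetProd fun i _ => hA (σ i) i
  have h2 : (fun y => (A y).det) = fun y => ∑ σ : Equiv.Perm (Fin n),
      ((Equiv.Perm.sign σ : ℤ) : ℝ) * ∏ i, A y (σ i) i := by
    funext y; exact det_apply' (A y)
  rw [h2]
  convert h1 using 1
  ext v
  simp only [_root_.sum_apply, _root_.smul_apply, smul_eq_mul]
  -- By Cramer's rule this sum is the determinant with the `i`-th column differentiated, and its
  -- Leibniz expansion is the `i`-th part of the product rule.
  have h3 : ∀ i, ∑ j, (A y).adjugate i j * A' j i v =
      ∑ σ : Equiv.Perm (Fin n), ((Equiv.Perm.sign σ : ℤ) : ℝ) *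
        ((∏ j ∈ Finset.univ.erase i, A y (σ j) j) * A' (σ i) i v) := by
    intro i
    have h4 : ∑ j, (A y).adjugate i j * A' j i v = ((A y).updateCol i fun j => A' j i v).det := by
      rw [← cramer_apply, cramer_eq_adjugate_mulVec]; rfl
    rw [h4, det_apply']
    refine Finset.sum_congr rfl fun σ _ => ?_
    congr 1
    rw [← Finset.mul_prod_erase _ _ (Finset.mem_univ i), updateCol_self, mul_comm]
    congr 1
    refine Finset.prod_congr rfl fun j hj => ?_
    rw [updateCol_ne (Finset.ne_of_mem_erase hj)]
  simp_rw [h3, Finset.mul_sum]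
  exact Finset.sum_comm

variable {W : Type*} [NormedAddCommGroup W] [NormedSpace ℝ W] {n : ℕ}
  {A : W → Matrix (Fin n) (Fin n) ℝ} {y : W} {k : WithTop ℕ∞}

lemma ContDiffAt.matrix_det (hA : ∀ i j, ContDiffAt ℝ k (fun y => A y i j) y) :
    ContDiffAt ℝ k (fun y => (A y).det) y := by
  simp only [det_apply']
  refine ContDiffAt.sum fun σ _ => contDiffAt_const.mul ?_
  exact contDiffAt_prod fun i _ => hA (σ i) i

lemma ContDiffAt.matrix_inv (hA : ∀ i j, ContDiffAt ℝ k (fun y => A y i j) y)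
    (h0 : (A y).det ≠ 0) (i j : Fin n) : ContDiffAt ℝ k (fun y => (A y)⁻¹ i j) y := by
  simp only [inv_def, Ring.inverse_eq_inv', Matrix.smul_apply, smul_eq_mul, adjugate_apply]
  refine ((ContDiffAt.matrix_det hA).inv h0).mul (ContDiffAt.matrix_det fun a b => ?_)
  by_cases h : a = j
  · subst h; simp only [updateRow_self]; exact contDiffAt_const
  · simp only [updateRow_ne h]; exact hA a b

/-- The contraction of a bilinear form with the inverse metric does not depend on the basis. -/
lemma trace_inv_mul_transpose_congr {a b : Type*} [Fintype a] [Fintype b] [DecidableEq a]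
    [DecidableEq b] {g β : Matrix a a ℝ} {C : Matrix a b ℝ} {D : Matrix b a ℝ}
    (hCD : C * D = 1) (hDC : D * C = 1) (hg : IsUnit g.det) :
    ((Cᵀ * g * C)⁻¹ * (Cᵀ * β * C)ᵀ).trace = (g⁻¹ * βᵀ).trace := by
  have hDC' : Dᵀ * Cᵀ = 1 := by rw [← transpose_mul, hCD, transpose_one]
  have hinv : (Cᵀ * g * C)⁻¹ = D * g⁻¹ * Dᵀ := by
    refine inv_eq_left_inv ?_
    calc D * g⁻¹ * Dᵀ * (Cᵀ * g * C) = D * (g⁻¹ * (Dᵀ * Cᵀ) * g) * C := by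
          simp only [Matrix.mul_assoc]
      _ = 1 := by rw [hDC', Matrix.mul_one, nonsing_inv_mul _ hg, Matrix.mul_one, hDC]
  rw [hinv]
  calc (D * g⁻¹ * Dᵀ * (Cᵀ * β * C)ᵀ).trace = (D * (g⁻¹ * (Dᵀ * Cᵀ) * βᵀ * C)).trace := by
        simp only [transpose_mul, transpose_transpose, Matrix.mul_assoc]
    _ = (g⁻¹ * βᵀ).trace := by
        rw [trace_mul_comm, hDC', Matrix.mul_one, Matrix.mul_assoc, hCD, Matrix.mul_one]

lemma trace_inv_mul_transpose {n : Type*} [Fintype n] [DecidableEq n] (g β : Matrix n n ℝ) :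
    (g⁻¹ * βᵀ).trace = ∑ i, ∑ j, g⁻¹ i j * β i j := by
  simp [trace, mul_apply]

/-- The squared norm of a bilinear form in an arbitrary basis. -/
lemma trace_inv_mul_mul_inv_mul {a b : Type*} [Fintype a] [Fintype b] [DecidableEq a]
    [DecidableEq b] {β : Matrix a a ℝ} {C : Matrix a b ℝ} {D : Matrix b a ℝ}
    (hCD : C * D = 1) (hDC : D * C = 1) :
    ((Cᵀ * C)⁻¹ * (Cᵀ * β * C) * (Cᵀ * C)⁻¹ * (Cᵀ * β * C)ᵀ).trace = (β * βᵀ).trace := by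
  have hDC' : Dᵀ * Cᵀ = 1 := by rw [← transpose_mul, hCD, transpose_one]
  have hinv : (Cᵀ * C)⁻¹ = D * Dᵀ := by
    refine inv_eq_left_inv ?_
    calc D * Dᵀ * (Cᵀ * C) = D * (Dᵀ * Cᵀ) * C := by simp only [Matrix.mul_assoc]
      _ = 1 := by rw [hDC', Matrix.mul_one, hDC]
  rw [hinv]
  calc (D * Dᵀ * (Cᵀ * β * C) * (D * Dᵀ) * (Cᵀ * β * C)ᵀ).trace
      = (D * ((Dᵀ * Cᵀ) * β * (C * D) * (Dᵀ * Cᵀ) * βᵀ * C)).trace := by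
        simp only [transpose_mul, transpose_transpose, Matrix.mul_assoc]
    _ = (β * βᵀ).trace := by
        rw [trace_mul_comm, hDC', hCD, Matrix.one_mul, Matrix.mul_one, Matrix.mul_one,
          Matrix.mul_assoc, hCD, Matrix.mul_one]

end MatrixCalculus

/-! ### Gradient and Laplacian of a parametrized hypersurface, and their independence of
coordinates. -/

section CoordinateLaplacian

open Matrix Filter Topology

variable {n : ℕ}

/-- The partial derivative in the direction of the `i`-th coordinate. -/
noncomputable def partialDeriv {V : Type*} [NormedAddCommGroup V] [NormedSpace ℝ V]
    (f : EuclideanSpace ℝ (Fin n) → V) (i : Fin n) (y : EuclideanSpace ℝ (Fin n)) : V :=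
  fderiv ℝ f y (EuclideanSpace.single i (1 : ℝ))

lemma ContDiffAt.partialDeriv {V : Type*} [NormedAddCommGroup V] [NormedSpace ℝ V]
    {f : EuclideanSpace ℝ (Fin n) → V} {y : EuclideanSpace ℝ (Fin n)} (hf : ContDiffAt ℝ ∞ f y)
    (i : Fin n) : ContDiffAt ℝ ∞ (partialDeriv f i) y :=
  (hf.fderiv_right (m := ∞) (by simp)).clm_apply contDiffAt_const

lemma ContDiff.partialDeriv {V : Type*} [NormedAddCommGroup V] [NormedSpace ℝ V]
    {f : EuclideanSpace ℝ (Fin n) → V} (hf : ContDiff ℝ ∞ f)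
    (i : Fin n) : ContDiff ℝ ∞ (partialDeriv f i) :=
  contDiff_iff_contDiffAt.2 fun _ => hf.contDiffAt.partialDeriv i

lemma fderiv_apply_eq_sum {V : Type*} [NormedAddCommGroup V] [NormedSpace ℝ V]
    (f : EuclideanSpace ℝ (Fin n) → V) (y v : EuclideanSpace ℝ (Fin n)) :
    fderiv ℝ f y v = ∑ i, v i • partialDeriv f i y := by
  conv_lhs => rw [← (EuclideanSpace.basisFun (Fin n) ℝ).sum_repr v]
  simp [partialDeriv]

lemma partialDeriv_comm {V : Type*} [NormedAddCommGroup V] [NormedSpace ℝ V]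
    {f : EuclideanSpace ℝ (Fin n) → V} {y : EuclideanSpace ℝ (Fin n)} (hf : ContDiffAt ℝ ∞ f y)
    (i j : Fin n) :
    partialDeriv (partialDeriv f i) j y = partialDeriv (partialDeriv f j) i y := by
  have hd : DifferentiableAt ℝ (fderiv ℝ f) y :=
    (hf.fderiv_right (m := ∞) (by simp)).differentiableAt (by simp)
  have key : ∀ i j, partialDeriv (partialDeriv f i) j y =
      fderiv ℝ (fderiv ℝ f) y (EuclideanSpace.single j 1) (EuclideanSpace.single i 1) := by
    intro i j
    have h : partialDeriv f i = fun y => fderiv ℝ f y (EuclideanSpace.single i 1) := rfl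
    rw [partialDeriv, h, fderiv_clm_apply hd (differentiableAt_const _)]
    simp
  rw [key, key]
  exact (hf.isSymmSndFDerivAt (by simpa using ENat.LEInfty.out)).eq _ _

/-- The matrix of the metric induced by a parametrization of a hypersurface. -/
noncomputable def gramMatrix (F : EuclideanSpace ℝ (Fin n) → LorentzSpace n)
    (y : EuclideanSpace ℝ (Fin n)) : Matrix (Fin n) (Fin n) ℝ :=
  Matrix.of fun i j => lorentz (partialDeriv F i y) (partialDeriv F j y)

/-- The Laplace-Beltrami operator of a metric given in coordinates. -/
noncomputable def coordLaplacian (g : EuclideanSpace ℝ (Fin n) → Matrix (Fin n) (Fin n) ℝ)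
    (v : EuclideanSpace ℝ (Fin n) → ℝ) (y : EuclideanSpace ℝ (Fin n)) : ℝ :=
  (Real.sqrt (g y).det)⁻¹ * ∑ i,
    partialDeriv (fun y => Real.sqrt (g y).det * ∑ j, (g y)⁻¹ i j * partialDeriv v j y) i y

/-- The coefficients of the gradient in coordinates. -/
noncomputable def coordGradient (g : EuclideanSpace ℝ (Fin n) → Matrix (Fin n) (Fin n) ℝ)
    (v : EuclideanSpace ℝ (Fin n) → ℝ) (y : EuclideanSpace ℝ (Fin n)) (i : Fin n) : ℝ :=
  ∑ j, (g y)⁻¹ i j * partialDeriv v j y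

/-- The gradient of a function on a parametrized hypersurface, as a vector of the ambient space. -/
noncomputable def ambientGradient (F : EuclideanSpace ℝ (Fin n) → LorentzSpace n)
    (v : EuclideanSpace ℝ (Fin n) → ℝ) (y : EuclideanSpace ℝ (Fin n)) : LorentzSpace n :=
  ∑ i, coordGradient (gramMatrix F) v y i • partialDeriv F i y

lemma gramMatrix_symm (F : EuclideanSpace ℝ (Fin n) → LorentzSpace n)
    (y : EuclideanSpace ℝ (Fin n)) : (gramMatrix F y)ᵀ = gramMatrix F y := by
  ext i j; simp [gramMatrix, lorentz_comm]

lemma ContDiffAt.lorentz {W : Type*} [NormedAddCommGroup W] [NormedSpace ℝ W]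
    {X Y : W → LorentzSpace n} {y : W} {k : WithTop ℕ∞} (hX : ContDiffAt ℝ k X y)
    (hY : ContDiffAt ℝ k Y y) : ContDiffAt ℝ k (fun y => lorentz (X y) (Y y)) y := by
  simp only [← lorentzL_apply]
  exact ((lorentzL n).contDiff.contDiffAt.comp y hX).clm_apply hY

lemma HasFDerivAt.lorentz {W : Type*} [NormedAddCommGroup W] [NormedSpace ℝ W]
    {X Y : W → LorentzSpace n} {X' Y' : W →L[ℝ] LorentzSpace n} {y : W} (hX : HasFDerivAt X X' y)
    (hY : HasFDerivAt Y Y' y) :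
    HasFDerivAt (fun y => lorentz (X y) (Y y))
      ((lorentzL n).precompR W (X y) Y' + (lorentzL n).precompL W X' (Y y)) y := by
  simp only [← lorentzL_apply]
  exact (lorentzL n).hasFDerivAt_of_bilinear hX hY

lemma fderiv_lorentz_apply {W : Type*} [NormedAddCommGroup W] [NormedSpace ℝ W]
    {X Y : W → LorentzSpace n} {y : W} (hX : DifferentiableAt ℝ X y)
    (hY : DifferentiableAt ℝ Y y) (v : W) :
    fderiv ℝ (fun y => lorentz (X y) (Y y)) y v =
      lorentz (X y) (fderiv ℝ Y y v) + lorentz (fderiv ℝ X y v) (Y y) := by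
  rw [(hX.hasFDerivAt.lorentz hY.hasFDerivAt).fderiv]
  simp

variable {F : EuclideanSpace ℝ (Fin n) → LorentzSpace n} {v : EuclideanSpace ℝ (Fin n) → ℝ}
  {y : EuclideanSpace ℝ (Fin n)}

lemma contDiffAt_gramMatrix (hF : ContDiffAt ℝ ∞ F y) (i j : Fin n) :
    ContDiffAt ℝ ∞ (fun y => gramMatrix F y i j) y := by
  simp only [gramMatrix, of_apply]
  exact (hF.partialDeriv i).lorentz (hF.partialDeriv j)

lemma contDiffAt_coordGradient (hF : ContDiffAt ℝ ∞ F y) (hv : ContDiffAt ℝ ∞ v y)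
    (hdet : 0 < (gramMatrix F y).det) (i : Fin n) :
    ContDiffAt ℝ ∞ (fun y => coordGradient (gramMatrix F) v y i) y :=
  ContDiffAt.sum fun j _ =>
    (ContDiffAt.matrix_inv (contDiffAt_gramMatrix hF) hdet.ne' i j).mul (hv.partialDeriv j)

lemma contDiffAt_sqrt_det (hF : ContDiffAt ℝ ∞ F y) (hdet : 0 < (gramMatrix F y).det) :
    ContDiffAt ℝ ∞ (fun y => Real.sqrt (gramMatrix F y).det) y :=
  (ContDiffAt.matrix_det (contDiffAt_gramMatrix hF)).sqrt hdet.ne'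

lemma partialDeriv_gramMatrix (hF : ContDiffAt ℝ ∞ F y) (i j k : Fin n) :
    partialDeriv (fun y => gramMatrix F y i j) k y =
      lorentz (partialDeriv (partialDeriv F i) k y) (partialDeriv F j y) +
      lorentz (partialDeriv (partialDeriv F j) k y) (partialDeriv F i y) := by
  simp only [gramMatrix, of_apply]
  rw [partialDeriv, fderiv_lorentz_apply ((hF.partialDeriv i).differentiableAt (by simp))
    ((hF.partialDeriv j).differentiableAt (by simp)), lorentz_comm (partialDeriv F i y), add_comm]
  rfl

/-- Jacobi's formula gives `∂ₖ √det g = ½ √det g · gⁱʲ ∂ₖgᵢⱼ`. The two terms of `∂ₖ⟨Fᵢ, Fⱼ⟩`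
contribute equally because `g⁻¹` is symmetric, which cancels the `½`. The double sum is the
contracted Christoffel symbol `Γⁱᵢₖ`. -/
lemma partialDeriv_sqrt_det (hF : ContDiffAt ℝ ∞ F y) (hdet : 0 < (gramMatrix F y).det)
    (k : Fin n) :
    partialDeriv (fun y => Real.sqrt (gramMatrix F y).det) k y =
      Real.sqrt (gramMatrix F y).det * ∑ i, ∑ j, (gramMatrix F y)⁻¹ i j *
        lorentz (partialDeriv (partialDeriv F k) i y) (partialDeriv F j y) := by
  have hg : ∀ i j, HasFDerivAt (fun y => gramMatrix F y i j)
      (fderiv ℝ (fun y => gramMatrix F y i j) y) y := fun i j =>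
    ((contDiffAt_gramMatrix hF i j).differentiableAt (by simp)).hasFDerivAt
  have h1 := (HasFDerivAt.matrix_det hg).sqrt hdet.ne'
  have hadj : (gramMatrix F y).adjugate = (gramMatrix F y).det • (gramMatrix F y)⁻¹ := by
    rw [inv_def, smul_smul, Ring.inverse_eq_inv', mul_inv_cancel₀ hdet.ne', one_smul]
  rw [partialDeriv, h1.fderiv]
  simp only [_root_.smul_apply, _root_.sum_apply, smul_eq_mul, hadj, Matrix.smul_apply]
  have h2 : ∀ i j, fderiv ℝ (fun y => gramMatrix F y j i) y (EuclideanSpace.single k (1 : ℝ)) =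
      lorentz (partialDeriv (partialDeriv F k) j y) (partialDeriv F i y) +
      lorentz (partialDeriv (partialDeriv F k) i y) (partialDeriv F j y) := by
    intro i j
    have := partialDeriv_gramMatrix hF j i k
    rw [partialDeriv_comm hF j k, partialDeriv_comm hF i k] at this
    exact this
  have hsymm : ∀ i j, (gramMatrix F y)⁻¹ i j = (gramMatrix F y)⁻¹ j i := by
    intro i j
    conv_lhs => rw [← gramMatrix_symm, ← transpose_nonsing_inv, transpose_apply]
  have h3 : ∑ i, ∑ j, (gramMatrix F y).det * (gramMatrix F y)⁻¹ i j *
      fderiv ℝ (fun y => gramMatrix F y j i) y (EuclideanSpace.single k (1 : ℝ)) =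
      2 * (gramMatrix F y).det * ∑ i, ∑ j, (gramMatrix F y)⁻¹ i j *
        lorentz (partialDeriv (partialDeriv F k) i y) (partialDeriv F j y) := by
    simp_rw [h2, mul_add, Finset.sum_add_distrib]
    rw [Finset.sum_comm]
    simp_rw [hsymm _ _, mul_assoc, ← Finset.mul_sum]
    ring_nf
  rw [h3]
  have hs := Real.sq_sqrt hdet.le
  have hs0 := Real.sqrt_pos.2 hdet
  field_simp
  rw [hs]

lemma partialDeriv_sum_smul {c : Fin n → EuclideanSpace ℝ (Fin n) → ℝ}
    (hF : ContDiffAt ℝ ∞ F y) (hc : ∀ i, DifferentiableAt ℝ (c i) y) (k : Fin n) :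
    partialDeriv (fun y => ∑ i, c i y • partialDeriv F i y) k y =
      ∑ i, (partialDeriv (c i) k y • partialDeriv F i y +
        c i y • partialDeriv (partialDeriv F i) k y) := by
  have h : HasFDerivAt (fun y => ∑ i, c i y • partialDeriv F i y)
      (∑ i, (c i y • fderiv ℝ (partialDeriv F i) y +
        (fderiv ℝ (c i) y).smulRight (partialDeriv F i y))) y :=
    HasFDerivAt.fun_sum fun i _ => (hc i).hasFDerivAt.smul
      ((hF.partialDeriv i).differentiableAt (by simp)).hasFDerivAt
  rw [partialDeriv, h.fderiv]
  simp only [_root_.sum_apply, _root_.add_apply, _root_.smul_apply,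
    ContinuousLinearMap.smulRight_apply]
  exact Finset.sum_congr rfl fun i _ => by rw [add_comm]; rfl

/-- The Laplacian in coordinates is the divergence along the hypersurface of the ambient
gradient. -/
lemma coordLaplacian_eq (hF : ContDiffAt ℝ ∞ F y) (hv : ContDiffAt ℝ ∞ v y)
    (hdet : 0 < (gramMatrix F y).det) :
    coordLaplacian (gramMatrix F) v y = ∑ i, ∑ j, (gramMatrix F y)⁻¹ i j *
      lorentz (partialDeriv (ambientGradient F v) i y) (partialDeriv F j y) := by
  set g := gramMatrix F with hg
  set c : Fin n → EuclideanSpace ℝ (Fin n) → ℝ := fun i y => coordGradient g v y i with hc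
  have hcd : ∀ i, DifferentiableAt ℝ (c i) y := fun i =>
    (contDiffAt_coordGradient hF hv hdet i).differentiableAt (by simp)
  have hρd : DifferentiableAt ℝ (fun y => Real.sqrt (g y).det) y :=
    (contDiffAt_sqrt_det hF hdet).differentiableAt (by simp)
  have hρ : Real.sqrt (g y).det ≠ 0 := (Real.sqrt_pos.2 hdet).ne'
  have hinv : ∀ k i, ∑ j, (g y)⁻¹ i j * g y k j = if k = i then 1 else 0 := by
    intro k i
    have h1 : ((g y)⁻¹ * (g y)ᵀ) i k = (1 : Matrix (Fin n) (Fin n) ℝ) i k := by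
      rw [hg, gramMatrix_symm, nonsing_inv_mul _ (isUnit_iff_ne_zero.2 hdet.ne')]
    rw [mul_apply, one_apply] at h1
    simpa [eq_comm] using h1
  -- Product rule in `ρ⁻¹ ∂ₖ(ρ cᵏ)`. On the ambient side, the derivatives of the coefficients give
  -- the first sum through `g⁻¹g = 1`, and the second derivatives of `F` give the second.
  have hL : coordLaplacian g v y = ∑ k, partialDeriv (c k) k y +
      ∑ k, c k y * ∑ i, ∑ j, (g y)⁻¹ i j *
        lorentz (partialDeriv (partialDeriv F k) i y) (partialDeriv F j y) := by
    rw [coordLaplacian, ← Finset.sum_add_distrib, Finset.mul_sum]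
    refine Finset.sum_congr rfl fun k _ => ?_
    have h1 : partialDeriv (fun y => Real.sqrt (g y).det * c k y) k y =
        Real.sqrt (g y).det * partialDeriv (c k) k y +
          c k y * partialDeriv (fun y => Real.sqrt (g y).det) k y := by
      rw [partialDeriv, fderiv_fun_mul hρd (hcd k)]
      rfl
    change (Real.sqrt (g y).det)⁻¹ * partialDeriv (fun y => Real.sqrt (g y).det * c k y) k y = _
    rw [h1, partialDeriv_sqrt_det hF hdet k, ← hg]
    field_simp
  rw [hL]
  have hG : ∀ i, partialDeriv (ambientGradient F v) i y =
      ∑ k, (partialDeriv (c k) i y • partialDeriv F k y +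
        c k y • partialDeriv (partialDeriv F k) i y) := fun i => partialDeriv_sum_smul hF hcd i
  have hR : ∀ i j, (g y)⁻¹ i j * lorentz (partialDeriv (ambientGradient F v) i y) (partialDeriv F j y) =
      ∑ k, (partialDeriv (c k) i y * ((g y)⁻¹ i j * g y k j) + c k y * ((g y)⁻¹ i j *
        lorentz (partialDeriv (partialDeriv F k) i y) (partialDeriv F j y))) := by
    intro i j
    rw [hG, lorentz_sum_left, Finset.mul_sum]
    refine Finset.sum_congr rfl fun k _ => ?_
    rw [lorentz_add_left, lorentz_smul_left, lorentz_smul_left, hg, gramMatrix, of_apply]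
    ring
  have hR2 : ∀ i, ∑ j, (g y)⁻¹ i j *
      lorentz (partialDeriv (ambientGradient F v) i y) (partialDeriv F j y) =
      partialDeriv (c i) i y + ∑ k, c k y * ∑ j, (g y)⁻¹ i j *
        lorentz (partialDeriv (partialDeriv F k) i y) (partialDeriv F j y) := by
    intro i
    simp_rw [hR]
    rw [Finset.sum_comm]
    simp_rw [Finset.sum_add_distrib, ← Finset.mul_sum, hinv]
    simp
  simp_rw [hR2]
  rw [Finset.sum_add_distrib]
  congr 1
  simp_rw [Finset.mul_sum]
  rw [Finset.sum_comm]

/-- The ambient gradient is characterized by the differential of the function. -/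
lemma ambientGradient_eq (hdet : IsUnit (gramMatrix F y).det) {c : EuclideanSpace ℝ (Fin n)}
    (hc : ∀ i, lorentz (fderiv ℝ F y c) (partialDeriv F i y) = partialDeriv v i y) :
    ambientGradient F v y = fderiv ℝ F y c := by
  have h1 : gramMatrix F y *ᵥ c = fun i => partialDeriv v i y := by
    funext i
    rw [← hc i, fderiv_apply_eq_sum, lorentz_sum_left]
    simp only [mulVec, dotProduct, gramMatrix, of_apply, lorentz_smul_left]
    exact Finset.sum_congr rfl fun j _ => by rw [lorentz_comm, mul_comm]
  have h2 : ∀ i, coordGradient (gramMatrix F) v y i = c i := by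
    intro i
    change ((gramMatrix F y)⁻¹ *ᵥ fun i => partialDeriv v i y) i = c i
    rw [← h1, mulVec_mulVec, nonsing_inv_mul _ hdet, one_mulVec]
  rw [ambientGradient, fderiv_apply_eq_sum]
  simp_rw [h2]

lemma lorentz_ambientGradient (hdet : IsUnit (gramMatrix F y).det) (i : Fin n) :
    lorentz (ambientGradient F v y) (partialDeriv F i y) = partialDeriv v i y := by
  rw [ambientGradient, lorentz_sum_left]
  simp_rw [lorentz_smul_left]
  have h1 : gramMatrix F y *ᵥ ((gramMatrix F y)⁻¹ *ᵥ fun i => partialDeriv v i y) =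
      fun i => partialDeriv v i y := by
    rw [mulVec_mulVec, mul_nonsing_inv _ hdet, one_mulVec]
  rw [← congrFun h1 i]
  simp only [mulVec, dotProduct, coordGradient]
  exact Finset.sum_congr rfl fun j _ => by
    rw [gramMatrix, of_apply, lorentz_comm, mul_comm]

lemma coordLaplacian_congr {g g' : EuclideanSpace ℝ (Fin n) → Matrix (Fin n) (Fin n) ℝ}
    {v v' : EuclideanSpace ℝ (Fin n) → ℝ} (hg : g =ᶠ[𝓝 y] g') (hv : v =ᶠ[𝓝 y] v') :
    coordLaplacian g v y = coordLaplacian g' v' y := by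
  rw [coordLaplacian, coordLaplacian, hg.self_of_nhds]
  congr 1
  refine Finset.sum_congr rfl fun i _ => ?_
  have : (fun y => Real.sqrt (g y).det * ∑ j, (g y)⁻¹ i j * partialDeriv v j y) =ᶠ[𝓝 y]
      fun y => Real.sqrt (g' y).det * ∑ j, (g' y)⁻¹ i j * partialDeriv v' j y := by
    filter_upwards [hg, hv.eventuallyEq_nhds] with z hz hz'
    simp only [hz, partialDeriv, hz'.fderiv_eq]
  rw [partialDeriv, partialDeriv, this.fderiv_eq]

/-- The Laplacian does not depend on the coordinates. -/
theorem coordLaplacian_comp {θ : EuclideanSpace ℝ (Fin n) → EuclideanSpace ℝ (Fin n)}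
    {z : EuclideanSpace ℝ (Fin n)} (hF : ContDiff ℝ ∞ F) (hv : ContDiff ℝ ∞ v)
    (hdet : ∀ y, 0 < (gramMatrix F y).det) (hθev : ∀ᶠ z in 𝓝 z, ContDiffAt ℝ ∞ θ z)
    (hJ : Function.Injective (fderiv ℝ θ z)) :
    coordLaplacian (gramMatrix (F ∘ θ)) (v ∘ θ) z = coordLaplacian (gramMatrix F) v (θ z) := by
  have hθ := hθev.self_of_nhds
  let J : EuclideanSpace ℝ (Fin n) → Matrix (Fin n) (Fin n) ℝ := fun z =>
    of fun k i => partialDeriv θ i z k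
  have hJmul : ∀ z w, J z *ᵥ w = fderiv ℝ θ z (WithLp.toLp 2 w) := by
    intro z w
    funext k
    rw [fderiv_apply_eq_sum]
    simp [mulVec, dotProduct, J, mul_comm]
  have hJdet : IsUnit (J z).det := by
    rw [← isUnit_iff_isUnit_det, ← mulVec_injective_iff_isUnit]
    intro a b hab
    rw [hJmul, hJmul] at hab
    have := hJ (WithLp.ofLp_injective _ hab)
    simpa using this
  have hJcont : ContinuousAt (fun z => (J z).det) z := by
    refine (ContDiffAt.matrix_det (k := ∞) fun i j => ?_).continuousAt
    exact (EuclideanSpace.proj i : EuclideanSpace ℝ (Fin n) →L[ℝ] ℝ).contDiff.contDiffAt.comp z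
      (hθ.partialDeriv j)
  have hJev : ∀ᶠ z' in 𝓝 z, IsUnit (J z').det := by
    filter_upwards [hJcont.eventually_ne hJdet.ne_zero] with z' hz'
    exact isUnit_iff_ne_zero.2 hz'
  have hchainV : ∀ {V : Type} [NormedAddCommGroup V] [NormedSpace ℝ V]
      (f : EuclideanSpace ℝ (Fin n) → V) (z' : EuclideanSpace ℝ (Fin n)),
      DifferentiableAt ℝ f (θ z') → ContDiffAt ℝ ∞ θ z' → ∀ i,
      partialDeriv (f ∘ θ) i z' = ∑ k, J z' k i • partialDeriv f k (θ z') := by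
    intro V _ _ f z' hf hz' i
    rw [partialDeriv, fderiv_comp z' hf (hz'.differentiableAt (by simp)),
      ContinuousLinearMap.comp_apply, fderiv_apply_eq_sum]
    rfl
  have hFd : Differentiable ℝ F := hF.differentiable (by simp)
  have hvd : Differentiable ℝ v := hv.differentiable (by simp)
  have hgram : ∀ z', ContDiffAt ℝ ∞ θ z' →
      gramMatrix (F ∘ θ) z' = (J z')ᵀ * gramMatrix F (θ z') * J z' := by
    intro z' hz'
    ext i j
    simp only [gramMatrix, of_apply, hchainV F z' (hFd _) hz', lorentz_sum_left, lorentz_sum_right,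
      lorentz_smul_left, lorentz_smul_right, mul_apply, transpose_apply, Finset.sum_mul,
      Finset.mul_sum]
    exact Finset.sum_congr rfl fun _ _ => Finset.sum_congr rfl fun _ _ => by ring
  have hgdet : ∀ z', ContDiffAt ℝ ∞ θ z' → IsUnit (J z').det →
      0 < (gramMatrix (F ∘ θ) z').det := by
    intro z' hz' hz''
    rw [hgram z' hz', det_mul, det_mul, det_transpose]
    have := hdet (θ z')
    have h2 : 0 < (J z').det * (J z').det := mul_self_pos.2 hz''.ne_zero
    nlinarith
  -- The ambient gradient is the tangent vector representing `dv`, which does not mention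
  -- coordinates. It is realized in the new ones by the coefficients `J⁻¹b`.
  have hgrad : ambientGradient (F ∘ θ) (v ∘ θ) =ᶠ[𝓝 z] ambientGradient F v ∘ θ := by
    filter_upwards [hθev, hJev] with z' hz' hz''
    let b : EuclideanSpace ℝ (Fin n) := WithLp.toLp 2 (coordGradient (gramMatrix F) v (θ z'))
    let c : EuclideanSpace ℝ (Fin n) := WithLp.toLp 2 ((J z')⁻¹ *ᵥ b)
    have hJc : fderiv ℝ θ z' c = b := by
      have := hJmul z' ((J z')⁻¹ *ᵥ b)
      rw [mulVec_mulVec, mul_nonsing_inv _ hz'', one_mulVec] at this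
      exact (WithLp.ofLp_injective _ this).symm
    have hcomp : fderiv ℝ (F ∘ θ) z' c = ambientGradient F v (θ z') := by
      rw [fderiv_comp z' (hFd _) (hz'.differentiableAt (by simp)), ContinuousLinearMap.comp_apply,
        hJc, fderiv_apply_eq_sum]
      rfl
    rw [Function.comp_apply, ← hcomp]
    refine ambientGradient_eq (hgdet z' hz' hz'').ne'.isUnit fun i => ?_
    rw [hcomp, hchainV F z' (hFd _) hz', hchainV v z' (hvd _) hz', lorentz_sum_right]
    refine Finset.sum_congr rfl fun k _ => ?_
    rw [lorentz_smul_right, lorentz_ambientGradient (hdet _).ne'.isUnit, smul_eq_mul]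
  have hAG : DifferentiableAt ℝ (ambientGradient F v) (θ z) := by
    refine (ContDiffAt.sum fun i _ => ?_ : ContDiffAt ℝ ∞ _ _).differentiableAt (by simp)
    exact (contDiffAt_coordGradient hF.contDiffAt hv.contDiffAt (hdet _) i).smul
      (hF.contDiffAt.partialDeriv i)
  rw [coordLaplacian_eq (hF.contDiffAt.comp z hθ) (hv.contDiffAt.comp z hθ) (hgdet z hθ hJdet),
    coordLaplacian_eq hF.contDiffAt hv.contDiffAt (hdet _)]
  -- The Laplacian is the trace with respect to the metric of the bilinear form `⟨d(∇v), dF⟩`. Under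
  -- `θ` both the form and the metric are conjugated by `J`, which leaves the trace unchanged.
  let β : Matrix (Fin n) (Fin n) ℝ := of fun i j =>
    lorentz (partialDeriv (ambientGradient F v) i (θ z)) (partialDeriv F j (θ z))
  have hβ : ∀ i j, lorentz (partialDeriv (ambientGradient (F ∘ θ) (v ∘ θ)) i z)
      (partialDeriv (F ∘ θ) j z) = ((J z)ᵀ * β * J z) i j := by
    intro i j
    have h1 : partialDeriv (ambientGradient (F ∘ θ) (v ∘ θ)) i z =
        ∑ k, J z k i • partialDeriv (ambientGradient F v) k (θ z) := by
      rw [← hchainV _ z hAG hθ, partialDeriv, hgrad.fderiv_eq]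
      rfl
    simp only [h1, hchainV F z (hFd _) hθ, lorentz_sum_left, lorentz_sum_right,
      lorentz_smul_left, lorentz_smul_right, mul_apply, transpose_apply, Finset.sum_mul,
      Finset.mul_sum, β, of_apply]
    exact Finset.sum_congr rfl fun _ _ => Finset.sum_congr rfl fun _ _ => by ring
  simp_rw [hβ]
  rw [hgram z hθ, ← trace_inv_mul_transpose,
    trace_inv_mul_transpose_congr (mul_nonsing_inv _ hJdet) (nonsing_inv_mul _ hJdet)
      (hdet _).ne'.isUnit, trace_inv_mul_transpose]
  rfl

end CoordinateLaplacian

/-! ### Traces in orthonormal and in coordinate bases. -/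

section OrthonormalTrace

open Matrix

variable {n : ℕ} {ι W : Type*} [Fintype ι] [DecidableEq ι] [NormedAddCommGroup W]
  [InnerProductSpace ℝ W] (e : OrthonormalBasis ι ℝ W)
  {Φ : EuclideanSpace ℝ (Fin n) →ₗ[ℝ] W} {Ψ : W →ₗ[ℝ] EuclideanSpace ℝ (Fin n)}

/-- `C` and `D` are the matrices of `Φ` and `Ψ` in the two bases. They are rectangular in their
index types because `orthoFrame` is indexed by `Fin` of a `finrank`, not by `Fin n`. -/
lemma exists_change_of_basis (hΦΨ : ∀ w, Φ (Ψ w) = w) (hΨΦ : ∀ y, Ψ (Φ y) = y) :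
    ∃ (C : Matrix ι (Fin n) ℝ) (D : Matrix (Fin n) ι ℝ), C * D = 1 ∧ D * C = 1 ∧
      ∀ j, Φ (EuclideanSpace.single j 1) = ∑ i, C i j • e i := by
  refine ⟨of fun i j => ⟪e i, Φ (EuclideanSpace.single j 1)⟫_ℝ, of fun j i => Ψ (e i) j, ?_, ?_,
    fun j => (e.sum_repr' _).symm⟩
  · ext i k
    have h : Φ (Ψ (e k)) = ∑ j, Ψ (e k) j • Φ (EuclideanSpace.single j 1) := by
      conv_lhs => rw [← (EuclideanSpace.basisFun (Fin n) ℝ).sum_repr (Ψ (e k))]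
      simp
    have h2 : ⟪e i, Φ (Ψ (e k))⟫_ℝ = (1 : Matrix ι ι ℝ) i k := by
      rw [hΦΨ, orthonormal_iff_ite.1 e.orthonormal, one_apply]
    rw [← h2, h, inner_sum]
    simp [mul_apply, inner_smul_right, mul_comm]
  · ext j k
    have h := congrArg (fun w => Ψ w j) (e.sum_repr' (Φ (EuclideanSpace.single k 1)))
    simp only [map_sum, map_smul, hΨΦ] at h
    simp only [mul_apply, of_apply, one_apply]
    rw [show (∑ i, Ψ (e i) j * ⟪e i, Φ (EuclideanSpace.single k 1)⟫_ℝ) =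
      (∑ i, ⟪e i, Φ (EuclideanSpace.single k 1)⟫_ℝ • Ψ (e i)) j by simp [mul_comm], h]
    simp

/-- The trace of a bilinear form, computed in an orthonormal basis and in an arbitrary one. -/
lemma sum_orthonormalBasis_eq (hΦΨ : ∀ w, Φ (Ψ w) = w) (hΨΦ : ∀ y, Ψ (Φ y) = y)
    (β : W →ₗ[ℝ] W →ₗ[ℝ] ℝ) {g h : Matrix (Fin n) (Fin n) ℝ}
    (hg : ∀ i j, g i j = ⟪Φ (EuclideanSpace.single i 1), Φ (EuclideanSpace.single j 1)⟫_ℝ)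
    (hh : ∀ i j, h i j = β (Φ (EuclideanSpace.single i 1)) (Φ (EuclideanSpace.single j 1))) :
    ∑ i, β (e i) (e i) = (g⁻¹ * hᵀ).trace ∧
      ∑ i, ∑ j, β (e i) (e j) ^ 2 = (g⁻¹ * h * g⁻¹ * hᵀ).trace := by
  obtain ⟨C, D, hCD, hDC, hC⟩ := exists_change_of_basis e hΦΨ hΨΦ
  let b : Matrix ι ι ℝ := of fun i j => β (e i) (e j)
  have hg' : g = Cᵀ * C := by
    ext i j
    rw [hg, hC, hC, sum_inner]
    simp_rw [inner_sum, inner_smul_left, inner_smul_right, orthonormal_iff_ite.1 e.orthonormal]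
    simp [mul_apply]
  have hh' : h = Cᵀ * b * C := by
    ext i j
    rw [hh, hC, hC]
    simp only [map_sum, map_smul, LinearMap.sum_apply, LinearMap.smul_apply, smul_eq_mul,
      mul_apply, transpose_apply, b, of_apply, Finset.sum_mul, Finset.mul_sum]
    exact Finset.sum_congr rfl fun _ _ => Finset.sum_congr rfl fun _ _ => by ring
  constructor
  · have := trace_inv_mul_transpose_congr (g := 1) (β := b) hCD hDC (by simp)
    rw [Matrix.mul_one] at this
    rw [hg', hh', this]
    simp [trace, b]
  · rw [hg', hh', trace_inv_mul_mul_inv_mul hCD hDC]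
    simp [trace, b, mul_apply, sq]

end OrthonormalTrace

/-! ### Chain rules for differentials. -/

section Chain

variable {n : ℕ} {M : Type*} [TopologicalSpace M] [ChartedSpace (EuclideanSpace ℝ (Fin n)) M]
  {V : Type*} [NormedAddCommGroup V] [NormedSpace ℝ V]

lemma differential_mfderiv {W : Type*} [NormedAddCommGroup W] [NormedSpace ℝ W]
    {σ : W → M} {y : W} {f : M → V}
    (hf : MDifferentiableAt (𝓡 n) 𝓘(ℝ, V) f (σ y))
    (hσ : MDifferentiableAt 𝓘(ℝ, W) (𝓡 n) σ y) (v : W) :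
    differential f (σ y) (mfderiv 𝓘(ℝ, W) (𝓡 n) σ y v) = fderiv ℝ (f ∘ σ) y v := by
  rw [← mfderiv_eq_fderiv, mfderiv_comp y hf hσ]
  rfl

lemma differential_clm_comp {W : Type*} [NormedAddCommGroup W] [NormedSpace ℝ W] {x : M → V}
    {p : M} (hx : MDifferentiableAt (𝓡 n) 𝓘(ℝ, V) x p) (T : V →L[ℝ] W)
    (v : TangentSpace (𝓡 n) p) :
    differential (fun q => T (x q)) p v = T (differential x p v) := by
  have h : MDifferentiableAt 𝓘(ℝ, V) 𝓘(ℝ, W) T (x p) :=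
    T.differentiableAt.mdifferentiableAt
  have := mfderiv_comp p h hx
  rw [differential, show (fun q => T (x q)) = T ∘ x from rfl, this, mfderiv_eq_fderiv, T.fderiv]
  rfl

end Chain

/-! ### Complete space-like hypersurfaces as entire graphs. -/

section GraphChart

open Matrix Filter Topology

variable {n : ℕ} {M : Type*}

/-- The graph of a function as a hypersurface of the Lorentzian space. -/
noncomputable def graphMap (f : EuclideanSpace ℝ (Fin n) → ℝ) (y : EuclideanSpace ℝ (Fin n)) :
    LorentzSpace n :=
  WithLp.toLp 2 (Fin.snoc (α := fun _ => ℝ) y (f y))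

@[simp] lemma spatial_graphMap (f : EuclideanSpace ℝ (Fin n) → ℝ) (y : EuclideanSpace ℝ (Fin n)) :
    spatial n (graphMap f y) = y := by
  ext i; simp [graphMap]

@[simp] lemma temporal_graphMap (f : EuclideanSpace ℝ (Fin n) → ℝ)
    (y : EuclideanSpace ℝ (Fin n)) : temporal n (graphMap f y) = f y := by
  simp [graphMap]

lemma lorentzSpace_ext {X Y : LorentzSpace n} (h : spatial n X = spatial n Y)
    (h' : temporal n X = temporal n Y) : X = Y := by
  ext i
  refine Fin.lastCases h' (fun i => ?_) i
  exact congrArg (fun Z => Z i) h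

/-- A global parametrization of a hypersurface as the graph of a function `f`. -/
structure IsGraphChart [TopologicalSpace M] [ChartedSpace (EuclideanSpace ℝ (Fin n)) M]
    (x : M → LorentzSpace n) (σ : EuclideanSpace ℝ (Fin n) → M)
    (f : EuclideanSpace ℝ (Fin n) → ℝ) : Prop where
  smooth_map : ContMDiff 𝓘(ℝ, EuclideanSpace ℝ (Fin n)) (𝓡 n) ∞ σ
  left_inv : ∀ p, σ (spatial n (x p)) = p
  smooth_fun : ContDiff ℝ ∞ f
  apply_eq : ∀ y, x (σ y) = graphMap f y

section

variable [MetricSpace M] [CompleteSpace M] [ConnectedSpace M]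
    [ChartedSpace (EuclideanSpace ℝ (Fin n)) M] [IsManifold (𝓡 n) ∞ M]
    [RiemannianBundle (fun p : M => TangentSpace (𝓡 n) p)] [IsRiemannianManifold (𝓡 n) M]
    {x N : M → LorentzSpace n}

/-- Complete space-like hypersurfaces are entire graphs. -/
theorem IsSpacelikeHypersurface.exists_isGraphChart (hx : IsSpacelikeHypersurface x N) :
    ∃ σ f, IsGraphChart x σ f := by
  have hP : ContMDiff (𝓡 n) 𝓘(ℝ, EuclideanSpace ℝ (Fin n)) ∞ fun p => spatial n (x p) :=
    (spatial n).contDiff.contMDiff.comp hx.smooth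
  obtain ⟨σ, h1, h2, h3⟩ := exists_smooth_inverse_of_expanding hP fun p v => by
    rw [differential_clm_comp ((hx.smooth p).mdifferentiableAt (by simp))]
    -- The induced metric is the Euclidean square of the projection minus the square of the time
    -- component, so forgetting the latter can only lengthen.
    refine le_of_sq_le_sq ?_ (norm_nonneg _)
    rw [← real_inner_self_eq_norm_sq v, ← hx.isometric, lorentz_eq, real_inner_self_eq_norm_sq]
    nlinarith [mul_self_nonneg (temporal n (differential x p v))]
  refine ⟨σ, fun y => temporal n (x (σ y)), h3, h2, ?_, fun y => ?_⟩
  · exact contMDiff_iff_contDiff.1 ((temporal n).contDiff.contMDiff.comp (hx.smooth.comp h3))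
  · exact lorentzSpace_ext (by rw [spatial_graphMap, h1]) (by rw [temporal_graphMap])

end

namespace IsGraphChart

section Smooth

variable [TopologicalSpace M] [ChartedSpace (EuclideanSpace ℝ (Fin n)) M]
    {x N : M → LorentzSpace n} {σ : EuclideanSpace ℝ (Fin n) → M}
    {f : EuclideanSpace ℝ (Fin n) → ℝ}

lemma right_inv (h : IsGraphChart x σ f) (y : EuclideanSpace ℝ (Fin n)) :
    spatial n (x (σ y)) = y := by rw [h.apply_eq]; simp

lemma surjective (h : IsGraphChart x σ f) : Function.Surjective σ := fun p => ⟨_, h.left_inv p⟩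

lemma mdifferentiableAt (h : IsGraphChart x σ f) (y : EuclideanSpace ℝ (Fin n)) :
    MDifferentiableAt 𝓘(ℝ, EuclideanSpace ℝ (Fin n)) (𝓡 n) σ y :=
  (h.smooth_map y).mdifferentiableAt (by simp)

lemma contDiff_graphMap {f : EuclideanSpace ℝ (Fin n) → ℝ} (hf : ContDiff ℝ ∞ f) :
    ContDiff ℝ ∞ (graphMap f) := by
  refine contDiff_euclidean.2 fun i => ?_
  refine Fin.lastCases ?_ (fun i => ?_) i
  · simpa [graphMap] using hf
  · simpa [graphMap] using (EuclideanSpace.proj i : EuclideanSpace ℝ (Fin n) →L[ℝ] ℝ).contDiff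

lemma comp_eq (h : IsGraphChart x σ f) : x ∘ σ = graphMap f := funext h.apply_eq

/-- The differential of a graph chart. -/
noncomputable def tangentMap (_ : IsGraphChart x σ f) (y : EuclideanSpace ℝ (Fin n)) :
    EuclideanSpace ℝ (Fin n) →L[ℝ] TangentSpace (𝓡 n) (σ y) :=
  mfderiv 𝓘(ℝ, EuclideanSpace ℝ (Fin n)) (𝓡 n) σ y

lemma differential_tangentMap {V : Type*} [NormedAddCommGroup V] [NormedSpace ℝ V]
    (h : IsGraphChart x σ f) {u : M → V} {y : EuclideanSpace ℝ (Fin n)}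
    (hu : MDifferentiableAt (𝓡 n) 𝓘(ℝ, V) u (σ y)) (v : EuclideanSpace ℝ (Fin n)) :
    differential u (σ y) (h.tangentMap y v) = fderiv ℝ (u ∘ σ) y v :=
  differential_mfderiv hu (h.mdifferentiableAt y) v

variable [RiemannianBundle (fun p : M => TangentSpace (𝓡 n) p)]

lemma differential_spatial_tangentMap (h : IsGraphChart x σ f) (hx : IsSpacelikeHypersurface x N)
    (y v : EuclideanSpace ℝ (Fin n)) :
    spatial n (differential x (σ y) (h.tangentMap y v)) = v := by
  rw [h.differential_tangentMap ((hx.smooth _).mdifferentiableAt (by simp))]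
  have h1 : (spatial n) ∘ (x ∘ σ) = id := funext h.right_inv
  have h2 : DifferentiableAt ℝ (x ∘ σ) y := by
    rw [h.comp_eq]; exact (contDiff_graphMap h.smooth_fun).differentiable (by simp) y
  have h3 := congrArg (fun u => fderiv ℝ u y v) h1
  simp only [fderiv_id] at h3
  rw [fderiv_comp y (spatial n).differentiableAt h2, (spatial n).fderiv] at h3
  exact h3

/-- The differential of `σ` has a left inverse, so it is injective; the dimensions being equal, the
left inverse is two-sided. -/
lemma tangentMap_spatial_differential (h : IsGraphChart x σ f) (hx : IsSpacelikeHypersurface x N)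
    (y : EuclideanSpace ℝ (Fin n)) (w : TangentSpace (𝓡 n) (σ y)) :
    h.tangentMap y (spatial n (differential x (σ y) w)) = w := by
  have hinj : Function.Injective (h.tangentMap y) := fun a b hab => by
    rw [← h.differential_spatial_tangentMap hx y a, hab, h.differential_spatial_tangentMap hx]
  let Φ : EuclideanSpace ℝ (Fin n) →ₗ[ℝ] EuclideanSpace ℝ (Fin n) := (h.tangentMap y).toLinearMap
  obtain ⟨v, hv⟩ := (LinearMap.injective_iff_surjective (f := Φ)).1 hinj w
  have hv : h.tangentMap y v = w := hv
  rw [← hv, h.differential_spatial_tangentMap hx]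

lemma inner_tangentMap (h : IsGraphChart x σ f) (hx : IsSpacelikeHypersurface x N)
    (y v w : EuclideanSpace ℝ (Fin n)) :
    ⟪h.tangentMap y v, h.tangentMap y w⟫_ℝ =
      lorentz (fderiv ℝ (graphMap f) y v) (fderiv ℝ (graphMap f) y w) := by
  rw [← hx.isometric, h.differential_tangentMap ((hx.smooth _).mdifferentiableAt (by simp)),
    h.differential_tangentMap ((hx.smooth _).mdifferentiableAt (by simp)), h.comp_eq]

lemma gramMatrix_eq (h : IsGraphChart x σ f) (hx : IsSpacelikeHypersurface x N)
    (y : EuclideanSpace ℝ (Fin n)) (i j : Fin n) :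
    gramMatrix (graphMap f) y i j = ⟪h.tangentMap y (EuclideanSpace.single i 1),
      h.tangentMap y (EuclideanSpace.single j 1)⟫_ℝ := by
  rw [h.inner_tangentMap hx]; rfl

lemma partialDeriv_graphMap {f : EuclideanSpace ℝ (Fin n) → ℝ} (hf : ContDiff ℝ ∞ f) (i : Fin n)
    (y : EuclideanSpace ℝ (Fin n)) :
    partialDeriv (graphMap f) i y =
      WithLp.toLp 2 (Fin.snoc (α := fun _ => ℝ) (EuclideanSpace.single i (1 : ℝ))
        (partialDeriv f i y)) := by
  have hd : DifferentiableAt ℝ (graphMap f) y :=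
    (contDiff_graphMap hf).differentiable (by simp) y
  refine lorentzSpace_ext ?_ ?_
  · have h1 : (spatial n) ∘ graphMap f = id := funext fun y => spatial_graphMap f y
    have h3 := congrArg (fun u => fderiv ℝ u y (EuclideanSpace.single i (1 : ℝ))) h1
    simp only [fderiv_id] at h3
    rw [fderiv_comp y (spatial n).differentiableAt hd, (spatial n).fderiv] at h3
    refine h3.trans ?_
    ext j
    simp [Pi.single_apply]
  · have h1 : (temporal n) ∘ graphMap f = f := funext fun y => temporal_graphMap f y
    have h3 := congrArg (fun u => fderiv ℝ u y (EuclideanSpace.single i (1 : ℝ))) h1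
    rw [fderiv_comp y (temporal n).differentiableAt hd, (temporal n).fderiv] at h3
    refine h3.trans ?_
    rw [temporal_apply]
    simp [partialDeriv]

lemma partialDeriv_partialDeriv_graphMap {f : EuclideanSpace ℝ (Fin n) → ℝ} (hf : ContDiff ℝ ∞ f)
    (i j : Fin n) (y : EuclideanSpace ℝ (Fin n)) :
    partialDeriv (partialDeriv (graphMap f) i) j y =
      WithLp.toLp 2 (Fin.snoc (α := fun _ => ℝ) (0 : EuclideanSpace ℝ (Fin n))
        (partialDeriv (partialDeriv f i) j y)) := by
  have hd : DifferentiableAt ℝ (partialDeriv (graphMap f) i) y :=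
    ((contDiff_graphMap hf).partialDeriv i).differentiable (by simp) y
  refine lorentzSpace_ext ?_ ?_
  · have h1 : (spatial n) ∘ partialDeriv (graphMap f) i =
        fun _ => EuclideanSpace.single i (1 : ℝ) := by
      funext z; rw [Function.comp, partialDeriv_graphMap hf]; ext k; simp [Pi.single_apply]
    have h3 := congrArg (fun u => fderiv ℝ u y (EuclideanSpace.single j (1 : ℝ))) h1
    simp only [fderiv_fun_const] at h3
    rw [fderiv_comp y (spatial n).differentiableAt hd, (spatial n).fderiv] at h3
    refine h3.trans ?_
    ext k
    simp
  · have h1 : (temporal n) ∘ partialDeriv (graphMap f) i = partialDeriv f i := by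
      funext z; rw [Function.comp, partialDeriv_graphMap hf, temporal_apply]; simp
    have h3 := congrArg (fun u => fderiv ℝ u y (EuclideanSpace.single j (1 : ℝ))) h1
    rw [fderiv_comp y (temporal n).differentiableAt hd, (temporal n).fderiv] at h3
    refine h3.trans ?_
    rw [temporal_apply]
    simp [partialDeriv]

lemma gramMatrix_graphMap {f : EuclideanSpace ℝ (Fin n) → ℝ} (hf : ContDiff ℝ ∞ f)
    (y : EuclideanSpace ℝ (Fin n)) :
    gramMatrix (graphMap f) y =
      1 - vecMulVec (fun i => partialDeriv f i y) (fun i => partialDeriv f i y) := by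
  ext i j
  simp only [gramMatrix, of_apply, partialDeriv_graphMap hf, lorentz, Matrix.sub_apply, one_apply,
    vecMulVec_apply]
  simp [Pi.single_apply, eq_comm]

/-- The slope of a space-like graph is smaller than one. -/
lemma sum_sq_partialDeriv_lt_one (h : IsGraphChart x σ f) (hx : IsSpacelikeHypersurface x N)
    (y : EuclideanSpace ℝ (Fin n)) : ∑ i, partialDeriv f i y ^ 2 < 1 := by
  set q := ∑ i, partialDeriv f i y ^ 2 with hq
  have hq0 : 0 ≤ q := Finset.sum_nonneg fun i _ => sq_nonneg _
  rcases hq0.eq_or_lt with h0 | h0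
  · rw [← h0]; exact one_pos
  -- In the direction of the slope, the positive definite metric `I - ∇f ∇fᵀ` takes the value `q -
  -- q²`, whence `q < 1`.
  let a : EuclideanSpace ℝ (Fin n) := WithLp.toLp 2 fun i => partialDeriv f i y
  have ha : h.tangentMap y a ≠ 0 := by
    intro h1
    have h2 := h.differential_spatial_tangentMap hx y a
    rw [h1, map_zero, map_zero] at h2
    have : ∀ i, partialDeriv f i y = 0 := fun i => congrArg (fun v => v i) h2.symm
    simp [hq, this] at h0
  have h1 : 0 < ⟪h.tangentMap y a, h.tangentMap y a⟫_ℝ := real_inner_self_pos.2 ha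
  have h2 : ⟪h.tangentMap y a, h.tangentMap y a⟫_ℝ = q - q ^ 2 := by
    have h3 : ⟪h.tangentMap y a, h.tangentMap y a⟫_ℝ =
        ∑ i, ∑ j, a i * (a j * gramMatrix (graphMap f) y i j) := by
      rw [h.inner_tangentMap hx, fderiv_apply_eq_sum, lorentz_sum_left]
      refine Finset.sum_congr rfl fun i _ => ?_
      rw [lorentz_sum_right]
      refine Finset.sum_congr rfl fun j _ => ?_
      rw [lorentz_smul_left, lorentz_smul_right]
      rfl
    rw [h3, gramMatrix_graphMap h.smooth_fun]
    simp only [Matrix.sub_apply, one_apply, vecMulVec_apply, mul_sub, mul_ite, mul_one, mul_zero,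
      Finset.sum_sub_distrib, Finset.sum_ite_eq, Finset.mem_univ, if_true, a]
    have h4 : ∑ i, ∑ j, partialDeriv f i y * (partialDeriv f j y *
        (partialDeriv f i y * partialDeriv f j y)) = q ^ 2 := by
      rw [hq, sq (∑ i, _), Finset.sum_mul_sum]
      exact Finset.sum_congr rfl fun _ _ => Finset.sum_congr rfl fun _ _ => by ring
    rw [h4, hq]
    simp only [sq]
  nlinarith

/-- The last coordinate of the normal of a graph. -/
noncomputable def normalFactor (_ : IsGraphChart x σ f) (N : M → LorentzSpace n)
    (y : EuclideanSpace ℝ (Fin n)) : ℝ := temporal n (N (σ y))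

lemma contDiff_normal (h : IsGraphChart x σ f) (hx : IsSpacelikeHypersurface x N) :
    ContDiff ℝ ∞ fun y => N (σ y) :=
  contMDiff_iff_contDiff.1 (hx.smooth_normal.comp h.smooth_map)

lemma contDiff_normalFactor (h : IsGraphChart x σ f) (hx : IsSpacelikeHypersurface x N) :
    ContDiff ℝ ∞ (h.normalFactor N) :=
  (temporal n).contDiff.comp (h.contDiff_normal hx)

lemma lorentz_normal_partialDeriv (h : IsGraphChart x σ f) (hx : IsSpacelikeHypersurface x N)
    (y : EuclideanSpace ℝ (Fin n)) (i : Fin n) :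
    lorentz (N (σ y)) (partialDeriv (graphMap f) i y) = 0 := by
  have := hx.normal (σ y) (h.tangentMap y (EuclideanSpace.single i 1))
  rwa [h.differential_tangentMap ((hx.smooth _).mdifferentiableAt (by simp)), h.comp_eq] at this

/-- Orthogonality to each tangent vector `(eᵢ, ∂ᵢf)` makes the normal proportional to `(∇f, 1)`. -/
lemma spatial_normal (h : IsGraphChart x σ f) (hx : IsSpacelikeHypersurface x N)
    (y : EuclideanSpace ℝ (Fin n)) (i : Fin n) :
    spatial n (N (σ y)) i = h.normalFactor N y * partialDeriv f i y := by
  have := h.lorentz_normal_partialDeriv hx y i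
  rw [partialDeriv_graphMap h.smooth_fun] at this
  simp [lorentz, Pi.single_apply] at this
  rw [spatial_apply, normalFactor, temporal_apply]
  linarith

lemma normalFactor_sq (h : IsGraphChart x σ f) (hx : IsSpacelikeHypersurface x N)
    (y : EuclideanSpace ℝ (Fin n)) :
    h.normalFactor N y ^ 2 * (1 - ∑ i, partialDeriv f i y ^ 2) = 1 := by
  have h1 := hx.unit (σ y)
  rw [lorentz] at h1
  have h2 : ∀ i : Fin n, N (σ y) i.castSucc = h.normalFactor N y * partialDeriv f i y :=
    h.spatial_normal hx y
  simp_rw [h2] at h1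
  have h3 : N (σ y) (Fin.last n) = h.normalFactor N y := rfl
  have h4 : ∑ i, h.normalFactor N y * partialDeriv f i y * (h.normalFactor N y * partialDeriv f i y)
      = h.normalFactor N y ^ 2 * ∑ i, partialDeriv f i y ^ 2 := by
    rw [Finset.mul_sum]; exact Finset.sum_congr rfl fun _ _ => by ring
  rw [h3, h4] at h1
  linarith

/-- The metric is the rank-one perturbation `I - ∇f ∇fᵀ`, and the Sherman-Morrison formula applies
with `ν² = 1/(1 - |∇f|²)`. -/
lemma inv_gramMatrix (h : IsGraphChart x σ f) (hx : IsSpacelikeHypersurface x N)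
    (y : EuclideanSpace ℝ (Fin n)) :
    (gramMatrix (graphMap f) y)⁻¹ = 1 + h.normalFactor N y ^ 2 •
      vecMulVec (fun i => partialDeriv f i y) (fun i => partialDeriv f i y) := by
  refine inv_eq_left_inv ?_
  set a := fun i => partialDeriv f i y with ha
  have h1 := h.normalFactor_sq hx y
  have h2 : vecMulVec a a * vecMulVec a a = (∑ i, partialDeriv f i y ^ 2) • vecMulVec a a := by
    ext i j
    simp only [mul_apply, vecMulVec_apply, Matrix.smul_apply, smul_eq_mul, Finset.sum_mul, ha]
    exact Finset.sum_congr rfl fun _ _ => by ring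
  rw [gramMatrix_graphMap h.smooth_fun, Matrix.mul_sub, Matrix.mul_one, Matrix.add_mul,
    Matrix.one_mul, Matrix.smul_mul, ← ha, h2, smul_smul]
  have h3 : h.normalFactor N y ^ 2 * ∑ i, partialDeriv f i y ^ 2 = h.normalFactor N y ^ 2 - 1 := by
    linarith
  rw [h3, sub_smul, one_smul]
  abel

lemma det_gramMatrix_pos (h : IsGraphChart x σ f) (hx : IsSpacelikeHypersurface x N)
    (y : EuclideanSpace ℝ (Fin n)) : 0 < (gramMatrix (graphMap f) y).det := by
  have h2 : (gramMatrix (graphMap f) y).det = 1 - ∑ i, partialDeriv f i y ^ 2 := by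
    rw [gramMatrix_graphMap h.smooth_fun, vecMulVec_eq Unit, det_one_sub_mul_comm]
    simp [mul_apply, sq]
  rw [h2]
  linarith [h.sum_sq_partialDeriv_lt_one hx y]

end Smooth

end IsGraphChart

end GraphChart

/-! ### Curvature, support function and Laplacian in a graph chart. -/

section GraphFormulas

open Matrix Filter Topology

variable {n : ℕ} {M : Type*}

/-- The mean curvature of the graph of `f` whose normal has last coordinate `ν`. -/
noncomputable def graphMeanCurvature (f ν : EuclideanSpace ℝ (Fin n) → ℝ)
    (y : EuclideanSpace ℝ (Fin n)) : ℝ :=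
  ν y * (∑ i, partialDeriv (partialDeriv f i) i y +
    ν y ^ 2 * ∑ i, ∑ j, partialDeriv f i y * partialDeriv f j y *
      partialDeriv (partialDeriv f j) i y)

/-- The squared norm of the second fundamental form of the graph of `f` whose normal has last
coordinate `ν`. -/
noncomputable def graphNormSq (f ν : EuclideanSpace ℝ (Fin n) → ℝ)
    (y : EuclideanSpace ℝ (Fin n)) : ℝ :=
  ν y ^ 2 * (∑ i, ∑ j, partialDeriv (partialDeriv f j) i y ^ 2 +
    2 * ν y ^ 2 * ∑ j, (∑ i, partialDeriv f i y * partialDeriv (partialDeriv f j) i y) ^ 2 +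
    ν y ^ 4 * (∑ i, ∑ j, partialDeriv f i y * partialDeriv f j y *
      partialDeriv (partialDeriv f j) i y) ^ 2)

/-- The squared norm of the traceless second fundamental form of a graph. -/
noncomputable def graphTracelessNormSq (f ν : EuclideanSpace ℝ (Fin n) → ℝ)
    (y : EuclideanSpace ℝ (Fin n)) : ℝ :=
  graphNormSq f ν y - graphMeanCurvature f ν y ^ 2 / n

/-- The support function of a graph. -/
noncomputable def graphSupport (f ν : EuclideanSpace ℝ (Fin n) → ℝ)
    (y : EuclideanSpace ℝ (Fin n)) : ℝ :=
  ν y * (∑ i, y i * partialDeriv f i y - f y)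

section Smooth

variable {f ν : EuclideanSpace ℝ (Fin n) → ℝ}

lemma contDiff_graphMeanCurvature (hf : ContDiff ℝ ∞ f) (hν : ContDiff ℝ ∞ ν) :
    ContDiff ℝ ∞ (graphMeanCurvature f ν) := by
  refine hν.mul ((ContDiff.sum fun i _ => (hf.partialDeriv i).partialDeriv i).add
    ((hν.pow 2).mul (ContDiff.sum fun i _ => ContDiff.sum fun j _ => ?_)))
  exact ((hf.partialDeriv i).mul (hf.partialDeriv j)).mul ((hf.partialDeriv j).partialDeriv i)

lemma contDiff_graphNormSq (hf : ContDiff ℝ ∞ f) (hν : ContDiff ℝ ∞ ν) :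
    ContDiff ℝ ∞ (graphNormSq f ν) := by
  refine (hν.pow 2).mul (((ContDiff.sum fun i _ => ContDiff.sum fun j _ =>
    ((hf.partialDeriv j).partialDeriv i).pow 2).add ((contDiff_const.mul (hν.pow 2)).mul
      (ContDiff.sum fun j _ => (ContDiff.sum fun i _ =>
        (hf.partialDeriv i).mul ((hf.partialDeriv j).partialDeriv i)).pow 2))).add
    ((hν.pow 4).mul ((ContDiff.sum fun i _ => ContDiff.sum fun j _ => ?_).pow 2)))
  exact ((hf.partialDeriv i).mul (hf.partialDeriv j)).mul ((hf.partialDeriv j).partialDeriv i)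

lemma contDiff_graphTracelessNormSq (hf : ContDiff ℝ ∞ f) (hν : ContDiff ℝ ∞ ν) :
    ContDiff ℝ ∞ (graphTracelessNormSq f ν) :=
  (contDiff_graphNormSq hf hν).sub (((contDiff_graphMeanCurvature hf hν).pow 2).div_const _)

end Smooth

namespace IsGraphChart

variable [TopologicalSpace M] [ChartedSpace (EuclideanSpace ℝ (Fin n)) M]
    {x N : M → LorentzSpace n} {σ : EuclideanSpace ℝ (Fin n) → M}
    {f : EuclideanSpace ℝ (Fin n) → ℝ}

lemma lorentz_self_eq (h : IsGraphChart x σ f) (y : EuclideanSpace ℝ (Fin n)) :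
    lorentz (x (σ y)) (x (σ y)) = ∑ i, y i ^ 2 - f y ^ 2 := by
  rw [h.apply_eq]
  simp [lorentz, graphMap, sq]

variable [RiemannianBundle (fun p : M => TangentSpace (𝓡 n) p)]

/-- Differentiating `⟨N, ∂ⱼF⟩ = 0` gives `⟨∂ᵢN, ∂ⱼF⟩ = -⟨N, ∂ᵢ∂ⱼF⟩`. The vector `∂ᵢ∂ⱼF` is vertical,
and the sign of the time direction cancels the minus. -/
lemma secondForm_tangentMap (h : IsGraphChart x σ f) (hx : IsSpacelikeHypersurface x N)
    (y : EuclideanSpace ℝ (Fin n)) (i j : Fin n) :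
    secondForm x N (σ y) (h.tangentMap y (EuclideanSpace.single i 1))
      (h.tangentMap y (EuclideanSpace.single j 1)) =
      h.normalFactor N y * partialDeriv (partialDeriv f j) i y := by
  rw [secondForm, h.differential_tangentMap ((hx.smooth _).mdifferentiableAt (by simp)),
    h.differential_tangentMap ((hx.smooth_normal _).mdifferentiableAt (by simp)), h.comp_eq]
  have h1 : (fun y => lorentz (N (σ y)) (partialDeriv (graphMap f) j y)) = fun _ => 0 :=
    funext fun y => h.lorentz_normal_partialDeriv hx y j
  have h2 := fderiv_lorentz_apply ((h.contDiff_normal hx).differentiable (by simp) y)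
    (((contDiff_graphMap h.smooth_fun).partialDeriv j).differentiable (by simp) y)
    (EuclideanSpace.single i (1 : ℝ))
  rw [h1, fderiv_fun_const] at h2
  change 0 = lorentz (N (σ y)) (partialDeriv (partialDeriv (graphMap f) j) i y) +
    lorentz (fderiv ℝ (N ∘ σ) y (EuclideanSpace.single i 1)) (partialDeriv (graphMap f) j y) at h2
  rw [partialDeriv_partialDeriv_graphMap h.smooth_fun] at h2
  have h3 : lorentz (N (σ y)) (WithLp.toLp 2 (Fin.snoc (α := fun _ => ℝ)
      (0 : EuclideanSpace ℝ (Fin n)) (partialDeriv (partialDeriv f j) i y))) =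
      -(h.normalFactor N y * partialDeriv (partialDeriv f j) i y) := by
    simp [lorentz, normalFactor]
  rw [h3] at h2
  change lorentz _ (partialDeriv (graphMap f) j y) = _
  linarith

lemma curvature_eq (h : IsGraphChart x σ f) (hx : IsSpacelikeHypersurface x N)
    (y : EuclideanSpace ℝ (Fin n)) :
    meanCurvature x N (σ y) = graphMeanCurvature f (h.normalFactor N) y ∧
      normSqSecondForm x N (σ y) = graphNormSq f (h.normalFactor N) y := by
  let β : TangentSpace (𝓡 n) (σ y) →ₗ[ℝ] TangentSpace (𝓡 n) (σ y) →ₗ[ℝ] ℝ :=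
    LinearMap.mk₂ ℝ (secondForm x N (σ y))
      (fun _ _ _ => by simp [secondForm, lorentz_add_left])
      (fun _ _ _ => by simp [secondForm, lorentz_smul_left])
      (fun _ _ _ => by simp [secondForm, lorentz_add_right])
      (fun _ _ _ => by simp [secondForm, lorentz_smul_right])
  set b : Matrix (Fin n) (Fin n) ℝ := of fun i j => partialDeriv (partialDeriv f j) i y with hb
  set a : Fin n → ℝ := fun i => partialDeriv f i y with ha
  set ν := h.normalFactor N y with hν
  have hbs : bᵀ = b := by
    ext i j
    simp only [hb, transpose_apply, of_apply]
    exact partialDeriv_comm h.smooth_fun.contDiffAt i j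
  obtain ⟨h1, h2⟩ := sum_orthonormalBasis_eq (n := n) (orthoFrame (n := n) (σ y))
    (Φ := (h.tangentMap y).toLinearMap)
    (Ψ := ((spatial n).comp (differential x (σ y))).toLinearMap)
    (fun w => h.tangentMap_spatial_differential hx y w)
    (fun w => h.differential_spatial_tangentMap hx y w) β (g := gramMatrix (graphMap f) y)
    (h := ν • b) (fun i j => h.gramMatrix_eq hx y i j)
    (fun i j => (h.secondForm_tangentMap hx y i j).symm)
  rw [h.inv_gramMatrix hx, transpose_smul, hbs, ← ha, ← hν] at h1 h2
  have haba : a ⬝ᵥ (a ᵥ* b) = ∑ i, ∑ j, a i * a j * b i j := by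
    simp only [dotProduct, vecMul, Finset.mul_sum]
    rw [Finset.sum_comm]
    exact Finset.sum_congr rfl fun _ _ => Finset.sum_congr rfl fun _ _ => by ring
  constructor
  · refine h1.trans ?_
    rw [Matrix.mul_smul, trace_smul, Matrix.add_mul, Matrix.one_mul, Matrix.smul_mul, trace_add,
      trace_smul, vecMulVec_mul, trace_vecMulVec, haba]
    rfl
  · refine h2.trans ?_
    set A := vecMulVec a a with hA
    -- Here `1 + ν²A` is the inverse metric and `νb` the second fundamental form. Since `A = aaᵀ`
    -- has rank one, each trace below collapses to a polynomial in the derivatives of `f`.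
    have hexp : ((1 + ν ^ 2 • A) * (ν • b) * (1 + ν ^ 2 • A) * (ν • b)).trace = ν ^ 2 *
        ((b * b).trace + ν ^ 2 * (A * b * b).trace + ν ^ 2 * (b * A * b).trace +
          ν ^ 4 * (A * b * (A * b)).trace) := by
      simp only [Matrix.mul_smul, Matrix.smul_mul, trace_smul, Matrix.add_mul, Matrix.mul_add,
        Matrix.one_mul, Matrix.mul_one, trace_add, smul_eq_mul, Matrix.mul_assoc]
      ring
    have e0 : (b * A * b).trace = (A * b * b).trace := by
      rw [Matrix.mul_assoc, trace_mul_comm]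
    have e1 : (b * b).trace = ∑ i, ∑ j, b i j ^ 2 := by
      simp only [trace, diag_apply, mul_apply, sq]
      refine Finset.sum_congr rfl fun i _ => Finset.sum_congr rfl fun j _ => ?_
      rw [show b j i = b i j from congrFun (congrFun hbs i) j]
    have e2 : (A * b * b).trace = ∑ j, (∑ i, a i * b i j) ^ 2 := by
      rw [hA, vecMulVec_mul, vecMulVec_mul, trace_vecMulVec, dotProduct_comm, ← dotProduct_mulVec]
      nth_rewrite 2 [← hbs]
      rw [mulVec_transpose]
      simp only [dotProduct, vecMul, sq]
    have e3 : (A * b * (A * b)).trace = (∑ i, ∑ j, a i * a j * b i j) ^ 2 := by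
      rw [hA, vecMulVec_mul, vecMulVec_mul_vecMulVec, trace_vecMulVec, dotProduct_smul,
        smul_eq_mul, dotProduct_comm _ a, haba, sq]
    rw [hexp, e0, e1, e2, e3]
    change _ = ν ^ 2 * (∑ i, ∑ j, b i j ^ 2 + 2 * ν ^ 2 * ∑ j, (∑ i, a i * b i j) ^ 2 +
      ν ^ 4 * (∑ i, ∑ j, a i * a j * b i j) ^ 2)
    ring

lemma tracelessNormSq_eq (h : IsGraphChart x σ f) (hx : IsSpacelikeHypersurface x N)
    (y : EuclideanSpace ℝ (Fin n)) :
    tracelessNormSq x N (σ y) = graphTracelessNormSq f (h.normalFactor N) y := by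
  rw [tracelessNormSq, (h.curvature_eq hx y).1, (h.curvature_eq hx y).2]; rfl

lemma lorentz_normal_eq (h : IsGraphChart x σ f) (hx : IsSpacelikeHypersurface x N)
    (y : EuclideanSpace ℝ (Fin n)) :
    lorentz (x (σ y)) (N (σ y)) = graphSupport f (h.normalFactor N) y := by
  have h2 : ∀ i : Fin n, N (σ y) i.castSucc = h.normalFactor N y * partialDeriv f i y :=
    h.spatial_normal hx y
  have h3 : N (σ y) (Fin.last n) = h.normalFactor N y := rfl
  rw [h.apply_eq, lorentz, h3, graphSupport, mul_sub, Finset.mul_sum]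
  simp_rw [h2]
  simp only [graphMap, Fin.snoc_castSucc, Fin.snoc_last]
  congr 1
  · exact Finset.sum_congr rfl fun _ _ => by ring
  · ring

lemma inner_riemannianGradient (u : M → ℝ) (p : M) (w : TangentSpace (𝓡 n) p) :
    ⟪riemannianGradient n u p, w⟫_ℝ = differential u p w := by
  rw [riemannianGradient, sum_inner]
  conv_rhs => rw [← (orthoFrame (n := n) p).sum_repr' w]
  rw [map_sum]
  refine Finset.sum_congr rfl fun i _ => ?_
  rw [inner_smul_left, map_smul, smul_eq_mul, mul_comm]
  rfl

lemma contMDiff_of_comp (h : IsGraphChart x σ f) (hx : IsSpacelikeHypersurface x N) {u : M → ℝ}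
    {v : EuclideanSpace ℝ (Fin n) → ℝ} (hv : ContDiff ℝ ∞ v) (huv : ∀ y, u (σ y) = v y) :
    ContMDiff (𝓡 n) 𝓘(ℝ, ℝ) ∞ u := by
  have h1 : u = v ∘ (spatial n ∘ x) := by
    funext p
    rw [Function.comp_apply, ← huv, Function.comp_apply, h.left_inv]
  rw [h1]
  exact hv.contMDiff.comp ((spatial n).contDiff.contMDiff.comp hx.smooth)

lemma differential_riemannianGradient (h : IsGraphChart x σ f) (hx : IsSpacelikeHypersurface x N)
    {u : M → ℝ} {v : EuclideanSpace ℝ (Fin n) → ℝ} (hv : ContDiff ℝ ∞ v)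
    (huv : ∀ y, u (σ y) = v y) (y : EuclideanSpace ℝ (Fin n)) :
    differential x (σ y) (riemannianGradient n u (σ y)) = ambientGradient (graphMap f) v y := by
  have hd : ∀ c, differential x (σ y) (h.tangentMap y c) = fderiv ℝ (graphMap f) y c := fun c => by
    rw [h.differential_tangentMap ((hx.smooth _).mdifferentiableAt (by simp)), h.comp_eq]
  have hg := h.tangentMap_spatial_differential hx y (riemannianGradient n u (σ y))
  rw [← hg, hd]
  refine (ambientGradient_eq (h.det_gramMatrix_pos hx y).ne'.isUnit fun i => ?_).symm
  rw [← hd, hg, partialDeriv, ← hd, hx.isometric, inner_riemannianGradient,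
    h.differential_tangentMap (((h.contMDiff_of_comp hx hv huv) _).mdifferentiableAt (by simp)),
    show u ∘ σ = v from funext huv]
  rfl

lemma norm_sq_riemannianGradient (h : IsGraphChart x σ f) (hx : IsSpacelikeHypersurface x N)
    {u : M → ℝ} {v : EuclideanSpace ℝ (Fin n) → ℝ} (hv : ContDiff ℝ ∞ v)
    (huv : ∀ y, u (σ y) = v y) (y : EuclideanSpace ℝ (Fin n)) :
    ‖riemannianGradient n u (σ y)‖ ^ 2 =
      lorentz (ambientGradient (graphMap f) v y) (ambientGradient (graphMap f) v y) := by
  rw [← real_inner_self_eq_norm_sq, ← hx.isometric, h.differential_riemannianGradient hx hv huv]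

lemma metricMatrix_eq [IsManifold (𝓡 n) ∞ M] (hx : IsSpacelikeHypersurface x N) (q : M)
    {z : EuclideanSpace ℝ (Fin n)} (hz : z ∈ (chartAt (EuclideanSpace ℝ (Fin n)) q).target) :
    metricMatrix q z = gramMatrix (x ∘ (chartAt (EuclideanSpace ℝ (Fin n)) q).symm) z := by
  ext i j
  have hd : MDifferentiableAt (𝓡 n) (𝓡 n) (chartAt (EuclideanSpace ℝ (Fin n)) q).symm z :=
    ((contMDiffOn_chart_symm (n := ∞) (I := 𝓡 n) (x := q)).contMDiffAt
      ((chartAt (EuclideanSpace ℝ (Fin n)) q).open_target.mem_nhds hz)).mdifferentiableAt (by simp)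
  have key : ∀ i, differential x _ (coordVector q z i) =
      partialDeriv (x ∘ (chartAt (EuclideanSpace ℝ (Fin n)) q).symm) i z := fun i =>
    differential_mfderiv ((hx.smooth _).mdifferentiableAt (by simp)) hd _
  simp only [metricMatrix, gramMatrix, of_apply, ← hx.isometric, key]

/-- The left side lives in the preferred chart at the point. The transition `θ` from it to the graph
chart has invertible differential, so coordinate invariance (`coordLaplacian_comp`) moves the
computation to the graph. -/
lemma riemannianLaplacian_eq [IsManifold (𝓡 n) ∞ M] (h : IsGraphChart x σ f)
    (hx : IsSpacelikeHypersurface x N)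
    {u : M → ℝ} {v : EuclideanSpace ℝ (Fin n) → ℝ} (hv : ContDiff ℝ ∞ v)
    (huv : ∀ y, u (σ y) = v y) (y : EuclideanSpace ℝ (Fin n)) :
    riemannianLaplacian n u (σ y) = coordLaplacian (gramMatrix (graphMap f)) v y := by
  let φ := chartAt (EuclideanSpace ℝ (Fin n)) (σ y)
  let θ := spatial n ∘ x ∘ φ.symm
  have hy : φ (σ y) ∈ φ.target := φ.map_source (mem_chart_source _ _)
  have hφ : ∀ z ∈ φ.target, ContMDiffAt (𝓡 n) (𝓡 n) ∞ φ.symm z := fun z hz =>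
    (contMDiffOn_chart_symm (I := 𝓡 n) (x := σ y)).contMDiffAt (φ.open_target.mem_nhds hz)
  have hθ : ∀ z ∈ φ.target, ContDiffAt ℝ ∞ θ z := fun z hz =>
    (spatial n).contDiff.contDiffAt.comp z
      (ContMDiffAt.comp z (hx.smooth _) (hφ z hz)).contDiffAt
  have hσθ : ∀ z, σ (θ z) = φ.symm z := fun z => h.left_inv _
  have hθy : θ (φ (σ y)) = y := by
    change spatial n (x (φ.symm (φ (σ y)))) = y
    rw [φ.left_inv (mem_chart_source _ _), h.right_inv]
  have h1 : metricMatrix (σ y) =ᶠ[𝓝 (φ (σ y))] gramMatrix (graphMap f ∘ θ) := by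
    filter_upwards [φ.open_target.mem_nhds hy] with z hz
    rw [metricMatrix_eq hx (σ y) hz]
    congr 1
    funext z
    rw [Function.comp_apply, Function.comp_apply, ← h.apply_eq, hσθ]
  have h2 : u ∘ φ.symm = v ∘ θ := by
    funext z
    rw [Function.comp_apply, Function.comp_apply, ← huv, hσθ]
  have hinj : Function.Injective (fderiv ℝ θ (φ (σ y))) := by
    have hs : ContMDiffAt (𝓡 n) (𝓡 n) ∞ φ (φ.symm (φ (σ y))) := by
      rw [φ.left_inv (mem_chart_source _ _)]
      exact (contMDiffOn_chart (I := 𝓡 n) (x := σ y)).contMDiffAt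
        (φ.open_source.mem_nhds (mem_chart_source _ _))
    have hs' : DifferentiableAt ℝ (φ ∘ σ) (θ (φ (σ y))) := by
      have : ContMDiffAt (𝓡 n) (𝓡 n) ∞ (φ ∘ σ) (θ (φ (σ y))) :=
        ContMDiffAt.comp _ (by rw [hσθ]; exact hs) (h.smooth_map _)
      exact this.contDiffAt.differentiableAt (by simp)
    have hid : ((φ ∘ σ) ∘ θ) =ᶠ[𝓝 (φ (σ y))] id := by
      filter_upwards [φ.open_target.mem_nhds hy] with z hz
      rw [Function.comp_apply, Function.comp_apply, hσθ, φ.right_inv hz]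
      rfl
    have hcomp := hid.fderiv_eq (𝕜 := ℝ)
    rw [fderiv_comp _ hs' ((hθ _ hy).differentiableAt (by simp)), fderiv_id] at hcomp
    intro a b hab
    have ha := congrArg (fun L => L a) hcomp
    have hb := congrArg (fun L => L b) hcomp
    simp only [ContinuousLinearMap.comp_apply, ContinuousLinearMap.id_apply] at ha hb
    rw [← ha, ← hb, hab]
  have h3 := coordLaplacian_comp (F := graphMap f) (v := v) (contDiff_graphMap h.smooth_fun) hv
    (h.det_gramMatrix_pos hx) (by filter_upwards [φ.open_target.mem_nhds hy] with z hz using hθ z hz)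
    hinj
  rw [hθy] at h3
  rw [← h3, ← h2]
  exact coordLaplacian_congr h1 EventuallyEq.rfl

end IsGraphChart

end GraphFormulas

/-! ### Second-order jets in a coordinate direction. -/

section Jets

open Filter Topology

variable {n : ℕ}

/-- `φ` is smooth, with value `a` at `y`, and with first and second derivatives `b` and `c` in the
direction of the `k`-th coordinate. -/
structure HasJet (φ : EuclideanSpace ℝ (Fin n) → ℝ) (k : Fin n) (y : EuclideanSpace ℝ (Fin n))
    (a b c : ℝ) : Prop where
  smooth : ContDiff ℝ ∞ φ
  value : φ y = a
  first : partialDeriv φ k y = b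
  second : partialDeriv (partialDeriv φ k) k y = c

variable {φ ψ : EuclideanSpace ℝ (Fin n) → ℝ} {k : Fin n} {y : EuclideanSpace ℝ (Fin n)}
  {a b c a' b' c' : ℝ}

lemma hasJet_of_contDiff (hφ : ContDiff ℝ ∞ φ) (k : Fin n) (y : EuclideanSpace ℝ (Fin n)) :
    HasJet φ k y (φ y) (partialDeriv φ k y) (partialDeriv (partialDeriv φ k) k y) :=
  ⟨hφ, rfl, rfl, rfl⟩

lemma partialDeriv_add (hφ : ContDiff ℝ ∞ φ) (hψ : ContDiff ℝ ∞ ψ) (k : Fin n) :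
    partialDeriv (fun y => φ y + ψ y) k = fun y => partialDeriv φ k y + partialDeriv ψ k y := by
  funext y
  rw [partialDeriv, fderiv_fun_add (hφ.differentiable (by simp) y) (hψ.differentiable (by simp) y)]
  rfl

lemma partialDeriv_mul (hφ : ContDiff ℝ ∞ φ) (hψ : ContDiff ℝ ∞ ψ) (k : Fin n) :
    partialDeriv (fun y => φ y * ψ y) k =
      fun y => φ y * partialDeriv ψ k y + ψ y * partialDeriv φ k y := by
  funext y
  rw [partialDeriv, fderiv_fun_mul (hφ.differentiable (by simp) y) (hψ.differentiable (by simp) y)]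
  rfl

lemma partialDeriv_const (r : ℝ) (k : Fin n) :
    partialDeriv (fun _ : EuclideanSpace ℝ (Fin n) => r) k = fun _ => 0 := by
  funext y; simp [partialDeriv]

namespace HasJet

lemma congr_jet (h : HasJet φ k y a b c) (ha : a = a') (hb : b = b') (hc : c = c') :
    HasJet φ k y a' b' c' := by subst ha hb hc; exact h

lemma congr_fun (h : HasJet φ k y a b c) (hφ : ψ = φ) : HasJet ψ k y a b c := by
  subst hφ; exact h

/-- This is how an identity between functions is differentiated twice: both sides are given jets,
and the entries are compared. -/
lemma unique (h : HasJet φ k y a b c) (h' : HasJet φ k y a' b' c') : a = a' ∧ b = b' ∧ c = c' :=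
  ⟨h.value.symm.trans h'.value, h.first.symm.trans h'.first, h.second.symm.trans h'.second⟩

lemma const (r : ℝ) (k : Fin n) (y : EuclideanSpace ℝ (Fin n)) :
    HasJet (fun _ => r) k y r 0 0 :=
  ⟨contDiff_const, rfl, by rw [partialDeriv_const], by rw [partialDeriv_const, partialDeriv_const]⟩

lemma add (h : HasJet φ k y a b c) (h' : HasJet ψ k y a' b' c') :
    HasJet (fun y => φ y + ψ y) k y (a + a') (b + b') (c + c') := by
  refine ⟨h.smooth.add h'.smooth, by rw [h.value, h'.value], ?_, ?_⟩
  · simp only [partialDeriv_add h.smooth h'.smooth, h.first, h'.first]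
  · simp only [partialDeriv_add h.smooth h'.smooth,
      partialDeriv_add (h.smooth.partialDeriv k) (h'.smooth.partialDeriv k), h.second, h'.second]

lemma mul (h : HasJet φ k y a b c) (h' : HasJet ψ k y a' b' c') :
    HasJet (fun y => φ y * ψ y) k y (a * a') (b * a' + a * b') (c * a' + 2 * b * b' + a * c') := by
  refine ⟨h.smooth.mul h'.smooth, by rw [h.value, h'.value], ?_, ?_⟩
  · simp only [partialDeriv_mul h.smooth h'.smooth, h.first, h'.first, h.value, h'.value]; ring
  · simp only [partialDeriv_mul h.smooth h'.smooth,
      partialDeriv_add (h.smooth.mul (h'.smooth.partialDeriv k))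
        (h'.smooth.mul (h.smooth.partialDeriv k)),
      partialDeriv_mul h.smooth (h'.smooth.partialDeriv k),
      partialDeriv_mul h'.smooth (h.smooth.partialDeriv k), h.second, h'.second, h.first, h'.first,
      h.value, h'.value]
    ring

lemma const_mul (r : ℝ) (h : HasJet φ k y a b c) :
    HasJet (fun y => r * φ y) k y (r * a) (r * b) (r * c) :=
  ((const r k y).mul h).congr_jet rfl (by ring) (by ring)

lemma sub (h : HasJet φ k y a b c) (h' : HasJet ψ k y a' b' c') :
    HasJet (fun y => φ y - ψ y) k y (a - a') (b - b') (c - c') :=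
  ((h.add (h'.const_mul (-1))).congr_jet (by ring) (by ring) (by ring)).congr_fun
    (by funext y; ring)

lemma sq (h : HasJet φ k y a b c) :
    HasJet (fun y => φ y ^ 2) k y (a ^ 2) (2 * a * b) (2 * b ^ 2 + 2 * a * c) :=
  ((h.mul h).congr_jet (by ring) (by ring) (by ring)).congr_fun (by funext y; ring)

lemma sum {ι : Type*} {s : Finset ι} {φ : ι → EuclideanSpace ℝ (Fin n) → ℝ} {a b c : ι → ℝ}
    (h : ∀ i ∈ s, HasJet (φ i) k y (a i) (b i) (c i)) :
    HasJet (fun y => ∑ i ∈ s, φ i y) k y (∑ i ∈ s, a i) (∑ i ∈ s, b i) (∑ i ∈ s, c i) := by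
  classical
  induction s using Finset.induction_on with
  | empty => simpa using const 0 k y
  | insert i s hi ih =>
    have h1 := (h i (Finset.mem_insert_self i s)).add
      (ih fun j hj => h j (Finset.mem_insert_of_mem hj))
    refine (h1.congr_jet ?_ ?_ ?_).congr_fun ?_
    · rw [Finset.sum_insert hi]
    · rw [Finset.sum_insert hi]
    · rw [Finset.sum_insert hi]
    · funext y; rw [Finset.sum_insert hi]

lemma coord (i k : Fin n) (y : EuclideanSpace ℝ (Fin n)) :
    HasJet (fun y : EuclideanSpace ℝ (Fin n) => y i) k y (y i) (if i = k then 1 else 0) 0 := by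
  have h1 : partialDeriv (fun y : EuclideanSpace ℝ (Fin n) => y i) k =
      fun _ => if i = k then 1 else 0 := by
    funext y
    have : fderiv ℝ (fun y : EuclideanSpace ℝ (Fin n) => y i) y =
        (EuclideanSpace.proj i : EuclideanSpace ℝ (Fin n) →L[ℝ] ℝ) :=
      (EuclideanSpace.proj i : EuclideanSpace ℝ (Fin n) →L[ℝ] ℝ).fderiv
    rw [partialDeriv, this]
    simp
  exact ⟨(EuclideanSpace.proj i : EuclideanSpace ℝ (Fin n) →L[ℝ] ℝ).contDiff, rfl, by rw [h1],
    by rw [h1, partialDeriv_const]⟩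

end HasJet

end Jets

/-! ### Derivatives of the geometric quantities at a horizontal point with diagonal Hessian. -/

section AdaptedGraph

open Filter Topology

variable {n : ℕ}

/-- The graph of `f` is horizontal at `y₀`, with upward normal there, and with principal curvatures
`κ` in the coordinate directions. -/
structure IsAdaptedGraph (f ν : EuclideanSpace ℝ (Fin n) → ℝ) (y₀ : EuclideanSpace ℝ (Fin n))
    (κ : Fin n → ℝ) : Prop where
  smooth : ContDiff ℝ ∞ f
  smooth_normal : ContDiff ℝ ∞ ν
  unit : ∀ y, ν y ^ 2 * (1 - ∑ i, partialDeriv f i y ^ 2) = 1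
  slope : ∀ i, partialDeriv f i y₀ = 0
  upward : ν y₀ = 1
  hessian : ∀ i j, partialDeriv (partialDeriv f j) i y₀ = if i = j then κ i else 0

/-- The third derivatives of a function. -/
noncomputable def thirdDeriv (f : EuclideanSpace ℝ (Fin n) → ℝ) (y : EuclideanSpace ℝ (Fin n))
    (i j k : Fin n) : ℝ :=
  partialDeriv (partialDeriv (partialDeriv f i) j) k y

/-- The fourth derivatives `f_{iikk}` of a function. -/
noncomputable def fourthDeriv (f : EuclideanSpace ℝ (Fin n) → ℝ) (y : EuclideanSpace ℝ (Fin n))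
    (i k : Fin n) : ℝ :=
  partialDeriv (partialDeriv (partialDeriv (partialDeriv f i) i) k) k y

lemma partialDeriv_comm' {f : EuclideanSpace ℝ (Fin n) → ℝ} (hf : ContDiff ℝ ∞ f) (i j : Fin n) :
    partialDeriv (partialDeriv f i) j = partialDeriv (partialDeriv f j) i :=
  funext fun _ => partialDeriv_comm hf.contDiffAt i j

lemma thirdDeriv_swap_left {f : EuclideanSpace ℝ (Fin n) → ℝ} (hf : ContDiff ℝ ∞ f)
    (y : EuclideanSpace ℝ (Fin n)) (i j k : Fin n) :
    thirdDeriv f y i j k = thirdDeriv f y j i k := by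
  rw [thirdDeriv, thirdDeriv, partialDeriv_comm' hf]

lemma thirdDeriv_swap_right {f : EuclideanSpace ℝ (Fin n) → ℝ} (hf : ContDiff ℝ ∞ f)
    (y : EuclideanSpace ℝ (Fin n)) (i j k : Fin n) :
    thirdDeriv f y i j k = thirdDeriv f y i k j := by
  rw [thirdDeriv, thirdDeriv, partialDeriv_comm' (hf.partialDeriv i)]

lemma fourthDeriv_swap {f : EuclideanSpace ℝ (Fin n) → ℝ} (hf : ContDiff ℝ ∞ f)
    (y : EuclideanSpace ℝ (Fin n)) (i k : Fin n) :
    fourthDeriv f y i k = fourthDeriv f y k i := by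
  rw [fourthDeriv, fourthDeriv, partialDeriv_comm' (hf.partialDeriv i) i k,
    partialDeriv_comm' hf i k, partialDeriv_comm' ((hf.partialDeriv k).partialDeriv i) i k,
    partialDeriv_comm' (hf.partialDeriv k) i k]

namespace IsAdaptedGraph

variable {f ν : EuclideanSpace ℝ (Fin n) → ℝ} {y₀ : EuclideanSpace ℝ (Fin n)} {κ : Fin n → ℝ}

lemma jet_slope (h : IsAdaptedGraph f ν y₀ κ) (i k : Fin n) :
    HasJet (partialDeriv f i) k y₀ 0 (if i = k then κ k else 0) (thirdDeriv f y₀ i k k) :=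
  (hasJet_of_contDiff (h.smooth.partialDeriv i) k y₀).congr_jet (h.slope i)
    (by rw [h.hessian]; simp only [eq_comm]) rfl

lemma jet_fun (h : IsAdaptedGraph f ν y₀ κ) (k : Fin n) :
    HasJet f k y₀ (f y₀) 0 (κ k) :=
  (hasJet_of_contDiff h.smooth k y₀).congr_jet rfl (h.slope k) (by rw [h.hessian, if_pos rfl])

lemma jet_hessian (h : IsAdaptedGraph f ν y₀ κ) (i j k : Fin n) :
    HasJet (partialDeriv (partialDeriv f j) i) k y₀ (if i = j then κ i else 0)
      (thirdDeriv f y₀ j i k) (partialDeriv (partialDeriv (partialDeriv (partialDeriv f j) i) k) k y₀) :=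
  (hasJet_of_contDiff ((h.smooth.partialDeriv j).partialDeriv i) k y₀).congr_jet (h.hessian i j) rfl rfl

/-- Obtained by differentiating `ν²(1 - |∇f|²) = 1` twice: at the point `|∇f|²` has zero value and
slope, and second derivative `2κₖ²`. -/
lemma jet_normal (h : IsAdaptedGraph f ν y₀ κ) (k : Fin n) : HasJet ν k y₀ 1 0 (κ k ^ 2) := by
  have hν := hasJet_of_contDiff h.smooth_normal k y₀
  rw [h.upward] at hν
  have hq : HasJet (fun y => ∑ i, partialDeriv f i y ^ 2) k y₀ 0 0 (2 * κ k ^ 2) := by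
    refine (HasJet.sum fun i _ => (h.jet_slope i k).sq).congr_jet (by simp) (by simp) ?_
    simp [ite_pow]
  have h1 := hν.sq.mul ((HasJet.const 1 k y₀).sub hq)
  have h2 := h1.unique ((HasJet.const 1 k y₀).congr_fun (funext h.unit))
  obtain ⟨-, e1, e2⟩ := h2
  have e3 : partialDeriv ν k y₀ = 0 := by linarith
  rw [e3] at e2
  exact hν.congr_jet rfl e3 (by linarith)

/-- Both slope factors vanish at the point, so the two derivatives must fall one on each. Only `i =
j = k` survives, with `2κₖ²` from the slopes and `κₖ` from the Hessian. -/
lemma jet_slope_hessian_slope (h : IsAdaptedGraph f ν y₀ κ) (k : Fin n) :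
    HasJet (fun y => ∑ i, ∑ j, partialDeriv f i y * partialDeriv f j y *
      partialDeriv (partialDeriv f j) i y) k y₀ 0 0 (2 * κ k ^ 3) := by
  refine (HasJet.sum fun i _ => HasJet.sum fun j _ =>
    ((h.jet_slope i k).mul (h.jet_slope j k)).mul (h.jet_hessian i j k)).congr_jet (by simp)
      (by simp) ?_
  simp only [zero_mul, mul_zero, add_zero, zero_add]
  rw [Finset.sum_eq_single k, Finset.sum_eq_single k]
  · simp; ring
  · intro j _ hj; simp [hj]
  · simp
  · intro i _ hi; simp [hi]
  · simp

lemma jet_meanCurvature (h : IsAdaptedGraph f ν y₀ κ) (k : Fin n) :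
    HasJet (graphMeanCurvature f ν) k y₀ (∑ i, κ i) (∑ i, thirdDeriv f y₀ i i k)
      (∑ i, fourthDeriv f y₀ i k + 2 * κ k ^ 3 + κ k ^ 2 * ∑ i, κ i) := by
  have h1 : HasJet (fun y => ∑ i, partialDeriv (partialDeriv f i) i y) k y₀ (∑ i, κ i)
      (∑ i, thirdDeriv f y₀ i i k) (∑ i, fourthDeriv f y₀ i k) :=
    (HasJet.sum fun i _ => h.jet_hessian i i k).congr_jet (by simp) rfl rfl
  refine ((h.jet_normal k).mul (h1.add ((h.jet_normal k).sq.mul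
    (h.jet_slope_hessian_slope k)))).congr_jet ?_ ?_ ?_ <;> ring

lemma jet_normSq (h : IsAdaptedGraph f ν y₀ κ) (k : Fin n) :
    HasJet (graphNormSq f ν) k y₀ (∑ i, κ i ^ 2) (2 * ∑ i, κ i * thirdDeriv f y₀ i i k)
      (2 * ∑ i, ∑ j, thirdDeriv f y₀ i j k ^ 2 + 2 * ∑ i, κ i * fourthDeriv f y₀ i k +
        4 * κ k ^ 4 + 2 * κ k ^ 2 * ∑ i, κ i ^ 2) := by
  have h1 : HasJet (fun y => ∑ i, ∑ j, partialDeriv (partialDeriv f j) i y ^ 2) k y₀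
      (∑ i, κ i ^ 2) (2 * ∑ i, κ i * thirdDeriv f y₀ i i k)
      (2 * ∑ i, ∑ j, thirdDeriv f y₀ i j k ^ 2 + 2 * ∑ i, κ i * fourthDeriv f y₀ i k) := by
    refine (HasJet.sum fun i _ => HasJet.sum fun j _ => (h.jet_hessian i j k).sq).congr_jet
      (by simp [ite_pow]) ?_ ?_
    · rw [Finset.mul_sum]
      refine Finset.sum_congr rfl fun i _ => ?_
      simp [mul_assoc]
    · simp only [Finset.sum_add_distrib]
      congr 1
      · rw [Finset.sum_comm]
        simp_rw [← Finset.mul_sum]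
      · rw [Finset.mul_sum]
        refine Finset.sum_congr rfl fun i _ => ?_
        simp [mul_assoc, fourthDeriv]
  have h2 : HasJet (fun y => ∑ j, (∑ i, partialDeriv f i y * partialDeriv (partialDeriv f j) i y) ^ 2)
      k y₀ 0 0 (2 * κ k ^ 4) := by
    refine (HasJet.sum fun j _ => (HasJet.sum fun i _ =>
      (h.jet_slope i k).mul (h.jet_hessian i j k)).sq).congr_jet (by simp) (by simp) ?_
    simp only [zero_mul, Finset.sum_const_zero, add_zero, mul_zero]
    have : ∀ j, ∑ i, (if i = k then κ k else 0) * (if i = j then κ i else 0) =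
        if j = k then κ k ^ 2 else 0 := by
      intro j
      rw [Finset.sum_eq_single k]
      · simp only [if_true, eq_comm (a := k)]
        split_ifs <;> ring
      · intro i _ hi; simp [hi]
      · simp
    simp_rw [this]
    simp [ite_pow]
    ring
  have h3 := (h.jet_slope_hessian_slope k).sq
  have h4 := (h.jet_normal k).sq
  have h5 : HasJet (fun y => ν y ^ 4) k y₀ 1 0 (4 * κ k ^ 2) :=
    (h4.sq.congr_jet (by ring) (by ring) (by ring)).congr_fun (by funext y; ring)
  refine (h4.mul ((h1.add ((h4.const_mul 2).mul h2)).add (h5.mul h3))).congr_jet ?_ ?_ ?_ <;> ring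

lemma jet_tracelessNormSq (h : IsAdaptedGraph f ν y₀ κ) (k : Fin n) :
    HasJet (graphTracelessNormSq f ν) k y₀ (∑ i, κ i ^ 2 - (∑ i, κ i) ^ 2 / n)
      (2 * ∑ i, κ i * thirdDeriv f y₀ i i k - 2 * (∑ i, κ i) * (∑ i, thirdDeriv f y₀ i i k) / n)
      (2 * ∑ i, ∑ j, thirdDeriv f y₀ i j k ^ 2 + 2 * ∑ i, κ i * fourthDeriv f y₀ i k +
        4 * κ k ^ 4 + 2 * κ k ^ 2 * ∑ i, κ i ^ 2 - (2 * (∑ i, thirdDeriv f y₀ i i k) ^ 2 +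
        2 * (∑ i, κ i) * (∑ i, fourthDeriv f y₀ i k + 2 * κ k ^ 3 + κ k ^ 2 * ∑ i, κ i)) / n) := by
  refine (((h.jet_normSq k).sub ((h.jet_meanCurvature k).sq.const_mul (n : ℝ)⁻¹)).congr_jet
    (by ring) (by ring) (by ring)).congr_fun ?_
  funext y
  rw [graphTracelessNormSq]
  ring

lemma jet_support (h : IsAdaptedGraph f ν y₀ κ) (k : Fin n) :
    HasJet (graphSupport f ν) k y₀ (-f y₀) (y₀ k * κ k)
      (κ k + ∑ i, y₀ i * thirdDeriv f y₀ i k k - f y₀ * κ k ^ 2) := by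
  have h1 : HasJet (fun y => ∑ i, y i * partialDeriv f i y) k y₀ 0 (y₀ k * κ k)
      (2 * κ k + ∑ i, y₀ i * thirdDeriv f y₀ i k k) := by
    refine (HasJet.sum fun i _ => (HasJet.coord i k y₀).mul (h.jet_slope i k)).congr_jet (by simp)
      (by simp) ?_
    simp [Finset.sum_add_distrib]
  refine ((h.jet_normal k).mul (h1.sub (h.jet_fun k))).congr_jet ?_ ?_ ?_ <;> ring

lemma jet_lorentz_self (h : IsAdaptedGraph f ν y₀ κ) (k : Fin n) :
    HasJet (fun y => ∑ i, y i ^ 2 - f y ^ 2) k y₀ (∑ i, y₀ i ^ 2 - f y₀ ^ 2) (2 * y₀ k)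
      (2 - 2 * f y₀ * κ k) := by
  refine ((HasJet.sum fun i _ => (HasJet.coord i k y₀).sq).sub (h.jet_fun k).sq).congr_jet rfl ?_ ?_
  · simp
  · simp [ite_pow]

end IsAdaptedGraph

end AdaptedGraph

/-! ### Simons' identity and the sign of its terms. -/

section SimonsIdentity

variable {n : ℕ}

/-- The algebra of Simons' identity at an adapted point: `T` and `F` stand for the third and fourth
derivatives of the graph function, `y` for the tangential part of `x`, and `f` for `-u`. The term `∑
κᵢFᵢₖ` is turned into `∑ κₖFᵢₖ` by symmetry of fourth derivatives, and then eliminated with the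
twice differentiated equation `hR`. The terms in `T` that are linear cancel against the drift, and
the quartic ones in `κ` cancel among themselves. -/
lemma simons_identity (hn : (n : ℝ) ≠ 0) {κ y : Fin n → ℝ} {T : Fin n → Fin n → Fin n → ℝ}
    {F : Fin n → Fin n → ℝ} {f s lam : ℝ} (hF : ∀ i k, F i k = F k i)
    (hT : ∀ i k, T i k k = T k k i) (hs : s = ∑ k, y k ^ 2 - f ^ 2)
    (hH : ∑ k, κ k = lam - s * f)
    (hR : ∀ k, ∑ i, F i k + 2 * κ k ^ 3 + κ k ^ 2 * ∑ i, κ i =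
      (2 - 2 * f * κ k) * -f + 2 * (2 * y k) * (y k * κ k) +
        s * (κ k + ∑ i, y i * T i k k - f * κ k ^ 2)) :
    ∑ k, (2 * ∑ i, ∑ j, T i j k ^ 2 + 2 * ∑ i, κ i * F i k + 4 * κ k ^ 4 +
        2 * κ k ^ 2 * ∑ i, κ i ^ 2 - (2 * (∑ i, T i i k) ^ 2 +
        2 * (∑ i, κ i) * (∑ i, F i k + 2 * κ k ^ 3 + κ k ^ 2 * ∑ i, κ i)) / n) -
      s * ∑ k, y k * (2 * ∑ i, κ i * T i i k - 2 * (∑ i, κ i) * (∑ i, T i i k) / n) =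
    2 * ((∑ k, ∑ i, ∑ j, T i j k ^ 2 - (∑ k, (∑ i, T i i k) ^ 2) / n) +
      (∑ i, κ i ^ 2) * (∑ i, κ i ^ 2 - (∑ i, κ i) ^ 2 / n) -
      lam * (∑ i, κ i ^ 3 - (∑ i, κ i) * (∑ i, κ i ^ 2) / n) +
      f ^ 2 * (∑ i, κ i ^ 2 - (∑ i, κ i) ^ 2 / n) +
      ∑ k, (4 * κ k ^ 2 - 4 * (∑ i, κ i) / n * κ k + (∑ i, κ i ^ 2 - (∑ i, κ i) ^ 2 / n)) *
        y k ^ 2) := by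
  set H := ∑ i, κ i
  set S := ∑ i, κ i ^ 2 with hS
  set R : Fin n → ℝ := fun k => (2 - 2 * f * κ k) * -f + 2 * (2 * y k) * (y k * κ k) +
        s * (κ k + ∑ i, y i * T i k k - f * κ k ^ 2) with hRdef
  set W := ∑ k, y k * ∑ i, κ i * T i i k with hW
  set V := ∑ k, y k * ∑ i, T i i k with hV
  have hR : ∀ k, ∑ i, F i k + 2 * κ k ^ 3 + κ k ^ 2 * H = R k := hR
  have e1 : ∑ k, ∑ i, κ i * F i k = ∑ k, κ k * R k - 2 * ∑ k, κ k ^ 4 - H * ∑ k, κ k ^ 3 := by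
    rw [Finset.sum_comm, Finset.mul_sum, Finset.mul_sum, ← Finset.sum_sub_distrib,
      ← Finset.sum_sub_distrib]
    refine Finset.sum_congr rfl fun k _ => ?_
    rw [← Finset.mul_sum, ← hR k, Finset.sum_congr rfl fun i _ => hF k i]
    ring
  have hW' : ∑ k, κ k * ∑ i, y i * T i k k = W := by
    simp_rw [hW, Finset.mul_sum]
    rw [Finset.sum_comm]
    exact Finset.sum_congr rfl fun i _ => Finset.sum_congr rfl fun k _ => by rw [hT]; ring
  have hV' : ∑ k, ∑ i, y i * T i k k = V := by
    simp_rw [hV, Finset.mul_sum]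
    rw [Finset.sum_comm]
    exact Finset.sum_congr rfl fun i _ => Finset.sum_congr rfl fun k _ => by rw [hT]
  have e2 : ∑ k, κ k * R k = -2 * f * H + (2 * f ^ 2 + s) * S + 4 * ∑ k, κ k ^ 2 * y k ^ 2 +
      s * W - s * f * ∑ k, κ k ^ 3 := by
    rw [← hW']
    simp only [H, hS, Finset.mul_sum _ _ (_ : ℝ), ← Finset.sum_add_distrib, ← Finset.sum_sub_distrib]
    refine Finset.sum_congr rfl fun k _ => ?_
    simp only [hRdef, ← Finset.mul_sum]
    ring
  have e3 : ∑ k, R k = -2 * f * n + (2 * f ^ 2 + s) * H + 4 * ∑ k, κ k * y k ^ 2 +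
      s * V - s * f * S := by
    have : (n : ℝ) = ∑ _k : Fin n, 1 := by simp
    rw [← hV', this]
    simp only [H, hS, Finset.mul_sum _ _ (_ : ℝ), ← Finset.sum_add_distrib, ← Finset.sum_sub_distrib]
    refine Finset.sum_congr rfl fun k _ => ?_
    simp only [hRdef, ← Finset.mul_sum]
    ring
  clear_value H S R
  have e4 : ∑ k, (2 * ∑ i, ∑ j, T i j k ^ 2 + 2 * ∑ i, κ i * F i k + 4 * κ k ^ 4 +
        2 * κ k ^ 2 * S - (2 * (∑ i, T i i k) ^ 2 + 2 * H * (∑ i, F i k + 2 * κ k ^ 3 +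
          κ k ^ 2 * H)) / n) =
      2 * ∑ k, ∑ i, ∑ j, T i j k ^ 2 + 2 * (∑ k, ∑ i, κ i * F i k) + 4 * ∑ k, κ k ^ 4 +
        2 * S * S - (2 * ∑ k, (∑ i, T i i k) ^ 2 + 2 * H * ∑ k, R k) / n := by
    simp_rw [hR]
    rw [Finset.sum_sub_distrib, Finset.sum_add_distrib, Finset.sum_add_distrib,
      Finset.sum_add_distrib, ← Finset.sum_div, Finset.sum_add_distrib, ← Finset.mul_sum,
      ← Finset.mul_sum, ← Finset.mul_sum, ← Finset.mul_sum, ← Finset.mul_sum, ← Finset.sum_mul,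
      ← Finset.mul_sum, ← hS]
  have e5 : ∑ k, y k * (2 * ∑ i, κ i * T i i k - 2 * H * (∑ i, T i i k) / n) =
      2 * W - 2 * H * V / n := by
    rw [hW, hV, Finset.mul_sum, Finset.mul_sum, Finset.sum_div, ← Finset.sum_sub_distrib]
    exact Finset.sum_congr rfl fun k _ => by ring
  have e6 : ∑ k, (4 * κ k ^ 2 - 4 * H / n * κ k + (S - H ^ 2 / n)) * y k ^ 2 =
      4 * ∑ k, κ k ^ 2 * y k ^ 2 - 4 * H / n * ∑ k, κ k * y k ^ 2 +
        (S - H ^ 2 / n) * ∑ k, y k ^ 2 := by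
    rw [Finset.mul_sum, Finset.mul_sum, Finset.mul_sum, ← Finset.sum_sub_distrib,
      ← Finset.sum_add_distrib]
    exact Finset.sum_congr rfl fun k _ => by ring
  -- Eliminating `λ` and `|y|²` leaves `s` and `f` as free variables, so the remaining claim is a
  -- polynomial identity.
  have hlam : lam = H + s * f := by linarith
  have hy : ∑ k, y k ^ 2 = s + f ^ 2 := by linarith
  rw [e4, e5, e6, e1, e2, e3, hlam, hy]
  field_simp
  ring

/-- Cauchy-Schwarz for the trace, then omission of the entries with `i ≠ j`. The two steps are kept
apart because the case of equality is needed. -/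
lemma sum_sq_trace_le {T : Fin n → Fin n → Fin n → ℝ} :
    (∑ k, (∑ i, T i i k) ^ 2) / n ≤ ∑ k, ∑ i, T i i k ^ 2 ∧
      ∑ k, ∑ i, T i i k ^ 2 ≤ ∑ k, ∑ i, ∑ j, T i j k ^ 2 := by
  constructor
  · rw [Finset.sum_div]
    refine Finset.sum_le_sum fun k _ => div_le_of_le_mul₀ (by positivity)
      (Finset.sum_nonneg fun _ _ => sq_nonneg _) ?_
    have := sq_sum_le_card_mul_sum_sq (s := Finset.univ) (f := fun i => T i i k)
    rw [Finset.card_univ, Fintype.card_fin] at this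
    linarith
  · exact Finset.sum_le_sum fun k _ => Finset.sum_le_sum fun i _ =>
      Finset.single_le_sum (f := fun j => T i j k ^ 2) (fun _ _ => sq_nonneg _) (Finset.mem_univ i)

/-- A symmetric tensor of order three is zero if its norm is controlled by that of its trace. -/
lemma eq_zero_of_sum_sq_le (hn : 2 ≤ n) {T : Fin n → Fin n → Fin n → ℝ}
    (hT : ∀ i j k, T i j k = T i k j)
    (h : ∑ k, ∑ i, ∑ j, T i j k ^ 2 ≤ (∑ k, (∑ i, T i i k) ^ 2) / n) (i j k : Fin n) :
    T i j k = 0 := by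
  have hn0 : (2 : ℝ) ≤ n := by exact_mod_cast hn
  obtain ⟨h1, h2⟩ := sum_sq_trace_le (T := T)
  have h3 : ∑ k, ∑ i, T i i k ^ 2 = ∑ k, ∑ i, ∑ j, T i j k ^ 2 := le_antisymm h2 (h.trans h1)
  -- Equality in the second step kills the entries with `i ≠ j`.
  have h4 : ∀ k i j, i ≠ j → T i j k = 0 := by
    intro k i j hij
    have a1 := (Finset.sum_eq_sum_iff_of_le fun k _ => Finset.sum_le_sum fun i _ =>
      Finset.single_le_sum (f := fun j => T i j k ^ 2) (fun _ _ => sq_nonneg _)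
        (Finset.mem_univ i)).1 h3 k (Finset.mem_univ k)
    have a2 := (Finset.sum_eq_sum_iff_of_le fun i _ =>
      Finset.single_le_sum (f := fun j => T i j k ^ 2) (fun _ _ => sq_nonneg _)
        (Finset.mem_univ i)).1 a1 i (Finset.mem_univ i)
    have a3 := Finset.sum_erase_eq_sub (s := Finset.univ) (f := fun j => T i j k ^ 2)
      (Finset.mem_univ i)
    rw [← a2, sub_self] at a3
    have a4 := (Finset.sum_eq_zero_iff_of_nonneg fun _ _ => sq_nonneg _).1 a3 j
      (Finset.mem_erase.2 ⟨hij.symm, Finset.mem_univ j⟩)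
    exact pow_eq_zero_iff (two_ne_zero) |>.1 a4
  have h5 : ∀ k, ∑ i, T i i k = T k k k := fun k =>
    Finset.sum_eq_single k (fun i _ hi => by rw [hT, h4 i i k hi]) (by simp)
  have h6 : ∀ k, ∑ i, T i i k ^ 2 = T k k k ^ 2 := fun k =>
    Finset.sum_eq_single k (fun i _ hi => by rw [hT, h4 i i k hi]; ring) (by simp)
  simp only [← h3, h5, h6] at h
  -- By symmetry only the entries `T k k k` are left, and the hypothesis says that the sum of their
  -- squares is at most `1/n` of itself, with `n ≥ 2`.
  have h7 : ∑ k, T k k k ^ 2 = 0 := by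
    have h0 : 0 ≤ ∑ k, T k k k ^ 2 := Finset.sum_nonneg fun _ _ => sq_nonneg _
    rw [le_div_iff₀ (by linarith)] at h
    nlinarith
  by_cases hij : i = j
  · subst hij
    by_cases hik : i = k
    · subst hik
      exact pow_eq_zero_iff (two_ne_zero) |>.1
        ((Finset.sum_eq_zero_iff_of_nonneg fun _ _ => sq_nonneg _).1 h7 i (Finset.mem_univ i))
    · rw [hT, h4 i i k hik]
  · exact h4 k i j hij

/-- The cubic term of Simons' identity is controlled by Okumura's inequality. -/
lemma cubic_term_le (hn : 2 ≤ n) (κ : Fin n → ℝ) (lam : ℝ) :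
    (∑ i, κ i ^ 2 - (∑ i, κ i) ^ 2 / n) *
      ((Real.sqrt (∑ i, κ i ^ 2 - (∑ i, κ i) ^ 2 / n)
          - |lam| * ((n - 2) / (2 * Real.sqrt (n * (n - 1))))) ^ 2
        + 1 / n * (∑ i, κ i - lam) ^ 2 - n * lam ^ 2 / (4 * (n - 1))) ≤
    (∑ i, κ i ^ 2) * (∑ i, κ i ^ 2 - (∑ i, κ i) ^ 2 / n) -
      lam * (∑ i, κ i ^ 3 - (∑ i, κ i) * (∑ i, κ i ^ 2) / n) := by
  have hn0 : (2 : ℝ) ≤ n := by exact_mod_cast hn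
  have hn1 : (n : ℝ) ≠ 0 := by linarith
  have hn2 : (n : ℝ) - 1 ≠ 0 := by linarith
  set H := ∑ i, κ i with hH
  set S := ∑ i, κ i ^ 2 with hS
  set μ : Fin n → ℝ := fun i => κ i - H / n with hμ
  have m1 : ∑ i, μ i = 0 := by
    simp only [hμ, Finset.sum_sub_distrib, Finset.sum_const, Finset.card_univ, Fintype.card_fin,
      nsmul_eq_mul, ← hH]
    field_simp
    ring
  have m2 : ∑ i, μ i ^ 2 = S - H ^ 2 / n := by
    have : ∀ i, μ i ^ 2 = κ i ^ 2 - 2 * (H / n) * κ i + (H / n) ^ 2 := fun i => by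
      simp only [hμ]; ring
    simp only [this, Finset.sum_add_distrib, Finset.sum_sub_distrib, ← Finset.mul_sum,
      Finset.sum_const, Finset.card_univ, Fintype.card_fin, nsmul_eq_mul, ← hH, ← hS]
    field_simp
    ring
  -- Passing to the trace-free part, where Okumura's inequality applies.
  have m3 : ∑ i, κ i ^ 3 - H * S / n = ∑ i, μ i ^ 3 + 2 * H / n * (S - H ^ 2 / n) := by
    have : ∀ i, μ i ^ 3 = κ i ^ 3 - 3 * (H / n) * κ i ^ 2 + 3 * (H / n) ^ 2 * κ i - (H / n) ^ 3 :=
      fun i => by simp only [hμ]; ring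
    simp only [this, Finset.sum_add_distrib, Finset.sum_sub_distrib, ← Finset.mul_sum,
      Finset.sum_const, Finset.card_univ, Fintype.card_fin, nsmul_eq_mul, ← hH, ← hS]
    field_simp
    ring
  have h1 := abs_sum_pow_three_le hn0 (by simp) m1
  rw [m2] at h1
  rw [m3]
  set B := S - H ^ 2 / n with hB
  have hB0 : 0 ≤ B := by rw [← m2]; exact Finset.sum_nonneg fun _ _ => sq_nonneg _
  set r := Real.sqrt B
  have hr : r ^ 2 = B := Real.sq_sqrt hB0
  set q := Real.sqrt (n * (n - 1)) with hq
  have hq2 : q ^ 2 = n * (n - 1) := Real.sq_sqrt (by nlinarith)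
  have hq0 : 0 < q := Real.sqrt_pos.2 (by nlinarith)
  have h2 : lam * ∑ i, μ i ^ 3 ≤ |lam| * ((n - 2) / q * B * r) :=
    (le_abs_self _).trans (by rw [abs_mul]; exact mul_le_mul_of_nonneg_left h1 (abs_nonneg _))
  -- The `λ²` terms cancel, since `(n - 2)² + 4(n - 1) = n²`; the expression in (b) is this
  -- quadratic with its squares completed.
  have h3 : (r - |lam| * ((n - 2) / (2 * q))) ^ 2 + 1 / n * (H - lam) ^ 2 -
      n * lam ^ 2 / (4 * (n - 1)) = B - |lam| * ((n - 2) / q) * r + H ^ 2 / n - 2 * H * lam / n := by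
    have : (|lam| * ((n - 2) / (2 * q))) ^ 2 = lam ^ 2 * ((n - 2) ^ 2 / (4 * (n * (n - 1)))) := by
      rw [mul_pow, sq_abs, div_pow, mul_pow, hq2]; ring
    have e : |lam| * ((n - 2) / (2 * q)) = |lam| * ((n - 2) / q) / 2 := by
      field_simp
    rw [sub_sq, this, hr, e]
    field_simp
    ring
  have hS' : S = B + H ^ 2 / n := by rw [hB]; ring
  have h4 : (B + H ^ 2 / n) * B - lam * (∑ i, μ i ^ 3 + 2 * H / n * B) -
      B * (B - |lam| * ((n - 2) / q) * r + H ^ 2 / n - 2 * H * lam / n) =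
      |lam| * ((n - 2) / q * B * r) - lam * ∑ i, μ i ^ 3 := by ring
  rw [h3, hS']
  linarith

end SimonsIdentity

/-! ### Gradient and drift Laplacian at a horizontal point of a graph. -/

namespace IsGraphChart

open Matrix Filter Topology

variable {n : ℕ} {M : Type*} [TopologicalSpace M] [ChartedSpace (EuclideanSpace ℝ (Fin n)) M]
    [RiemannianBundle (fun p : M => TangentSpace (𝓡 n) p)]
    {x N : M → LorentzSpace n} {σ : EuclideanSpace ℝ (Fin n) → M}
    {f v : EuclideanSpace ℝ (Fin n) → ℝ} {y : EuclideanSpace ℝ (Fin n)}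

lemma inv_gramMatrix_of_horizontal (h : IsGraphChart x σ f) (hx : IsSpacelikeHypersurface x N)
    (hy : ∀ i, partialDeriv f i y = 0) : (gramMatrix (graphMap f) y)⁻¹ = 1 := by
  rw [h.inv_gramMatrix hx]
  ext i j
  simp [hy, vecMulVec_apply]

lemma ambientGradient_of_horizontal (h : IsGraphChart x σ f) (hx : IsSpacelikeHypersurface x N)
    (hy : ∀ i, partialDeriv f i y = 0) :
    ambientGradient (graphMap f) v y = ∑ i, partialDeriv v i y • partialDeriv (graphMap f) i y := by
  rw [ambientGradient]
  refine Finset.sum_congr rfl fun i _ => ?_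
  rw [coordGradient, h.inv_gramMatrix_of_horizontal hx hy]
  simp [one_apply]

lemma lorentz_ambientGradient_of_horizontal (h : IsGraphChart x σ f)
    (hx : IsSpacelikeHypersurface x N) (hy : ∀ i, partialDeriv f i y = 0) :
    lorentz (graphMap f y) (ambientGradient (graphMap f) v y) =
      ∑ k, y k * partialDeriv v k y := by
  rw [h.ambientGradient_of_horizontal hx hy, lorentz_sum_right]
  refine Finset.sum_congr rfl fun i _ => ?_
  rw [lorentz_smul_right, partialDeriv_graphMap h.smooth_fun, hy]
  simp [lorentz, graphMap, Pi.single_apply, mul_comm]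

/-- The metric is the identity at the point, and the Christoffel terms drop out: in the derivative
of `⟨∇v, ∂ᵢF⟩ = ∂ᵢv` the gradient is horizontal while `∂ᵢ∂ᵢF` is vertical. -/
lemma coordLaplacian_of_horizontal (h : IsGraphChart x σ f) (hx : IsSpacelikeHypersurface x N)
    (hv : ContDiff ℝ ∞ v) (hy : ∀ i, partialDeriv f i y = 0) :
    coordLaplacian (gramMatrix (graphMap f)) v y = ∑ k, partialDeriv (partialDeriv v k) k y := by
  have hF := contDiff_graphMap h.smooth_fun
  rw [coordLaplacian_eq hF.contDiffAt hv.contDiffAt (h.det_gramMatrix_pos hx y),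
    h.inv_gramMatrix_of_horizontal hx hy]
  refine Finset.sum_congr rfl fun i _ => ?_
  rw [Finset.sum_eq_single i (fun j _ hj => by rw [one_apply_ne hj.symm, zero_mul]) (by simp),
    one_apply_eq, one_mul]
  have hd : DifferentiableAt ℝ (ambientGradient (graphMap f) v) y :=
    (ContDiffAt.sum fun j _ => (contDiffAt_coordGradient hF.contDiffAt hv.contDiffAt
      (h.det_gramMatrix_pos hx y) j).smul (hF.contDiffAt.partialDeriv j)).differentiableAt
      (by simp : (∞ : WithTop ℕ∞) ≠ 0)
  have h1 : (fun y => lorentz (ambientGradient (graphMap f) v y) (partialDeriv (graphMap f) i y)) =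
      partialDeriv v i :=
    funext fun y => lorentz_ambientGradient (h.det_gramMatrix_pos hx y).ne'.isUnit i
  have h2 := fderiv_lorentz_apply hd ((hF.partialDeriv i).differentiable (by simp) y)
    (EuclideanSpace.single i (1 : ℝ))
  rw [h1] at h2
  have h3 : lorentz (ambientGradient (graphMap f) v y)
      (partialDeriv (partialDeriv (graphMap f) i) i y) = 0 := by
    rw [h.ambientGradient_of_horizontal hx hy, lorentz_sum_left]
    refine Finset.sum_eq_zero fun k _ => ?_
    rw [lorentz_smul_left, partialDeriv_graphMap h.smooth_fun,
      partialDeriv_partialDeriv_graphMap h.smooth_fun, hy]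
    simp [lorentz]
  change partialDeriv (partialDeriv v i) i y = lorentz _ (partialDeriv _ i y) +
    lorentz (partialDeriv _ i y) _ at h2
  rw [h2, h3, zero_add]

lemma driftLaplacian_eq [IsManifold (𝓡 n) ∞ M] (h : IsGraphChart x σ f)
    (hx : IsSpacelikeHypersurface x N) {u : M → ℝ} (hv : ContDiff ℝ ∞ v)
    (huv : ∀ y, u (σ y) = v y) (y : EuclideanSpace ℝ (Fin n)) :
    driftLaplacian x u (σ y) = coordLaplacian (gramMatrix (graphMap f)) v y -
      (∑ i, y i ^ 2 - f y ^ 2) *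
        lorentz (graphMap f y) (ambientGradient (graphMap f) v y) := by
  rw [driftLaplacian, h.riemannianLaplacian_eq hx hv huv, h.lorentz_self_eq,
    h.differential_riemannianGradient hx hv huv, h.apply_eq]

lemma driftLaplacian_of_horizontal [IsManifold (𝓡 n) ∞ M] (h : IsGraphChart x σ f)
    (hx : IsSpacelikeHypersurface x N) {u : M → ℝ} (hv : ContDiff ℝ ∞ v)
    (huv : ∀ y, u (σ y) = v y) (hy : ∀ i, partialDeriv f i y = 0) :
    driftLaplacian x u (σ y) = ∑ k, partialDeriv (partialDeriv v k) k y -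
      (∑ i, y i ^ 2 - f y ^ 2) * ∑ k, y k * partialDeriv v k y := by
  rw [h.driftLaplacian_eq hx hv huv, h.coordLaplacian_of_horizontal hx hv hy,
    h.lorentz_ambientGradient_of_horizontal hx hy]

end IsGraphChart

/-! ### The drift Laplacian of `B` at an adapted point. -/

namespace IsAdaptedGraph

variable {n : ℕ} {f ν : EuclideanSpace ℝ (Fin n) → ℝ} {y₀ : EuclideanSpace ℝ (Fin n)}
  {κ : Fin n → ℝ} {lam : ℝ}

/-- The derivatives up to order two of the equation of a `λ`-hypersurface. -/
lemma lambda_equation (h : IsAdaptedGraph f ν y₀ κ)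
    (hlam : ∀ y, graphMeanCurvature f ν y =
      lam + (∑ i, y i ^ 2 - f y ^ 2) * graphSupport f ν y) (k : Fin n) :
    ∑ i, κ i = lam - (∑ i, y₀ i ^ 2 - f y₀ ^ 2) * f y₀ ∧
    ∑ i, thirdDeriv f y₀ i i k = y₀ k * ((∑ i, y₀ i ^ 2 - f y₀ ^ 2) * κ k - 2 * f y₀) ∧
    ∑ i, fourthDeriv f y₀ i k + 2 * κ k ^ 3 + κ k ^ 2 * ∑ i, κ i =
      (2 - 2 * f y₀ * κ k) * -f y₀ + 2 * (2 * y₀ k) * (y₀ k * κ k) +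
        (∑ i, y₀ i ^ 2 - f y₀ ^ 2) *
          (κ k + ∑ i, y₀ i * thirdDeriv f y₀ i k k - f y₀ * κ k ^ 2) := by
  obtain ⟨e1, e2, e3⟩ := (h.jet_meanCurvature k).unique
    (((HasJet.const lam k y₀).add ((h.jet_lorentz_self k).mul (h.jet_support k))).congr_fun
      (funext hlam))
  exact ⟨by rw [e1]; ring, by rw [e2]; ring, by rw [e3]; ring⟩

lemma drift_eq (hn : 2 ≤ n) (h : IsAdaptedGraph f ν y₀ κ)
    (hlam : ∀ y, graphMeanCurvature f ν y =
      lam + (∑ i, y i ^ 2 - f y ^ 2) * graphSupport f ν y) :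
    ∑ k, partialDeriv (partialDeriv (graphTracelessNormSq f ν) k) k y₀ -
      (∑ i, y₀ i ^ 2 - f y₀ ^ 2) * ∑ k, y₀ k * partialDeriv (graphTracelessNormSq f ν) k y₀ =
    2 * ((∑ k, ∑ i, ∑ j, thirdDeriv f y₀ i j k ^ 2 - (∑ k, (∑ i, thirdDeriv f y₀ i i k) ^ 2) / n) +
      (∑ i, κ i ^ 2) * (∑ i, κ i ^ 2 - (∑ i, κ i) ^ 2 / n) -
      lam * (∑ i, κ i ^ 3 - (∑ i, κ i) * (∑ i, κ i ^ 2) / n) +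
      f y₀ ^ 2 * (∑ i, κ i ^ 2 - (∑ i, κ i) ^ 2 / n) +
      ∑ k, (4 * κ k ^ 2 - 4 * (∑ i, κ i) / n * κ k + (∑ i, κ i ^ 2 - (∑ i, κ i) ^ 2 / n)) *
        y₀ k ^ 2) := by
  have hn0 : (n : ℝ) ≠ 0 := by positivity
  simp_rw [fun k => (h.jet_tracelessNormSq k).first, fun k => (h.jet_tracelessNormSq k).second]
  exact simons_identity hn0 (fourthDeriv_swap h.smooth y₀)
    (fun i k => by rw [thirdDeriv_swap_left h.smooth, thirdDeriv_swap_right h.smooth]) rfl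
    (h.lambda_equation hlam ⟨0, by omega⟩).1 fun k => (h.lambda_equation hlam k).2.2

/-- The drift Laplacian of `B` is nonnegative, and it vanishes only if the second fundamental form
is parallel. -/
theorem drift_nonneg (hn : 2 ≤ n) (h : IsAdaptedGraph f ν y₀ κ)
    (hlam : ∀ y, graphMeanCurvature f ν y =
      lam + (∑ i, y i ^ 2 - f y ^ 2) * graphSupport f ν y)
    (hκ : ∀ k, 0 ≤ 4 * κ k ^ 2 - 4 * (∑ i, κ i) / n * κ k +
      (∑ i, κ i ^ 2 - (∑ i, κ i) ^ 2 / n))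
    (hQ : 0 ≤ (Real.sqrt (∑ i, κ i ^ 2 - (∑ i, κ i) ^ 2 / n)
          - |lam| * ((n - 2) / (2 * Real.sqrt (n * (n - 1))))) ^ 2
        + 1 / n * (∑ i, κ i - lam) ^ 2 - n * lam ^ 2 / (4 * (n - 1))) :
    0 ≤ ∑ k, partialDeriv (partialDeriv (graphTracelessNormSq f ν) k) k y₀ -
      (∑ i, y₀ i ^ 2 - f y₀ ^ 2) * ∑ k, y₀ k * partialDeriv (graphTracelessNormSq f ν) k y₀ ∧
    (∑ k, partialDeriv (partialDeriv (graphTracelessNormSq f ν) k) k y₀ -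
      (∑ i, y₀ i ^ 2 - f y₀ ^ 2) * ∑ k, y₀ k * partialDeriv (graphTracelessNormSq f ν) k y₀ = 0 →
      (∀ i j k, thirdDeriv f y₀ i j k = 0) ∧
      f y₀ ^ 2 * (∑ i, κ i ^ 2 - (∑ i, κ i) ^ 2 / n) = 0) := by
  rw [h.drift_eq hn hlam]
  have h1 := cubic_term_le hn κ lam
  have hB : 0 ≤ ∑ i, κ i ^ 2 - (∑ i, κ i) ^ 2 / n := by
    have := sq_sum_le_card_mul_sum_sq (s := Finset.univ) (f := κ)
    rw [Finset.card_univ, Fintype.card_fin] at this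
    have hn0 : (0 : ℝ) < n := by positivity
    rw [sub_nonneg, div_le_iff₀ hn0]
    linarith
  have h2 := mul_nonneg hB hQ
  have h3 := mul_nonneg (sq_nonneg (f y₀)) hB
  have h4 : 0 ≤ ∑ k, (4 * κ k ^ 2 - 4 * (∑ i, κ i) / n * κ k +
      (∑ i, κ i ^ 2 - (∑ i, κ i) ^ 2 / n)) * y₀ k ^ 2 :=
    Finset.sum_nonneg fun k _ => mul_nonneg (hκ k) (sq_nonneg _)
  obtain ⟨h5, h6⟩ := sum_sq_trace_le (T := thirdDeriv f y₀)
  refine ⟨by linarith, fun h0 => ?_⟩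
  have h7 := eq_zero_of_sum_sq_le hn (thirdDeriv_swap_right h.smooth y₀) (by linarith)
  exact ⟨h7, by linarith⟩

end IsAdaptedGraph

/-! ### Lorentzian frames and isometries. -/

section Isometry

variable {n : ℕ}

lemma eq_zero_of_lorentz_eq_zero {X : LorentzSpace n} (h : ∀ Y, lorentz X Y = 0) : X = 0 := by
  ext i
  refine Fin.lastCases ?_ (fun i => ?_) i
  · simpa [lorentz, Pi.single_apply, Fin.castSucc_ne_last] using
      h (EuclideanSpace.single (Fin.last n) 1)
  · simpa [lorentz, Pi.single_apply, (Fin.castSucc_ne_last _).symm] using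
      h (EuclideanSpace.single i.castSucc 1)

/-- Lorentzian frames are congruent. -/
lemma exists_lorentz_isometry {e : Fin n → LorentzSpace n} {ξ : LorentzSpace n}
    (he : ∀ i j, lorentz (e i) (e j) = if i = j then 1 else 0) (hξ : ∀ i, lorentz ξ (e i) = 0)
    (hξ1 : lorentz ξ ξ = -1) :
    ∃ T : LorentzSpace n ≃L[ℝ] LorentzSpace n, (∀ u v, lorentz (T u) (T v) = lorentz u v) ∧
      (∀ i, T (e i) = EuclideanSpace.single i.castSucc 1) ∧
      T ξ = EuclideanSpace.single (Fin.last n) 1 := by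
  let L : LorentzSpace n →ₗ[ℝ] LorentzSpace n :=
    { toFun := fun Y => ∑ i : Fin n, Y i.castSucc • e i + Y (Fin.last n) • ξ
      map_add' := fun Y Z => by
        simp only [PiLp.add_apply, add_smul, Finset.sum_add_distrib]; abel
      map_smul' := fun r Y => by
        simp only [PiLp.smul_apply, smul_eq_mul, mul_smul, Finset.smul_sum, smul_add,
          RingHom.id_apply] }
  have hLdef : ∀ Y, L Y = ∑ i : Fin n, Y i.castSucc • e i + Y (Fin.last n) • ξ := fun _ => rfl
  have hL : ∀ Y Z, lorentz (L Y) (L Z) = lorentz Y Z := by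
    intro Y Z
    simp only [hLdef, lorentz_add_left, lorentz_add_right, lorentz_sum_left, lorentz_sum_right,
      lorentz_smul_left, lorentz_smul_right, he, hξ, hξ1, lorentz_comm (e _) ξ]
    simp only [mul_ite, mul_one, mul_zero, Finset.sum_ite_eq', Finset.mem_univ, if_true,
      Finset.sum_const_zero, add_zero, zero_add, lorentz, mul_comm (Z _)]
    ring
  have hinj : Function.Injective L := by
    refine (injective_iff_map_eq_zero L).2 fun Y hY => eq_zero_of_lorentz_eq_zero fun Z => ?_
    rw [← hL, hY]
    simp [lorentz]
  -- `L` carries the standard frame to the given one, so the isometry wanted is its inverse.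
  let T := (LinearEquiv.ofInjectiveEndo L hinj).symm.toContinuousLinearEquiv
  have hT : ∀ Y, L (T Y) = Y := fun Y => (LinearEquiv.ofInjectiveEndo L hinj).apply_symm_apply Y
  refine ⟨T, fun u v => by rw [← hL, hT, hT], fun i => hinj ?_, hinj ?_⟩
  · rw [hT, hLdef]
    simp [(Fin.castSucc_ne_last _).symm]
  · rw [hT, hLdef]
    simp [Fin.castSucc_ne_last]

end Isometry

/-! ### Invariance under Lorentz isometries, and principal directions. -/

section Transport

variable {n : ℕ} {M : Type*} [TopologicalSpace M] [ChartedSpace (EuclideanSpace ℝ (Fin n)) M]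
    [RiemannianBundle (fun p : M => TangentSpace (𝓡 n) p)]
    {x N : M → LorentzSpace n} {T : LorentzSpace n ≃L[ℝ] LorentzSpace n}

namespace IsSpacelikeHypersurface

lemma differential_isometry (hx : IsSpacelikeHypersurface x N) (p : M)
    (v : TangentSpace (𝓡 n) p) :
    differential (fun p => T (x p)) p v = T (differential x p v) :=
  differential_clm_comp ((hx.smooth p).mdifferentiableAt (by simp))
    (T : LorentzSpace n →L[ℝ] LorentzSpace n) v

lemma differential_normal_isometry (hx : IsSpacelikeHypersurface x N) (p : M)
    (v : TangentSpace (𝓡 n) p) :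
    differential (fun p => T (N p)) p v = T (differential N p v) :=
  differential_clm_comp ((hx.smooth_normal p).mdifferentiableAt (by simp))
    (T : LorentzSpace n →L[ℝ] LorentzSpace n) v

lemma isometry (hx : IsSpacelikeHypersurface x N)
    (hT : ∀ u v, lorentz (T u) (T v) = lorentz u v) :
    IsSpacelikeHypersurface (fun p => T (x p)) (fun p => T (N p)) where
  smooth := (T : LorentzSpace n →L[ℝ] LorentzSpace n).contDiff.contMDiff.comp hx.smooth
  smooth_normal := (T : LorentzSpace n →L[ℝ] LorentzSpace n).contDiff.contMDiff.comp hx.smooth_normal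
  isometric p v w := by
    rw [hx.differential_isometry, hx.differential_isometry, hT, hx.isometric]
  normal p v := by rw [hx.differential_isometry, hT, hx.normal]
  unit p := by rw [hT, hx.unit]

lemma secondForm_isometry (hx : IsSpacelikeHypersurface x N)
    (hT : ∀ u v, lorentz (T u) (T v) = lorentz u v) :
    secondForm (fun p => T (x p)) (fun p => T (N p)) = secondForm x N := by
  funext p v w
  rw [secondForm, hx.differential_isometry, hx.differential_normal_isometry, hT, secondForm]

lemma driftLaplacian_isometry (hx : IsSpacelikeHypersurface x N)
    (hT : ∀ u v, lorentz (T u) (T v) = lorentz u v) (u : M → ℝ) (p : M) :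
    driftLaplacian (fun p => T (x p)) u p = driftLaplacian x u p := by
  rw [driftLaplacian, hx.differential_isometry, hT, hT, driftLaplacian]

lemma meanCurvature_isometry (hx : IsSpacelikeHypersurface x N)
    (hT : ∀ u v, lorentz (T u) (T v) = lorentz u v) :
    meanCurvature (fun p => T (x p)) (fun p => T (N p)) = meanCurvature x N := by
  funext p
  rw [meanCurvature, hx.secondForm_isometry hT, meanCurvature]

lemma normSqSecondForm_isometry (hx : IsSpacelikeHypersurface x N)
    (hT : ∀ u v, lorentz (T u) (T v) = lorentz u v) :
    normSqSecondForm (fun p => T (x p)) (fun p => T (N p)) = normSqSecondForm x N := by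
  funext p
  rw [normSqSecondForm, hx.secondForm_isometry hT, normSqSecondForm]

lemma tracelessNormSq_isometry (hx : IsSpacelikeHypersurface x N)
    (hT : ∀ u v, lorentz (T u) (T v) = lorentz u v) :
    tracelessNormSq (fun p => T (x p)) (fun p => T (N p)) = tracelessNormSq x N := by
  funext p
  rw [tracelessNormSq, hx.meanCurvature_isometry hT, hx.normSqSecondForm_isometry hT,
    tracelessNormSq]

end IsSpacelikeHypersurface

/-- In a graph chart the second fundamental form is a multiple of the Hessian of `f`, which is
symmetric. -/
lemma IsGraphChart.secondForm_symm {σ : EuclideanSpace ℝ (Fin n) → M}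
    {f : EuclideanSpace ℝ (Fin n) → ℝ} (h : IsGraphChart x σ f)
    (hx : IsSpacelikeHypersurface x N) (p : M) (v w : TangentSpace (𝓡 n) p) :
    secondForm x N p v w = secondForm x N p w v := by
  obtain ⟨y, rfl⟩ := h.surjective p
  have key : ∀ a b, secondForm x N (σ y) (h.tangentMap y a) (h.tangentMap y b) =
      ∑ i, ∑ j, a i * b j * (h.normalFactor N y * partialDeriv (partialDeriv f j) i y) := by
    intro a b
    have h1 := h.secondForm_tangentMap hx y
    simp only [secondForm, h.differential_tangentMap ((hx.smooth _).mdifferentiableAt (by simp)),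
      h.differential_tangentMap ((hx.smooth_normal _).mdifferentiableAt (by simp))] at h1 ⊢
    rw [fderiv_apply_eq_sum, fderiv_apply_eq_sum, lorentz_sum_left]
    refine Finset.sum_congr rfl fun i _ => ?_
    rw [lorentz_sum_right]
    refine Finset.sum_congr rfl fun j _ => ?_
    rw [lorentz_smul_left, lorentz_smul_right, ← h1, partialDeriv, partialDeriv]
    ring
  rw [← h.tangentMap_spatial_differential hx y v, ← h.tangentMap_spatial_differential hx y w,
    key, key, Finset.sum_comm]
  refine Finset.sum_congr rfl fun i _ => Finset.sum_congr rfl fun j _ => ?_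
  rw [partialDeriv_comm h.smooth_fun.contDiffAt]
  ring

lemma inner_shapeOperator (p : M) (v w : TangentSpace (𝓡 n) p) :
    ⟪shapeOperator x N p v, w⟫_ℝ = secondForm x N p v w := by
  rw [shapeOperator, sum_inner]
  conv_rhs => rw [← (orthoFrame (n := n) p).sum_repr' w]
  rw [secondForm, map_sum, lorentz_sum_right]
  refine Finset.sum_congr rfl fun i _ => ?_
  rw [inner_smul_left, map_smul, lorentz_smul_right, mul_comm]
  rfl

/-- The shape operator is diagonalizable. -/
lemma exists_principal_frame (hsymm : ∀ (p : M) (v w : TangentSpace (𝓡 n) p),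
      secondForm x N p v w = secondForm x N p w v) (p : M) :
    ∃ (κ : Fin n → ℝ) (e : Fin n → TangentSpace (𝓡 n) p),
      (∀ i j, ⟪e i, e j⟫_ℝ = if i = j then 1 else 0) ∧
      ∀ i, shapeOperator x N p (e i) = κ i • e i := by
  have : FiniteDimensional ℝ (TangentSpace (𝓡 n) p) :=
    inferInstanceAs (FiniteDimensional ℝ (EuclideanSpace ℝ (Fin n)))
  have hfin : Module.finrank ℝ (TangentSpace (𝓡 n) p) = n :=
    (finrank_euclideanSpace_fin (𝕜 := ℝ) (n := n))
  let A : TangentSpace (𝓡 n) p →ₗ[ℝ] TangentSpace (𝓡 n) p :=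
    { toFun := shapeOperator x N p
      map_add' := fun v w => by
        simp [shapeOperator, secondForm, lorentz_add_left, add_smul, Finset.sum_add_distrib]
      map_smul' := fun r v => by
        simp [shapeOperator, secondForm, lorentz_smul_left, mul_smul, Finset.smul_sum] }
  have hA : A.IsSymmetric := fun v w => by
    change ⟪shapeOperator x N p v, w⟫_ℝ = ⟪v, shapeOperator x N p w⟫_ℝ
    rw [inner_shapeOperator, real_inner_comm, inner_shapeOperator, hsymm]
  refine ⟨hA.eigenvalues hfin, hA.eigenvectorBasis hfin, fun i j => ?_, fun i => ?_⟩
  · exact orthonormal_iff_ite.1 (hA.eigenvectorBasis hfin).orthonormal i j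
  · exact hA.apply_eigenvectorBasis hfin i

end Transport

/-! ### Adapted graph charts. -/

section Adapted

variable {n : ℕ} {M : Type*} [MetricSpace M] [CompleteSpace M] [ConnectedSpace M]
    [ChartedSpace (EuclideanSpace ℝ (Fin n)) M] [IsManifold (𝓡 n) ∞ M]
    [RiemannianBundle (fun p : M => TangentSpace (𝓡 n) p)] [IsRiemannianManifold (𝓡 n) M]
    {x N : M → LorentzSpace n}

/-- After a Lorentzian isometry, a complete space-like hypersurface is an entire graph that is
adapted to a given point. -/
theorem IsSpacelikeHypersurface.exists_isAdaptedGraph (hx : IsSpacelikeHypersurface x N) (p : M) :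
    ∃ (T : LorentzSpace n ≃L[ℝ] LorentzSpace n) (σ : EuclideanSpace ℝ (Fin n) → M)
      (f : EuclideanSpace ℝ (Fin n) → ℝ) (y₀ : EuclideanSpace ℝ (Fin n)) (κ : Fin n → ℝ)
      (e : Fin n → TangentSpace (𝓡 n) p) (h : IsGraphChart (fun p => T (x p)) σ f),
      (∀ u v, lorentz (T u) (T v) = lorentz u v) ∧ σ y₀ = p ∧
      IsAdaptedGraph f (h.normalFactor fun p => T (N p)) y₀ κ ∧
      ∀ i, ‖e i‖ = 1 ∧ shapeOperator x N p (e i) = κ i • e i := by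
  obtain ⟨σ₀, f₀, h₀⟩ := hx.exists_isGraphChart
  obtain ⟨κ, e, he, hκ⟩ := exists_principal_frame (h₀.secondForm_symm hx) p
  obtain ⟨T, hT, hTe, hTN⟩ := exists_lorentz_isometry
    (e := fun i => differential x p (e i)) (ξ := N p) (fun i j => by rw [hx.isometric, he])
    (fun i => hx.normal p _) (hx.unit p)
  have hx' := hx.isometry hT
  -- The first chart served only for the symmetry of the second fundamental form. The moved
  -- hypersurface is a graph again, now horizontal over the point, with the principal directions
  -- along the axes.
  obtain ⟨σ, f, h⟩ := hx'.exists_isGraphChart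
  obtain ⟨y₀, hy₀⟩ := h.surjective p
  refine ⟨T, σ, f, y₀, κ, e, h, hT, hy₀, ?_, fun i => ⟨?_, hκ i⟩⟩
  · subst hy₀
    have hν : h.normalFactor (fun p => T (N p)) y₀ = 1 := by
      rw [IsGraphChart.normalFactor, hTN]; simp
    have hte : ∀ i, h.tangentMap y₀ (EuclideanSpace.single i 1) = e i := by
      intro i
      rw [← h.tangentMap_spatial_differential hx' y₀ (e i), hx.differential_isometry, hTe]
      congr 1
      ext j
      simp
    refine ⟨h.smooth_fun, h.contDiff_normalFactor hx', h.normalFactor_sq hx', fun i => ?_, hν,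
      fun i j => ?_⟩
    · have h1 := h.spatial_normal hx' y₀ i
      rw [hν, one_mul] at h1
      rw [← h1, hTN]
      simp [Fin.castSucc_ne_last]
    · have h1 := h.secondForm_tangentMap hx' y₀ i j
      rw [hν, one_mul, hx.secondForm_isometry hT, hte, hte, ← inner_shapeOperator, hκ,
        inner_smul_left, he] at h1
      rw [← h1]
      simp
  · have h1 := he i i
    rw [if_pos rfl, real_inner_self_eq_norm_sq] at h1
    nlinarith [norm_nonneg (e i)]

end Adapted

/-! ### Vanishing of `B` and of differentials. -/

section Umbilical

variable {n : ℕ} {M : Type*} [TopologicalSpace M] [ChartedSpace (EuclideanSpace ℝ (Fin n)) M]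
    [RiemannianBundle (fun p : M => TangentSpace (𝓡 n) p)]
    {x N : M → LorentzSpace n}

/-- `B` is the squared norm of `A - (H/n)I`. -/
lemma shapeOperator_eq_of_tracelessNormSq_eq_zero (hn : n ≠ 0) {p : M}
    (hB : tracelessNormSq x N p = 0) (v : TangentSpace (𝓡 n) p) :
    shapeOperator x N p v = (meanCurvature x N p / n) • v := by
  have hn0 : (n : ℝ) ≠ 0 := by exact_mod_cast hn
  have hfin : (Module.finrank ℝ (TangentSpace (𝓡 n) p) : ℝ) = n := by
    exact_mod_cast (finrank_euclideanSpace_fin (𝕜 := ℝ) (n := n))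
  set e := orthoFrame (n := n) p
  set H := meanCurvature x N p with hH
  have h1 : ∑ i, ∑ j, (secondForm x N p (e i) (e j) - if i = j then H / n else 0) ^ 2 = 0 := by
    have h2 : ∀ i j, (secondForm x N p (e i) (e j) - if i = j then H / n else 0) ^ 2 =
        secondForm x N p (e i) (e j) ^ 2 +
          if i = j then -2 * (H / n) * secondForm x N p (e i) (e j) + (H / n) ^ 2 else 0 := by
      intro i j; split_ifs <;> ring
    simp only [h2, Finset.sum_add_distrib, Finset.sum_ite_eq, Finset.mem_univ, if_true,
      ← Finset.mul_sum, Finset.sum_const, Finset.card_univ, Fintype.card_fin, nsmul_eq_mul, hfin]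
    have h3 : ∑ i, secondForm x N p (e i) (e i) = H := rfl
    have h4 : ∑ i, ∑ j, secondForm x N p (e i) (e j) ^ 2 = normSqSecondForm x N p := rfl
    rw [tracelessNormSq, sub_eq_zero, ← hH] at hB
    rw [h3, h4, hB]
    field_simp
    ring
  have h5 : ∀ i j, secondForm x N p (e i) (e j) = if i = j then H / n else 0 := by
    intro i j
    have h6 := (Finset.sum_eq_zero_iff_of_nonneg fun i _ =>
      Finset.sum_nonneg fun j _ => sq_nonneg _).1 h1 i (Finset.mem_univ i)
    have h7 := (Finset.sum_eq_zero_iff_of_nonneg fun j _ => sq_nonneg _).1 h6 j (Finset.mem_univ j)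
    exact sub_eq_zero.1 (pow_eq_zero_iff two_ne_zero |>.1 h7)
  have h8 : ∀ j, secondForm x N p v (e j) = H / n * ⟪e j, v⟫_ℝ := by
    intro j
    conv_lhs => rw [← e.sum_repr' v, secondForm, map_sum, lorentz_sum_left]
    simp_rw [map_smul, lorentz_smul_left]
    rw [Finset.sum_eq_single j]
    · have := h5 j j
      rw [if_pos rfl, secondForm] at this
      rw [this, mul_comm]
    · intro i _ hij
      have := h5 i j
      rw [if_neg hij, secondForm] at this
      rw [this, mul_zero]
    · simp
  rw [shapeOperator]
  simp_rw [show orthoFrame (n := n) p = e from rfl, h8, mul_smul]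
  rw [← Finset.smul_sum, e.sum_repr']

lemma IsGraphChart.differential_eq_zero {σ : EuclideanSpace ℝ (Fin n) → M}
    {f v : EuclideanSpace ℝ (Fin n) → ℝ} (h : IsGraphChart x σ f)
    (hx : IsSpacelikeHypersurface x N) {u : M → ℝ} (hv : ContDiff ℝ ∞ v)
    (huv : ∀ y, u (σ y) = v y) {y : EuclideanSpace ℝ (Fin n)} (hy : ∀ k, partialDeriv v k y = 0) :
    differential (n := n) u (σ y) = 0 := by
  ext w
  rw [← h.tangentMap_spatial_differential hx y w, h.differential_tangentMap
    (((h.contMDiff_of_comp hx hv huv) _).mdifferentiableAt (by simp)),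
    show u ∘ σ = v from funext huv, fderiv_apply_eq_sum]
  simp [hy]

end Umbilical

/-! ### Consequences of Simons' identity at each point. -/

section Pointwise

variable {n : ℕ} {M : Type*} [MetricSpace M] [CompleteSpace M] [ConnectedSpace M]
    [ChartedSpace (EuclideanSpace ℝ (Fin n)) M] [IsManifold (𝓡 n) ∞ M]
    [RiemannianBundle (fun p : M => TangentSpace (𝓡 n) p)] [IsRiemannianManifold (𝓡 n) M]
    {x N : M → LorentzSpace n} {lam : ℝ}

namespace IsSpacelikeHypersurface

/-- The quantities of a `λ`-hypersurface in an adapted graph chart. -/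
theorem exists_adapted_chart (hn : 2 ≤ n) (hx : IsSpacelikeHypersurface x N)
    (hlam : IsLambdaHypersurface x N (fun p => lorentz (x p) (x p)) lam) (p : M) :
    ∃ (x' N' : M → LorentzSpace n) (σ : EuclideanSpace ℝ (Fin n) → M)
      (f ν : EuclideanSpace ℝ (Fin n) → ℝ) (y₀ : EuclideanSpace ℝ (Fin n)) (κ : Fin n → ℝ)
      (e : Fin n → TangentSpace (𝓡 n) p), IsSpacelikeHypersurface x' N' ∧ IsGraphChart x' σ f ∧
      σ y₀ = p ∧ IsAdaptedGraph f ν y₀ κ ∧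
      (∀ i, ‖e i‖ = 1 ∧ shapeOperator x N p (e i) = κ i • e i) ∧
      (∀ y, graphMeanCurvature f ν y = lam + (∑ i, y i ^ 2 - f y ^ 2) * graphSupport f ν y) ∧
      (∀ y, meanCurvature x N (σ y) = graphMeanCurvature f ν y) ∧
      (∀ y, normSqSecondForm x N (σ y) = graphNormSq f ν y) ∧
      (∀ y, lorentz (x (σ y)) (N (σ y)) = graphSupport f ν y) ∧
      meanCurvature x N p = ∑ i, κ i ∧ normSqSecondForm x N p = ∑ i, κ i ^ 2 ∧
      lorentz (x p) (N p) = -f y₀ ∧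
      driftLaplacian x (tracelessNormSq x N) p =
        ∑ k, partialDeriv (partialDeriv (graphTracelessNormSq f ν) k) k y₀ -
        (∑ i, y₀ i ^ 2 - f y₀ ^ 2) * ∑ k, y₀ k * partialDeriv (graphTracelessNormSq f ν) k y₀ ∧
      ((∀ k, y₀ k = 0) → ∀ v : TangentSpace (𝓡 n) p, lorentz (x p) (differential x p v) = 0) := by
  obtain ⟨T, σ, f, y₀, κ, e, h, hT, hy₀, had, he⟩ := hx.exists_isAdaptedGraph p
  have hx' := hx.isometry hT
  set ν := h.normalFactor fun p => T (N p)
  have c1 : ∀ y, meanCurvature x N (σ y) = graphMeanCurvature f ν y := fun y => by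
    rw [← (h.curvature_eq hx' y).1, hx.meanCurvature_isometry hT]
  have c2 : ∀ y, normSqSecondForm x N (σ y) = graphNormSq f ν y := fun y => by
    rw [← (h.curvature_eq hx' y).2, hx.normSqSecondForm_isometry hT]
  have c3 : ∀ y, lorentz (x (σ y)) (N (σ y)) = graphSupport f ν y := fun y => by
    rw [← h.lorentz_normal_eq hx' y, hT]
  -- Any direction will do: only the value entry of the jets is read.
  have k : Fin n := ⟨0, by omega⟩
  refine ⟨_, _, σ, f, ν, y₀, κ, e, hx', h, hy₀, had, he, fun y => ?_, c1, c2, c3, ?_, ?_, ?_, ?_, ?_⟩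
  · have := hlam (σ y)
    have hs : lorentz (x (σ y)) (x (σ y)) = ∑ i, y i ^ 2 - f y ^ 2 := by
      rw [← hT, ← h.lorentz_self_eq]
    simp only [c1, c3, hs] at this
    linarith
  · rw [← hy₀, c1, (had.jet_meanCurvature k).value]
  · rw [← hy₀, c2, (had.jet_normSq k).value]
  · rw [← hy₀, c3, (had.jet_support k).value]
  · rw [← h.driftLaplacian_of_horizontal hx' (u := tracelessNormSq x N)
      (contDiff_graphTracelessNormSq had.smooth had.smooth_normal)
      (fun y => by rw [← hx.tracelessNormSq_isometry hT, h.tracelessNormSq_eq hx']) had.slope,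
      hx.driftLaplacian_isometry hT, hy₀]
  · intro hy v
    subst hy₀
    rw [← hT, ← hx.differential_isometry, ← h.tangentMap_spatial_differential hx' y₀ v,
      h.differential_tangentMap ((hx'.smooth _).mdifferentiableAt (by simp)), h.comp_eq, h.apply_eq,
      fderiv_apply_eq_sum, lorentz_sum_right]
    refine Finset.sum_eq_zero fun i _ => ?_
    rw [lorentz_smul_right, IsGraphChart.partialDeriv_graphMap had.smooth, had.slope]
    simp [lorentz, graphMap, hy]

/-- Pointwise consequences of Simons' identity: the drift Laplacian of `B` is nonnegative, and where
it vanishes the second fundamental form is parallel. -/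
lemma drift_tracelessNormSq (hn : 2 ≤ n) (hx : IsSpacelikeHypersurface x N)
    (hlam : IsLambdaHypersurface x N (fun p => lorentz (x p) (x p)) lam)
    (hA : ∀ (p : M) (v : TangentSpace (𝓡 n) p),
      0 ≤ ⟪(4 : ℝ) • shapeOperator x N p (shapeOperator x N p v)
        - (4 * meanCurvature x N p / n) • shapeOperator x N p v
        + tracelessNormSq x N p • v, v⟫_ℝ)
    (hQ : ∀ p : M, 0 ≤
      (Real.sqrt (normSqSecondForm x N p - meanCurvature x N p ^ 2 / n)
          - |lam| * ((n - 2) / (2 * Real.sqrt (n * (n - 1))))) ^ 2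
        + 1 / n * (meanCurvature x N p - lam) ^ 2
        - n * lam ^ 2 / (4 * (n - 1))) (p : M) :
    0 ≤ driftLaplacian x (tracelessNormSq x N) p ∧
    (driftLaplacian x (tracelessNormSq x N) p = 0 →
      differential (n := n) (meanCurvature x N) p = 0 ∧
      differential (n := n) (normSqSecondForm x N) p = 0 ∧
      lorentz (x p) (N p) ^ 2 * tracelessNormSq x N p = 0 ∧
      ((∀ q, lorentz (x q) (N q) = 0) → tracelessNormSq x N p = 0) ∧
      (tracelessNormSq x N p = 0 → (∀ q, meanCurvature x N q = meanCurvature x N p) →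
        (meanCurvature x N p = 0 → lorentz (x p) (N p) = 0) ∧
        (meanCurvature x N p ≠ 0 →
          ∀ v : TangentSpace (𝓡 n) p, lorentz (x p) (differential x p v) = 0))) := by
  have hn0 : (n : ℝ) ≠ 0 := by positivity
  obtain ⟨x', N', σ, f, ν, y₀, κ, e, hx', h, hy₀, had, he, hl, c1, c2, c3, d1, d2, d3, d4, d5⟩ :=
    hx.exists_adapted_chart hn hlam p
  have hB : tracelessNormSq x N p = ∑ i, κ i ^ 2 - (∑ i, κ i) ^ 2 / n := by
    rw [tracelessNormSq, d1, d2]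
  have hshape : ∀ (r : ℝ) (v : TangentSpace (𝓡 n) p),
      shapeOperator x N p (r • v) = r • shapeOperator x N p v := fun r v => by
    simp [shapeOperator, secondForm, lorentz_smul_left, mul_smul, Finset.smul_sum]
  have hκ : ∀ k, 0 ≤ 4 * κ k ^ 2 - 4 * (∑ i, κ i) / n * κ k +
      (∑ i, κ i ^ 2 - (∑ i, κ i) ^ 2 / n) := by
    -- The hypothesis is tested on the `k`-th unit principal vector.
    intro k
    have h1 := hA p (e k)
    rw [(he k).2, hshape, (he k).2, inner_add_left, inner_sub_left, inner_smul_left,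
      inner_smul_left, inner_smul_left, inner_smul_left, inner_smul_left, inner_smul_left,
      real_inner_self_eq_norm_sq, (he k).1, hB, d1] at h1
    simp only [conj_trivial] at h1
    linarith
  have hQp := hQ p
  rw [d1, d2] at hQp
  obtain ⟨h1, h2⟩ := had.drift_nonneg hn hl hκ hQp
  rw [d4]
  refine ⟨h1, fun h0 => ?_⟩
  obtain ⟨hT, h3⟩ := h2 h0
  refine ⟨?_, ?_, by rw [d3, hB, neg_sq, h3], fun hu => ?_, fun hB0 hconst => ?_⟩
  · rw [← hy₀]
    refine h.differential_eq_zero hx' (contDiff_graphMeanCurvature had.smooth had.smooth_normal)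
      c1 fun k => ?_
    rw [(had.jet_meanCurvature k).first]
    simp [hT]
  · rw [← hy₀]
    refine h.differential_eq_zero hx' (contDiff_graphNormSq had.smooth had.smooth_normal)
      c2 fun k => ?_
    rw [(had.jet_normSq k).first]
    simp [hT]
  · have h4 : ∀ k, κ k = 0 := by
      intro k
      obtain ⟨e1, -, e3⟩ := (had.jet_support k).unique ((HasJet.const 0 k y₀).congr_fun
        (funext fun y => by rw [← c3, hu]))
      simp only [hT, mul_zero, Finset.sum_const_zero, add_zero] at e3
      have : f y₀ = 0 := by linarith
      rw [this] at e3
      linarith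
    simp [hB, h4]
  · have h4 : ∀ k, κ k = meanCurvature x N p / n := by
      intro k
      have h5 := (he k).2
      rw [shapeOperator_eq_of_tracelessNormSq_eq_zero (by omega) hB0] at h5
      have h6 := congrArg (fun w => ⟪w, e k⟫_ℝ) h5
      simp only [inner_smul_left, real_inner_self_eq_norm_sq, (he k).1] at h6
      simpa using h6.symm
    set H := meanCurvature x N p
    -- First and, in `h6`, second derivative of the `λ`-equation, with `∇h = 0`, all `κₖ` equal and
    -- `H` constant. For `H = 0` the second gives `f = 0`. For `H ≠ 0`, if the bracket common to
    -- both vanishes, the second leaves `yₖ = 0`; otherwise the first does.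
    have h5 : ∀ k, y₀ k * ((∑ i, y₀ i ^ 2 - f y₀ ^ 2) * (H / n) - 2 * f y₀) = 0 := by
      intro k
      rw [← h4 k, ← (had.lambda_equation hl k).2.1]
      simp [hT]
    have h6 : ∀ k, (1 - f y₀ * (H / n)) * ((∑ i, y₀ i ^ 2 - f y₀ ^ 2) * (H / n) - 2 * f y₀) +
        4 * y₀ k ^ 2 * (H / n) = 0 := by
      intro k
      obtain ⟨-, -, e3⟩ := (had.jet_meanCurvature k).unique ((HasJet.const H k y₀).congr_fun
        (funext fun y => by rw [← c1, hconst]))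
      have := (had.lambda_equation hl k).2.2
      rw [e3] at this
      simp only [hT, h4, mul_zero, Finset.sum_const_zero, add_zero] at this
      linarith
    refine ⟨fun hH => ?_, fun hH => d5 fun k => ?_⟩
    · have := h6 ⟨0, by omega⟩
      rw [hH, zero_div] at this
      rw [d3]
      linarith
    · have hκ0 : H / n ≠ 0 := div_ne_zero hH hn0
      have h7 := h5 k
      rcases mul_eq_zero.1 h7 with h8 | h8
      · exact h8
      · have h9 := h6 k
        rw [h8, mul_zero, zero_add] at h9
        have : y₀ k ^ 2 = 0 := by
          rcases mul_eq_zero.1 h9 with h10 | h10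
          · linarith
          · exact absurd h10 hκ0
        exact pow_eq_zero_iff two_ne_zero |>.1 this

end IsSpacelikeHypersurface

end Pointwise

/-! ### The Riemannian volume in a graph chart. -/

section Volume

open Matrix

variable {n : ℕ}

lemma det_gramMatrix_comp {F : EuclideanSpace ℝ (Fin n) → LorentzSpace n}
    {θ : EuclideanSpace ℝ (Fin n) → EuclideanSpace ℝ (Fin n)} {z : EuclideanSpace ℝ (Fin n)}
    (hF : DifferentiableAt ℝ F (θ z)) (hθ : DifferentiableAt ℝ θ z) :
    (gramMatrix (F ∘ θ) z).det = (fderiv ℝ θ z).det ^ 2 * (gramMatrix F (θ z)).det := by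
  let J : Matrix (Fin n) (Fin n) ℝ := of fun k i => partialDeriv θ i z k
  have hJ : J.det = (fderiv ℝ θ z).det := by
    rw [ContinuousLinearMap.det, ← LinearMap.det_toMatrix (EuclideanSpace.basisFun (Fin n) ℝ).toBasis]
    congr 1
  have h1 : ∀ i, partialDeriv (F ∘ θ) i z = ∑ k, J k i • partialDeriv F k (θ z) := by
    intro i
    rw [partialDeriv, fderiv_comp z hF hθ, ContinuousLinearMap.comp_apply, fderiv_apply_eq_sum]
    rfl
  have h2 : gramMatrix (F ∘ θ) z = Jᵀ * gramMatrix F (θ z) * J := by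
    ext i j
    simp only [gramMatrix, of_apply, h1, lorentz_sum_left, lorentz_sum_right,
      lorentz_smul_left, lorentz_smul_right, mul_apply, transpose_apply, Finset.sum_mul,
      Finset.mul_sum]
    exact Finset.sum_congr rfl fun _ _ => Finset.sum_congr rfl fun _ _ => by ring
  rw [h2, det_mul, det_mul, det_transpose, hJ]
  ring

variable {M : Type*} [TopologicalSpace M] [ChartedSpace (EuclideanSpace ℝ (Fin n)) M]
    [RiemannianBundle (fun p : M => TangentSpace (𝓡 n) p)]
    {x N : M → LorentzSpace n} {σ : EuclideanSpace ℝ (Fin n) → M}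
    {f : EuclideanSpace ℝ (Fin n) → ℝ}

namespace IsGraphChart

lemma measurableEmbedding [MeasurableSpace M] [BorelSpace M] (h : IsGraphChart x σ f)
    (hx : IsSpacelikeHypersurface x N) : MeasurableEmbedding σ := by
  let e : EuclideanSpace ℝ (Fin n) ≃ₜ M :=
    { toFun := σ
      invFun := fun p => spatial n (x p)
      left_inv := h.right_inv
      right_inv := h.left_inv
      continuous_toFun := h.smooth_map.continuous
      continuous_invFun := (spatial n).continuous.comp hx.smooth.continuous }
  exact e.measurableEmbedding

lemma contDiff_sqrt_det (h : IsGraphChart x σ f) (hx : IsSpacelikeHypersurface x N) :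
    ContDiff ℝ ∞ fun y => Real.sqrt (gramMatrix (graphMap f) y).det :=
  contDiff_iff_contDiffAt.2 fun y =>
    contDiffAt_sqrt_det (contDiff_graphMap h.smooth_fun).contDiffAt (h.det_gramMatrix_pos hx y)

/-- Change of variables along the transition `θ`: its Jacobian `|det dθ|` is exactly the factor
between the two square roots of Gram determinants. -/
lemma setLIntegral_le_chartVolume [IsManifold (𝓡 n) ∞ M] [MeasurableSpace M] [BorelSpace M]
    (h : IsGraphChart x σ f)
    (hx : IsSpacelikeHypersurface x N) (q : M) {s : Set M} (hs : MeasurableSet s)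
    (hsq : s ⊆ (chartAt (EuclideanSpace ℝ (Fin n)) q).source) :
    ∫⁻ y in σ ⁻¹' s, ENNReal.ofReal (Real.sqrt (gramMatrix (graphMap f) y).det) ≤
      chartVolume (n := n) q s := by
  classical
  set φ := chartAt (EuclideanSpace ℝ (Fin n)) q with hφdef
  let θ := spatial n ∘ x ∘ φ.symm
  set t := φ.symm ⁻¹' s ∩ φ.target with ht
  have hF := contDiff_graphMap h.smooth_fun
  have hφ : ∀ z ∈ φ.target, ContMDiffAt (𝓡 n) (𝓡 n) ∞ φ.symm z := fun z hz =>
    (contMDiffOn_chart_symm (I := 𝓡 n) (x := q)).contMDiffAt (φ.open_target.mem_nhds hz)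
  have hθ : ∀ z ∈ φ.target, ContDiffAt ℝ ∞ θ z := fun z hz =>
    (spatial n).contDiff.contDiffAt.comp z
      (ContMDiffAt.comp z (hx.smooth _) (hφ z hz)).contDiffAt
  have hσθ : ∀ z, σ (θ z) = φ.symm z := fun z => h.left_inv _
  -- The inverse chart is controlled only on its target, so it is extended by a constant to get a
  -- measurable map.
  have htm : MeasurableSet t := by
    have hm := (φ.continuousOn_symm).measurable_piecewise (g := fun _ => q)
      continuousOn_const φ.open_target.measurableSet
    have : t = (φ.target.piecewise φ.symm fun _ => q) ⁻¹' s ∩ φ.target := by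
      ext z
      simp only [ht, mem_inter_iff, mem_preimage, and_congr_left_iff]
      intro hz
      rw [piecewise_eq_of_mem _ _ _ hz]
    rw [this]
    exact (hm hs).inter φ.open_target.measurableSet
  have himg : θ '' t = σ ⁻¹' s := by
    ext y
    constructor
    · rintro ⟨z, hz, rfl⟩
      rw [mem_preimage, hσθ]
      exact hz.1
    · intro hy
      have hyq : σ y ∈ φ.source := hsq hy
      refine ⟨φ (σ y), ⟨?_, φ.map_source hyq⟩, ?_⟩
      · rw [mem_preimage, φ.left_inv hyq]; exact hy
      · change spatial n (x (φ.symm (φ (σ y)))) = y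
        rw [φ.left_inv hyq, h.right_inv]
  have hinj : InjOn θ t := by
    intro z hz w hw hzw
    have := congrArg (fun y => φ (σ y)) hzw
    simpa only [hσθ, φ.right_inv hz.2, φ.right_inv hw.2] using this
  have hmeas : AEMeasurable φ.symm ((volume.restrict φ.target).withDensity
      (fun y => ENNReal.ofReal (Real.sqrt (metricMatrix q y).det))) :=
    (φ.continuousOn_symm.aemeasurable φ.open_target.measurableSet).mono_ac
      (withDensity_absolutelyContinuous _ _)
  rw [chartVolume, Measure.map_apply_of_aemeasurable hmeas hs, withDensity_apply',
    Measure.restrict_restrict' φ.open_target.measurableSet, ← himg,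
    lintegral_image_eq_lintegral_abs_det_fderiv_mul volume htm
      (fun z hz => ((hθ z hz.2).differentiableAt (by simp)).hasFDerivAt.hasFDerivWithinAt) hinj]
  refine (setLIntegral_congr_fun htm fun z hz => ?_).le
  have h1 : x ∘ φ.symm = graphMap f ∘ θ := by
    funext z
    rw [Function.comp_apply, Function.comp_apply, ← h.apply_eq, hσθ]
  rw [metricMatrix_eq hx q hz.2, ← hφdef, h1, det_gramMatrix_comp (hF.differentiable (by simp) _)
    ((hθ z hz.2).differentiableAt (by simp)), Real.sqrt_mul (sq_nonneg _), Real.sqrt_sq_eq_abs,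
    ENNReal.ofReal_mul (abs_nonneg _)]

/-- The Riemannian volume in a graph chart. -/
theorem lintegral_le_riemannianVolume [IsManifold (𝓡 n) ∞ M] [SecondCountableTopology M]
    [MeasurableSpace M] [BorelSpace M] (h : IsGraphChart x σ f) (hx : IsSpacelikeHypersurface x N) (g : M → ℝ≥0∞) :
    ∫⁻ y, ENNReal.ofReal (Real.sqrt (gramMatrix (graphMap f) y).det) * g (σ y) ≤
      ∫⁻ p, g p ∂(riemannianVolume n M) := by
  set ρ : EuclideanSpace ℝ (Fin n) → ℝ≥0∞ :=
    fun y => ENNReal.ofReal (Real.sqrt (gramMatrix (graphMap f) y).det) with hρ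
  have hρm : Measurable ρ := (h.contDiff_sqrt_det hx).continuous.measurable.ennreal_ofReal
  set μ : Measure M := (volume.withDensity ρ).map σ with hμ
  have hle : μ ≤ riemannianVolume n M := by
    -- Countably many chart domains cover `M`. Cutting a set into disjoint pieces, each inside one
    -- domain, allows comparison of each piece with its own chart volume, which the supremum
    -- dominates.
    obtain ⟨Q, hQ, hcov⟩ := TopologicalSpace.countable_cover_nhds
      (fun q : M => (chartAt (EuclideanSpace ℝ (Fin n)) q).open_source.mem_nhds
        (mem_chart_source _ q))
    rcases isEmpty_or_nonempty M with hM | hM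
    · exact Measure.le_iff.2 fun s _ => by simp [eq_empty_of_isEmpty s]
    have hQne : Q.Nonempty := by
      by_contra hne
      rw [not_nonempty_iff_eq_empty.1 hne] at hcov
      simp only [mem_empty_iff_false, iUnion_of_empty, iUnion_empty] at hcov
      exact empty_ne_univ hcov
    obtain ⟨c, rfl⟩ := hQ.exists_eq_range hQne
    rw [biUnion_range] at hcov
    let U : ℕ → Set M := fun k => (chartAt (EuclideanSpace ℝ (Fin n)) (c k)).source
    have hU : ∀ k, MeasurableSet (U k) := fun k =>
      (chartAt (EuclideanSpace ℝ (Fin n)) (c k)).open_source.measurableSet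
    have hD := MeasurableSet.disjointed hU
    refine Measure.le_iff.2 fun s hs => ?_
    have hsU : s = ⋃ k, s ∩ disjointed U k := by
      rw [← inter_iUnion, iUnion_disjointed, hcov, inter_univ]
    have hdisj : Pairwise fun i j => Disjoint (s ∩ disjointed U i) (s ∩ disjointed U j) :=
      fun i j hij => (disjoint_disjointed U hij).mono inter_subset_right inter_subset_right
    rw [hsU, measure_iUnion hdisj fun k => hs.inter (hD k),
      measure_iUnion hdisj fun k => hs.inter (hD k)]
    refine ENNReal.tsum_le_tsum fun k => ?_
    rw [hμ, (h.measurableEmbedding hx).map_apply, withDensity_apply']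
    refine (h.setLIntegral_le_chartVolume hx (c k) (hs.inter (hD k))
      (inter_subset_right.trans (disjointed_subset U k))).trans ?_
    exact Measure.le_iff'.1 (le_iSup (fun q : M => chartVolume (n := n) q) (c k)) _
  refine le_trans (le_of_eq ?_) (lintegral_mono' hle le_rfl)
  rw [hμ, (h.measurableEmbedding hx).lintegral_map,
    -- The function `g` is arbitrary; finiteness of the density replaces its measurability.
    lintegral_withDensity_eq_lintegral_mul_non_measurable _ hρm (by simp [hρ])]
  rfl

end IsGraphChart

end Volume

/-! ### The weighted Liouville theorem. -/

section Liouville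

open Filter Topology

variable {n : ℕ}

/-- The divergence of a gradient with weight `e^{-s²/4}` is the weighted drift Laplacian. -/
lemma divergence_weighted_gradient {F : EuclideanSpace ℝ (Fin n) → LorentzSpace n}
    {v : EuclideanSpace ℝ (Fin n) → ℝ} (hF : ContDiff ℝ ∞ F) (hv : ContDiff ℝ ∞ v)
    (hdet : ∀ y, 0 < (gramMatrix F y).det) (y : EuclideanSpace ℝ (Fin n)) :
    divergence (fun y i => Real.exp (-(lorentz (F y) (F y)) ^ 2 / 4) *
      (Real.sqrt (gramMatrix F y).det * coordGradient (gramMatrix F) v y i)) y =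
    Real.exp (-(lorentz (F y) (F y)) ^ 2 / 4) * Real.sqrt (gramMatrix F y).det *
      (coordLaplacian (gramMatrix F) v y -
        lorentz (F y) (F y) * lorentz (F y) (ambientGradient F v y)) := by
  set s : EuclideanSpace ℝ (Fin n) → ℝ := fun y => lorentz (F y) (F y) with hs
  set E : EuclideanSpace ℝ (Fin n) → ℝ := fun y => Real.exp (-(s y) ^ 2 / 4) with hE
  set ρ : EuclideanSpace ℝ (Fin n) → ℝ := fun y => Real.sqrt (gramMatrix F y).det with hρ
  have hsm : ContDiff ℝ ∞ s := contDiff_iff_contDiffAt.2 fun y => hF.contDiffAt.lorentz hF.contDiffAt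
  have hEm : ContDiff ℝ ∞ E := ((hsm.pow 2).neg.div_const 4).exp
  have hc : ∀ i, ContDiff ℝ ∞ fun y => ρ y * coordGradient (gramMatrix F) v y i := fun i =>
    contDiff_iff_contDiffAt.2 fun y => (contDiffAt_sqrt_det hF.contDiffAt (hdet y)).mul
      (contDiffAt_coordGradient hF.contDiffAt hv.contDiffAt (hdet y) i)
  have hρ0 : ρ y ≠ 0 := (Real.sqrt_pos.2 (hdet y)).ne'
  -- The derivative of `s²/4` is `s/2` times `∂ᵢs = 2⟨F, ∂ᵢF⟩`; this produces the drift term.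
  have hEi : ∀ i, partialDeriv E i y = -(s y * E y * lorentz (F y) (partialDeriv F i y)) := by
    intro i
    have hFd := hF.differentiable (by simp) y
    have hsd : HasFDerivAt s (fderiv ℝ s y) y := (hsm.differentiable (by simp) y).hasFDerivAt
    have h1 := ((hsd.pow 2).neg.mul_const (4⁻¹ : ℝ)).exp
    have h2 : E = fun y => Real.exp (-(s y) ^ 2 * 4⁻¹) := by
      funext y; simp only [hE, div_eq_mul_inv]
    have h3 : fderiv ℝ s y (EuclideanSpace.single i 1) =
        2 * lorentz (F y) (partialDeriv F i y) := by
      rw [fderiv_lorentz_apply hFd hFd, lorentz_comm (fderiv ℝ F y _), partialDeriv]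
      ring
    rw [partialDeriv, h2]
    refine (congrArg (fun L => L (EuclideanSpace.single i (1 : ℝ))) h1.fderiv).trans ?_
    simp [h3]
    ring
  have h4 : lorentz (F y) (ambientGradient F v y) =
      ∑ i, coordGradient (gramMatrix F) v y i * lorentz (F y) (partialDeriv F i y) := by
    rw [ambientGradient, lorentz_sum_right]
    exact Finset.sum_congr rfl fun i _ => lorentz_smul_right _ _ _
  have h5 : ∑ i, partialDeriv (fun y => ρ y * coordGradient (gramMatrix F) v y i) i y =
      ρ y * coordLaplacian (gramMatrix F) v y := by
    rw [coordLaplacian, mul_inv_cancel_left₀ hρ0]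
    rfl
  have h6 : divergence (fun y i => E y * (ρ y * coordGradient (gramMatrix F) v y i)) y =
      ∑ i, (E y * partialDeriv (fun y => ρ y * coordGradient (gramMatrix F) v y i) i y +
        ρ y * coordGradient (gramMatrix F) v y i * partialDeriv E i y) :=
    Finset.sum_congr rfl fun i _ => congrFun (partialDeriv_mul hEm (hc i) i) y
  rw [h6, Finset.sum_add_distrib, ← Finset.mul_sum, h5, h4, mul_sub, Finset.mul_sum, Finset.mul_sum,
    sub_eq_add_neg, ← Finset.sum_neg_distrib]
  congr 1
  · ring
  · refine Finset.sum_congr rfl fun i _ => ?_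
    rw [hEi]
    ring

variable {M : Type*} [MetricSpace M] [ChartedSpace (EuclideanSpace ℝ (Fin n)) M]
    [RiemannianBundle (fun p : M => TangentSpace (𝓡 n) p)]
    {x N : M → LorentzSpace n} {σ : EuclideanSpace ℝ (Fin n) → M}
    {f : EuclideanSpace ℝ (Fin n) → ℝ}

namespace IsGraphChart

lemma norm_tangentMap_eq (h : IsGraphChart x σ f) (hx : IsSpacelikeHypersurface x N)
    (y w : EuclideanSpace ℝ (Fin n)) :
    ‖h.tangentMap y w‖ =
      Real.sqrt (lorentz (fderiv ℝ (graphMap f) y w) (fderiv ℝ (graphMap f) y w)) := by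
  rw [← h.inner_tangentMap hx, real_inner_self_eq_norm_sq, Real.sqrt_sq (norm_nonneg _)]

/-- The induced metric is the flat one minus a square; this makes distances on `M` Lipschitz
functions of the Euclidean coordinate. -/
lemma norm_tangentMap_le (h : IsGraphChart x σ f) (hx : IsSpacelikeHypersurface x N)
    (y w : EuclideanSpace ℝ (Fin n)) : ‖h.tangentMap y w‖ ≤ ‖w‖ := by
  refine le_of_sq_le_sq ?_ (norm_nonneg _)
  rw [← real_inner_self_eq_norm_sq, ← hx.isometric, lorentz_eq,
    h.differential_spatial_tangentMap hx, real_inner_self_eq_norm_sq]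
  nlinarith [mul_self_nonneg (temporal n (differential x (σ y) (h.tangentMap y w)))]

variable [IsRiemannianManifold (𝓡 n) M]

lemma dist_le_of_norm_tangentMap_le (h : IsGraphChart x σ f) {y w : EuclideanSpace ℝ (Fin n)}
    {t C : ℝ} (ht : 0 ≤ t) (hC : 0 ≤ C)
    (hw : ∀ τ ∈ Ioo 0 t, ‖h.tangentMap (y + τ • w) w‖ ≤ C) :
    dist (σ y) (σ (y + t • w)) ≤ C * t := by
  have hl : ContDiff ℝ ∞ fun τ : ℝ => y + τ • w := by fun_prop
  have h1 := dist_le_of_norm_mfderiv_le (γ := fun τ => σ (y + τ • w)) ht hC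
    ((h.smooth_map.comp hl.contMDiff).of_le (by simp)).contMDiffOn fun τ hτ => ?_
  · simpa using h1
  · refine le_of_eq_of_le ?_ (hw τ hτ)
    have h2 : mfderiv 𝓘(ℝ, ℝ) (𝓡 n) (σ ∘ fun τ : ℝ => y + τ • w) τ =
        (mfderiv 𝓘(ℝ, EuclideanSpace ℝ (Fin n)) (𝓡 n) σ (y + τ • w)).comp
          (mfderiv 𝓘(ℝ, ℝ) 𝓘(ℝ, EuclideanSpace ℝ (Fin n)) (fun τ : ℝ => y + τ • w) τ) :=
      mfderiv_comp τ (h.mdifferentiableAt _) (hl.contMDiff.mdifferentiableAt (by simp))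
    have h3 : fderiv ℝ (fun τ : ℝ => y + τ • w) τ 1 = w := by
      have : HasDerivAt (fun τ : ℝ => y + τ • w) w τ := by
        simpa using ((hasDerivAt_id τ).smul_const w).const_add y
      exact this.deriv
    change ‖(mfderiv 𝓘(ℝ, ℝ) (𝓡 n) (σ ∘ fun τ : ℝ => y + τ • w) τ 1 : TangentSpace (𝓡 n) _)‖ = _
    rw [h2, mfderiv_eq_fderiv]
    change ‖h.tangentMap (y + τ • w) (fderiv ℝ (fun τ : ℝ => y + τ • w) τ 1)‖ = _
    rw [h3]

lemma lipschitzWith (h : IsGraphChart x σ f) (hx : IsSpacelikeHypersurface x N) :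
    LipschitzWith 1 σ := by
  refine LipschitzWith.of_dist_le_mul fun a b => ?_
  have := h.dist_le_of_norm_tangentMap_le (y := a) (w := b - a) zero_le_one (norm_nonneg (b - a))
    fun τ _ => h.norm_tangentMap_le hx _ _
  rw [one_smul, add_sub_cancel, mul_one] at this
  rw [NNReal.coe_one, one_mul, dist_eq_norm']
  exact this

/-- A function with integrable gradient whose drift Laplacian is nonnegative is harmonic for the
drift Laplacian. -/
theorem driftLaplacian_eq_zero [IsManifold (𝓡 n) ∞ M] [CompleteSpace M]
    [SecondCountableTopology M] [MeasurableSpace M] [BorelSpace M]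
    (h : IsGraphChart x σ f) (hx : IsSpacelikeHypersurface x N) {u : M → ℝ}
    {v : EuclideanSpace ℝ (Fin n) → ℝ} (hv : ContDiff ℝ ∞ v) (huv : ∀ y, u (σ y) = v y)
    (hint : ∫⁻ p, ENNReal.ofReal
      ((‖riemannianGradient n u p‖ + |driftLaplacian x u p|) *
        Real.exp (-(lorentz (x p) (x p)) ^ 2 / 4)) ∂(riemannianVolume n M) < ⊤)
    (hpos : ∀ p, 0 ≤ driftLaplacian x u p) (p : M) : driftLaplacian x u p = 0 := by
  set F := graphMap f with hFdef
  have hF : ContDiff ℝ ∞ F := contDiff_graphMap h.smooth_fun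
  have hdet := h.det_gramMatrix_pos hx
  set E : EuclideanSpace ℝ (Fin n) → ℝ := fun y => Real.exp (-(lorentz (F y) (F y)) ^ 2 / 4) with hE
  set ρ : EuclideanSpace ℝ (Fin n) → ℝ := fun y => Real.sqrt (gramMatrix F y).det with hρ
  have hE0 : ∀ y, 0 < E y := fun y => Real.exp_pos _
  have hρ0 : ∀ y, 0 < ρ y := fun y => Real.sqrt_pos.2 (hdet y)
  -- The coordinates of the weighted gradient, multiplied by the volume density so that the flat
  -- divergence theorem applies.
  set X : EuclideanSpace ℝ (Fin n) → Fin n → ℝ :=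
    fun y i => E y * (ρ y * coordGradient (gramMatrix F) v y i) with hX
  have hsm : ContDiff ℝ ∞ fun y => lorentz (F y) (F y) :=
    contDiff_iff_contDiffAt.2 fun y => hF.contDiffAt.lorentz hF.contDiffAt
  have hEm : ContDiff ℝ ∞ E := ((hsm.pow 2).neg.div_const 4).exp
  have hρm : ContDiff ℝ ∞ ρ := h.contDiff_sqrt_det hx
  have hcm : ∀ i, ContDiff ℝ ∞ fun y => coordGradient (gramMatrix F) v y i := fun i =>
    contDiff_iff_contDiffAt.2 fun y =>
      contDiffAt_coordGradient hF.contDiffAt hv.contDiffAt (hdet y) i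
  have hXm : ∀ i, ContDiff ℝ ∞ fun y => X y i := fun i => hEm.mul (hρm.mul (hcm i))
  have hdrift : ∀ y, divergence X y = E y * ρ y * driftLaplacian x u (σ y) := by
    intro y
    rw [h.driftLaplacian_eq hx hv huv, ← h.lorentz_self_eq, h.apply_eq]
    exact divergence_weighted_gradient hF hv hdet y
  -- The length of `X` in the induced metric, not the Euclidean one. It is the integrable quantity,
  -- and it governs the growth along `X` of the distance on `M`.
  let q : EuclideanSpace ℝ (Fin n) → ℝ := fun y => E y * ρ y * ‖riemannianGradient n u (σ y)‖
  have hqX : ∀ y, ‖h.tangentMap y (∑ i, X y i • EuclideanSpace.single i (1 : ℝ))‖ = q y := by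
    intro y
    have h1 : fderiv ℝ F y (∑ i, X y i • EuclideanSpace.single i (1 : ℝ)) =
        (E y * ρ y) • ambientGradient F v y := by
      rw [map_sum, ambientGradient, Finset.smul_sum]
      refine Finset.sum_congr rfl fun i _ => ?_
      rw [map_smul, smul_smul, mul_assoc]
      rfl
    rw [h.norm_tangentMap_eq hx, h1, lorentz_smul_left, lorentz_smul_right,
      ← h.norm_sq_riemannianGradient hx hv huv, ← mul_assoc, ← sq, ← mul_pow,
      Real.sqrt_sq (mul_nonneg (mul_pos (hE0 y) (hρ0 y)).le (norm_nonneg _))]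
  have hlc : ∀ {V : Type} [TopologicalSpace V] {G : V → LorentzSpace n}, Continuous G →
      Continuous fun y => Real.sqrt (lorentz (G y) (G y)) := by
    intro V _ G hG
    refine Real.continuous_sqrt.comp ?_
    simp only [← lorentzL_apply]
    exact ((lorentzL n).continuous.comp hG).clm_apply hG
  have hqc : Continuous q := by
    refine (hEm.continuous.mul hρm.continuous).mul ?_
    have : (fun y => ‖riemannianGradient n u (σ y)‖) = fun y =>
        Real.sqrt (lorentz (ambientGradient F v y) (ambientGradient F v y)) := by
      funext y
      rw [← h.norm_sq_riemannianGradient hx hv huv, Real.sqrt_sq (norm_nonneg _)]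
    rw [this]
    exact hlc (continuous_finsetSum _ fun i _ =>
      (hcm i).continuous.smul (hF.partialDeriv i).continuous)
  have hq : Integrable q := by
    refine ⟨hqc.aestronglyMeasurable, ?_⟩
    rw [hasFiniteIntegral_iff_ofReal (Eventually.of_forall fun y =>
      mul_nonneg (mul_pos (hE0 y) (hρ0 y)).le (norm_nonneg _))]
    refine lt_of_le_of_lt (le_trans (lintegral_mono fun y => ?_)
      (h.lintegral_le_riemannianVolume hx _)) hint
    rw [← ENNReal.ofReal_mul (hρ0 y).le]
    refine ENNReal.ofReal_le_ofReal ?_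
    rw [h.apply_eq]
    calc q y = ρ y * (‖riemannianGradient n u (σ y)‖ * E y) := by ring
      _ ≤ ρ y * ((‖riemannianGradient n u (σ y)‖ + |driftLaplacian x u (σ y)|) * E y) := by
        refine mul_le_mul_of_nonneg_left (mul_le_mul_of_nonneg_right ?_ (hE0 y).le) (hρ0 y).le
        linarith [abs_nonneg (driftLaplacian x u (σ y))]
  -- Along the segment in the direction `X y` the curve on `M` has initial speed `q y`, hence speed
  -- below `q y + ε` for a short time; the distance changes no faster.
  have hdq : ∀ y, ∀ ε > 0, ∀ᶠ t in 𝓝[>] (0 : ℝ),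
      |dist (σ (y + t • ∑ i, X y i • EuclideanSpace.single i (1 : ℝ))) p - dist (σ y) p| ≤
        t * (q y + ε) := by
    intro y ε hε
    set w := ∑ i, X y i • EuclideanSpace.single i (1 : ℝ) with hw
    have hc : Continuous fun τ : ℝ => ‖h.tangentMap (y + τ • w) w‖ := by
      simp only [h.norm_tangentMap_eq hx]
      exact hlc (((hF.continuous_fderiv (by simp)).comp (by fun_prop)).clm_apply continuous_const)
    have h0 : ∀ᶠ τ in 𝓝 (0 : ℝ), ‖h.tangentMap (y + τ • w) w‖ < q y + ε := by
      refine hc.continuousAt.eventually_lt continuousAt_const ?_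
      rw [zero_smul, add_zero, hqX]
      linarith
    obtain ⟨δ, hδ, hδ'⟩ := Metric.eventually_nhds_iff.1 h0
    have hq0 : 0 ≤ q y := mul_nonneg (mul_pos (hE0 y) (hρ0 y)).le (norm_nonneg _)
    filter_upwards [Ioo_mem_nhdsGT hδ] with t ht
    have h1 := h.dist_le_of_norm_tangentMap_le (y := y) (w := w) (t := t) (C := q y + ε) ht.1.le
      (by linarith) fun τ hτ => (hδ' (by
        rw [Real.dist_eq, sub_zero, abs_of_pos hτ.1]; exact hτ.2.trans ht.2)).le
    rw [dist_comm] at h1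
    rw [mul_comm]
    exact (abs_dist_sub_le _ _ _).trans h1
  obtain ⟨y, rfl⟩ := h.surjective p
  have key := divergence_eq_zero_of_nonneg (fun i => (hXm i).of_le (by simp))
    (fun z => by
      rw [hdrift]
      exact mul_nonneg (mul_pos (hE0 z) (hρ0 z)).le (hpos _))
    (d := fun z => dist (σ z) (σ y)) (fun z => dist_nonneg)
    (LipschitzWith.of_dist_le_mul fun a b => by
      rw [Real.dist_eq, NNReal.coe_one, one_mul]
      exact (abs_dist_sub_le _ _ _).trans (by simpa using (h.lipschitzWith hx).dist_le_mul a b))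
    -- Sublevel sets are closed balls of `M`, compact by Hopf-Rinow, seen through the homeomorphism
    -- with `ℝⁿ`.
    (fun r => by
      have h1 := (isCompact_closedBall_of_completeSpace (n := n) (σ y) r).image
        ((spatial n).continuous.comp hx.smooth.continuous)
      convert h1 using 1
      ext z
      constructor
      · intro hz
        exact ⟨σ z, hz, h.right_inv z⟩
      · rintro ⟨p, hp, rfl⟩
        change dist (σ (spatial n (x p))) (σ y) ≤ r
        rw [h.left_inv]
        exact hp)
    hq hdq y
  rw [hdrift] at key
  rcases mul_eq_zero.1 key with h1 | h1
  · exact absurd h1 (mul_pos (hE0 y) (hρ0 y)).ne'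
  · exact h1

end IsGraphChart

end Liouville

/-! ### Tools for identifying the umbilical hypersurfaces. -/

section Classification

variable {n : ℕ} {M : Type*} [TopologicalSpace M] [ChartedSpace (EuclideanSpace ℝ (Fin n)) M]
    {x N : M → LorentzSpace n} {σ : EuclideanSpace ℝ (Fin n) → M}
    {f : EuclideanSpace ℝ (Fin n) → ℝ}

lemma IsGraphChart.isEmbedding (h : IsGraphChart x σ f) (hx : Continuous x) :
    Topology.IsEmbedding x :=
  Function.LeftInverse.isEmbedding (f := fun X => σ (spatial n X)) h.left_inv
    (h.smooth_map.continuous.comp (spatial n).continuous) hx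

/-- A graph over the whole space that is contained in a graph is equal to it. -/
lemma IsGraphChart.range_eq (h : IsGraphChart x σ f) {Q : Set (LorentzSpace n)}
    (hQ : ∀ p, x p ∈ Q)
    (hinj : ∀ X ∈ Q, ∀ Y ∈ Q, spatial n X = spatial n Y → temporal n X = temporal n Y) :
    range x = Q := by
  refine Subset.antisymm (range_subset_iff.2 hQ) fun Y hY => ⟨σ (spatial n Y), ?_⟩
  exact lorentzSpace_ext (h.right_inv _) (hinj _ (hQ _) _ hY (h.right_inv _))

lemma temporal_eq_of_mem_hyperbolicSpace {c : ℝ} {X Y : LorentzSpace n}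
    (hX : X ∈ hyperbolicSpace n c) (hY : Y ∈ hyperbolicSpace n c)
    (hXY : spatial n X = spatial n Y) : temporal n X = temporal n Y := by
  have h1 := hX.1.trans hY.1.symm
  rw [lorentz_eq, lorentz_eq, hXY] at h1
  have hX0 : 0 < temporal n X := hX.2
  have hY0 : 0 < temporal n Y := hY.2
  nlinarith

lemma IsGraphChart.eq_of_differential_eq_zero {V : Type*} [NormedAddCommGroup V] [NormedSpace ℝ V]
    (h : IsGraphChart x σ f) {u : M → V} (hu : ContMDiff (𝓡 n) 𝓘(ℝ, V) ∞ u)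
    (hd : ∀ p, differential (n := n) u p = 0) (p q : M) : u p = u q := by
  have h1 : Differentiable ℝ (u ∘ σ) :=
    (contMDiff_iff_contDiff.1 (hu.comp h.smooth_map)).differentiable (by simp)
  have h2 : ∀ y, fderiv ℝ (u ∘ σ) y = 0 := fun y => by
    ext1 v
    rw [← h.differential_tangentMap ((hu _).mdifferentiableAt (by simp)), hd]
    rfl
  obtain ⟨a, rfl⟩ := h.surjective p
  obtain ⟨b, rfl⟩ := h.surjective q
  exact is_const_of_fderiv_eq_zero h1 h2 a b

variable [RiemannianBundle (fun p : M => TangentSpace (𝓡 n) p)]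

lemma IsGraphChart.differential_lorentz (h : IsGraphChart x σ f)
    (hx : IsSpacelikeHypersurface x N) {X Y : M → LorentzSpace n}
    (hX : ContMDiff (𝓡 n) 𝓘(ℝ, LorentzSpace n) ∞ X)
    (hY : ContMDiff (𝓡 n) 𝓘(ℝ, LorentzSpace n) ∞ Y) (p : M) (v : TangentSpace (𝓡 n) p) :
    differential (fun p => lorentz (X p) (Y p)) p v =
      lorentz (X p) (differential Y p v) + lorentz (differential X p v) (Y p) := by
  obtain ⟨y, rfl⟩ := h.surjective p
  have hXc := contMDiff_iff_contDiff.1 (hX.comp h.smooth_map)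
  have hYc := contMDiff_iff_contDiff.1 (hY.comp h.smooth_map)
  have hu : ContMDiff (𝓡 n) 𝓘(ℝ, ℝ) ∞ fun p => lorentz (X p) (Y p) :=
    h.contMDiff_of_comp hx (v := fun y => lorentz ((X ∘ σ) y) ((Y ∘ σ) y))
      (contDiff_iff_contDiffAt.2 fun y => hXc.contDiffAt.lorentz hYc.contDiffAt) fun _ => rfl
  rw [← h.tangentMap_spatial_differential hx y v,
    h.differential_tangentMap ((hu _).mdifferentiableAt (by simp)),
    h.differential_tangentMap ((hX _).mdifferentiableAt (by simp)),
    h.differential_tangentMap ((hY _).mdifferentiableAt (by simp))]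
  exact fderiv_lorentz_apply (hXc.differentiable (by simp) y) (hYc.differentiable (by simp) y) _

/-- An isometry that makes a given normal vertical. -/
lemma IsGraphChart.exists_isometry_normal (h : IsGraphChart x σ f)
    (hx : IsSpacelikeHypersurface x N) (p : M) :
    ∃ T : LorentzSpace n ≃L[ℝ] LorentzSpace n, (∀ u v, lorentz (T u) (T v) = lorentz u v) ∧
      T (N p) = EuclideanSpace.single (Fin.last n) 1 ∧
      ∀ i : Fin n, ∃ w : TangentSpace (𝓡 n) p,
        T (differential x p w) = EuclideanSpace.single i.castSucc 1 := by
  obtain ⟨κ, e, he, -⟩ := exists_principal_frame (h.secondForm_symm hx) p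
  obtain ⟨T, hT, hTe, hTN⟩ := exists_lorentz_isometry
    (e := fun i => differential x p (e i)) (ξ := N p) (fun i j => by rw [hx.isometric, he])
    (fun i => hx.normal p _) (hx.unit p)
  exact ⟨T, hT, hTN, fun i => ⟨e i, hTe i⟩⟩

lemma IsGraphChart.eq_zero_of_orthogonal (h : IsGraphChart x σ f)
    (hx : IsSpacelikeHypersurface x N) {p : M} {Z : LorentzSpace n}
    (h1 : ∀ w : TangentSpace (𝓡 n) p, lorentz Z (differential x p w) = 0)
    (h2 : lorentz Z (N p) = 0) : Z = 0 := by
  obtain ⟨T, hT, hTN, hTe⟩ := h.exists_isometry_normal hx p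
  have h3 : T Z = 0 := by
    ext i
    refine Fin.lastCases ?_ (fun i => ?_) i
    · rw [← hT, hTN] at h2
      simpa [lorentz, Fin.castSucc_ne_last] using h2
    · obtain ⟨w, hw⟩ := hTe i
      have h4 := h1 w
      rw [← hT, hw] at h4
      simpa [lorentz, Pi.single_apply, (Fin.castSucc_ne_last _).symm] using h4
  exact T.map_eq_zero_iff.1 h3

/-- The difference `dN - κ dx` is orthogonal to the tangent space by umbilicity, and to `N` because
`⟨N, N⟩` is constant. -/
lemma IsGraphChart.differential_normal_of_umbilical (h : IsGraphChart x σ f)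
    (hx : IsSpacelikeHypersurface x N) {p : M} {κ : ℝ}
    (hκ : ∀ v : TangentSpace (𝓡 n) p, shapeOperator x N p v = κ • v) (v : TangentSpace (𝓡 n) p) :
    differential N p v = κ • differential x p v := by
  rw [← sub_eq_zero]
  refine h.eq_zero_of_orthogonal hx (p := p) (fun w => ?_) ?_
  · rw [sub_eq_add_neg, ← neg_smul, lorentz_add_left, lorentz_smul_left, hx.isometric]
    have h1 := inner_shapeOperator (x := x) (N := N) p v w
    rw [hκ, inner_smul_left, secondForm] at h1
    rw [← h1]
    simp
  · have h1 := h.differential_lorentz hx hx.smooth_normal hx.smooth_normal p v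
    have h2 : (fun p => lorentz (N p) (N p)) = fun _ => (-1 : ℝ) := funext hx.unit
    have h3 : differential (n := n) (fun _ : M => (-1 : ℝ)) p v = 0 := by
      rw [differential, mfderiv_const]
      rfl
    rw [h2, h3, lorentz_comm (N p)] at h1
    rw [sub_eq_add_neg, ← neg_smul, lorentz_add_left, lorentz_smul_left,
      lorentz_comm (differential x p v), hx.normal]
    linarith

end Classification

/-! ### Hyperplanes and hyperbolic spaces. -/

section Umbilical

variable {n : ℕ} {M : Type*} [MetricSpace M] [CompleteSpace M] [ConnectedSpace M]
    [ChartedSpace (EuclideanSpace ℝ (Fin n)) M] [IsManifold (𝓡 n) ∞ M]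
    [RiemannianBundle (fun p : M => TangentSpace (𝓡 n) p)] [IsRiemannianManifold (𝓡 n) M]
    {x N : M → LorentzSpace n}

namespace IsSpacelikeHypersurface

/-- Complete hypersurfaces with constant normal that pass through the origin are hyperplanes. -/
theorem isIsometric_euclideanHyperplane (hx : IsSpacelikeHypersurface x N)
    (hN : ∀ p v, differential (n := n) N p v = 0) (hu : ∀ p, lorentz (x p) (N p) = 0) :
    IsIsometricToHypersurface x (euclideanHyperplane n) := by
  obtain ⟨σ, f, h⟩ := hx.exists_isGraphChart
  refine ⟨h.isEmbedding hx.smooth.continuous, ?_⟩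
  obtain ⟨p₀⟩ := (inferInstance : Nonempty M)
  obtain ⟨T, hT, hTN, -⟩ := h.exists_isometry_normal hx p₀
  refine ⟨T.toLinearEquiv, hT, ?_⟩
  obtain ⟨σ', f', h'⟩ := (hx.isometry hT).exists_isGraphChart
  change T '' range x = _
  rw [← range_comp]
  refine h'.range_eq (fun p => ?_) fun X hX Y hY _ => Eq.trans hX (Eq.symm hY)
  have h1 := hu p
  -- The normal is constant, so the isometry that makes it vertical at one point does so everywhere,
  -- and `⟨x, N⟩ = 0` says that the last coordinate vanishes.
  rw [h.eq_of_differential_eq_zero hx.smooth_normal (fun p => by ext1 v; exact hN p v) p p₀, ← hT,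
    hTN] at h1
  change T (x p) (Fin.last n) = 0
  simpa [lorentz, Fin.castSucc_ne_last] using h1

/-- Complete totally umbilical hypersurfaces whose position vector is normal are hyperbolic
spaces. -/
theorem isIsometric_hyperbolicSpace (hn : n ≠ 0) (hx : IsSpacelikeHypersurface x N) {κ : ℝ}
    (hκ : κ ≠ 0)
    (hN : ∀ p v, differential (n := n) N p v = κ • differential (n := n) x p v)
    (hnor : ∀ p v, lorentz (x p) (differential (n := n) x p v) = 0) :
    IsIsometricToHypersurface x (hyperbolicSpace n (-κ ^ 2)) := by
  obtain ⟨σ, f, h⟩ := hx.exists_isGraphChart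
  refine ⟨h.isEmbedding hx.smooth.continuous, ?_⟩
  set u : M → ℝ := fun p => lorentz (x p) (N p) with hu
  have hus : ContMDiff (𝓡 n) 𝓘(ℝ, ℝ) ∞ u := by
    have h1 := contMDiff_iff_contDiff.1 (hx.smooth.comp h.smooth_map)
    exact h.contMDiff_of_comp hx (v := fun y => lorentz ((x ∘ σ) y) (N (σ y)))
      (contDiff_iff_contDiffAt.2 fun y => h1.contDiffAt.lorentz (h.contDiff_normal hx).contDiffAt)
      fun _ => rfl
  have hxu : ∀ p, x p = (-u p) • N p := by
    intro p
    rw [← sub_eq_zero]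
    refine h.eq_zero_of_orthogonal hx (p := p) (fun w => ?_) ?_
    · rw [sub_eq_add_neg, ← neg_smul, lorentz_add_left, lorentz_smul_left, hx.normal, hnor]
      ring
    · rw [sub_eq_add_neg, ← neg_smul, lorentz_add_left, lorentz_smul_left, hx.unit]
      ring
  have hdu : ∀ p, differential (n := n) u p = 0 := by
    intro p
    ext v
    rw [hu, h.differential_lorentz hx hx.smooth hx.smooth_normal, hN, lorentz_smul_right, hnor,
      lorentz_comm, hx.normal]
    simp
  obtain ⟨p₀⟩ := (inferInstance : Nonempty M)
  have huc : ∀ p, u p = u p₀ := fun p => h.eq_of_differential_eq_zero hus hdu p p₀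
  -- Differentiating `x = -uN` with `u` constant gives `dx = -uκ dx`, and `dx` is not zero.
  have huκ : u p₀ * κ = -1 := by
    have h1 : x = fun p => (-u p₀) • N p := funext fun p => by rw [← huc p, ← hxu]
    have h2 : ∀ v : TangentSpace (𝓡 n) p₀,
        differential x p₀ v = (-u p₀) • κ • differential x p₀ v := by
      intro v
      rw [← hN]
      conv_lhs => rw [h1]
      exact differential_clm_comp ((hx.smooth_normal p₀).mdifferentiableAt (by simp))
        ((-u p₀) • ContinuousLinearMap.id ℝ (LorentzSpace n)) v
    obtain ⟨-, e, he, -⟩ := exists_principal_frame (h.secondForm_symm hx) p₀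
    have h3 := hx.isometric p₀ (e ⟨0, by omega⟩) (e ⟨0, by omega⟩)
    rw [he, if_pos rfl] at h3
    have h4 := congrArg (fun Z => lorentz Z (differential x p₀ (e ⟨0, by omega⟩)))
      (h2 (e ⟨0, by omega⟩))
    simp only [lorentz_smul_left, h3] at h4
    linarith
  have hxx : ∀ p, lorentz (x p) (x p) = 1 / (-κ ^ 2) := by
    intro p
    have h1 : u p₀ = -κ⁻¹ := by field_simp; linarith
    rw [hxu, huc, lorentz_smul_left, lorentz_smul_right, hx.unit, h1]
    field_simp
  -- A vector with vanishing time component has nonnegative square, whereas `⟨x, x⟩ < 0`. By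
  -- connectedness the hypersurface stays on one sheet; if it is the lower one, `-id` exchanges the
  -- sheets.
  have hlast : ∀ p, temporal n (x p) ≠ 0 := by
    intro p hp
    have h1 := hxx p
    rw [lorentz_eq, hp, real_inner_self_eq_norm_sq, one_div, inv_neg] at h1
    have : 0 < (κ ^ 2)⁻¹ := by positivity
    nlinarith [sq_nonneg ‖spatial n (x p)‖]
  have hcont : Continuous fun p => temporal n (x p) :=
    (temporal n).continuous.comp hx.smooth.continuous
  have key : ∀ T : LorentzSpace n ≃L[ℝ] LorentzSpace n,
      (∀ u v, lorentz (T u) (T v) = lorentz u v) → (∀ p, 0 < temporal n (T (x p))) →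
      T '' range x = hyperbolicSpace n (-κ ^ 2) := by
    intro T hT hpos
    obtain ⟨σ', f', h'⟩ := (hx.isometry hT).exists_isGraphChart
    rw [← range_comp]
    exact h'.range_eq (fun p => ⟨by rw [hT, hxx], hpos p⟩)
      fun X hX Y hY hXY => temporal_eq_of_mem_hyperbolicSpace hX hY hXY
  by_cases hp : ∃ p, 0 ≤ temporal n (x p)
  · refine ⟨LinearEquiv.refl ℝ _, fun _ _ => rfl,
      key (ContinuousLinearEquiv.refl ℝ _) (fun _ _ => rfl) fun p => ?_⟩
    by_contra hneg
    obtain ⟨q, hq⟩ := mem_range_of_exists_le_of_exists_ge hcont ⟨p, not_lt.1 hneg⟩ hp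
    exact hlast q hq
  · have hneg : ∀ u v : LorentzSpace n, lorentz (-u) (-v) = lorentz u v := by simp [lorentz]
    refine ⟨LinearEquiv.neg ℝ, hneg, key (ContinuousLinearEquiv.neg ℝ) hneg fun p => ?_⟩
    push Not at hp
    have : temporal n (-x p) = -temporal n (x p) := map_neg _ _
    change 0 < temporal n (-x p)
    rw [this]
    linarith [hp p]

end IsSpacelikeHypersurface

end Umbilical

/-! ### Conclusion. -/

theorem theorem1p3 {n : ℕ} (hn : 2 ≤ n)
    {M : Type*} [MetricSpace M] [CompleteSpace M] [ConnectedSpace M] [SecondCountableTopology M]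
    [MeasurableSpace M] [BorelSpace M]
    [ChartedSpace (EuclideanSpace ℝ (Fin n)) M] [IsManifold (𝓡 n) ∞ M]
    [RiemannianBundle (fun p : M => TangentSpace (𝓡 n) p)]
    [IsContMDiffRiemannianBundle (𝓡 n) ∞ (EuclideanSpace ℝ (Fin n))
      (fun p : M => TangentSpace (𝓡 n) p)]
    [IsRiemannianManifold (𝓡 n) M]
    (x N : M → LorentzSpace n) (hx : IsSpacelikeHypersurface x N)
    (lam : ℝ) (hlam : IsLambdaHypersurface x N (fun p => lorentz (x p) (x p)) lam)
    (hint : ∫⁻ p, ENNReal.ofReal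
      ((‖riemannianGradient n (tracelessNormSq x N) p‖ + |driftLaplacian x (tracelessNormSq x N) p|) *
        Real.exp (-(lorentz (x p) (x p)) ^ 2 / 4)) ∂(riemannianVolume n M) < ⊤)
    (hA : ∀ (p : M) (v : TangentSpace (𝓡 n) p),
      0 ≤ ⟪(4 : ℝ) • shapeOperator x N p (shapeOperator x N p v)
        - (4 * meanCurvature x N p / n) • shapeOperator x N p v
        + tracelessNormSq x N p • v, v⟫_ℝ) :
    (IsTotallyUmbilical x N ∧
      ((∃ c : ℝ, c < 0 ∧ IsIsometricToHypersurface x (hyperbolicSpace n c)) ∨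
        IsIsometricToHypersurface x (euclideanHyperplane n))) ∨
    ∃ p : M,
      (Real.sqrt (normSqSecondForm x N p - meanCurvature x N p ^ 2 / n)
          - |lam| * ((n - 2) / (2 * Real.sqrt (n * (n - 1))))) ^ 2
        + 1 / n * (meanCurvature x N p - lam) ^ 2
        - n * lam ^ 2 / (4 * (n - 1)) < 0 := by
  by_cases hQ : ∀ p : M, 0 ≤
      (Real.sqrt (normSqSecondForm x N p - meanCurvature x N p ^ 2 / n)
          - |lam| * ((n - 2) / (2 * Real.sqrt (n * (n - 1))))) ^ 2
        + 1 / n * (meanCurvature x N p - lam) ^ 2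
        - n * lam ^ 2 / (4 * (n - 1))
  swap
  · push Not at hQ
    exact Or.inr hQ
  left
  obtain ⟨σ, f, h⟩ := hx.exists_isGraphChart
  have hν := h.contDiff_normalFactor hx
  have hB0 : ∀ p, driftLaplacian x (tracelessNormSq x N) p = 0 :=
    h.driftLaplacian_eq_zero hx (contDiff_graphTracelessNormSq h.smooth_fun hν)
      (h.tracelessNormSq_eq hx) hint fun p => (hx.drift_tracelessNormSq hn hlam hA hQ p).1
  have hp := fun p => (hx.drift_tracelessNormSq hn hlam hA hQ p).2 (hB0 p)
  have hH : ∀ p q, meanCurvature x N p = meanCurvature x N q :=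
    h.eq_of_differential_eq_zero (h.contMDiff_of_comp hx
      (contDiff_graphMeanCurvature h.smooth_fun hν) fun y => (h.curvature_eq hx y).1)
      fun p => (hp p).1
  have hS : ∀ p q, normSqSecondForm x N p = normSqSecondForm x N q :=
    h.eq_of_differential_eq_zero (h.contMDiff_of_comp hx
      (contDiff_graphNormSq h.smooth_fun hν) fun y => (h.curvature_eq hx y).2)
      fun p => (hp p).2.1
  obtain ⟨p₀⟩ := (inferInstance : Nonempty M)
  have hBc : ∀ p q, tracelessNormSq x N p = tracelessNormSq x N q := fun p q => by
    rw [tracelessNormSq, tracelessNormSq, hH p q, hS p q]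
  -- `B` is constant. Were it nonzero, `u²B = 0` would force `u = 0` everywhere, which by the second
  -- derivatives of `u` implies `A = 0`, hence `B = 0`.
  have hB : ∀ p, tracelessNormSq x N p = 0 := by
    by_contra! hne
    obtain ⟨q, hq⟩ := hne
    refine hq ((hp q).2.2.2.1 fun p => ?_)
    have h1 := (hp p).2.2.1
    rw [hBc p q] at h1
    exact pow_eq_zero_iff two_ne_zero |>.1 ((mul_eq_zero.1 h1).resolve_right hq)
  have hA' : ∀ p (v : TangentSpace (𝓡 n) p),
      shapeOperator x N p v = (meanCurvature x N p₀ / n) • v := fun p v => by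
    rw [shapeOperator_eq_of_tracelessNormSq_eq_zero (by omega) (hB p), hH p p₀]
  have hN : ∀ p v, differential (n := n) N p v =
      (meanCurvature x N p₀ / n) • differential (n := n) x p v := fun p v =>
    h.differential_normal_of_umbilical hx (hA' p) v
  refine ⟨fun p => ⟨_, hA' p⟩, ?_⟩
  have hlast := fun p => (hp p).2.2.2.2 (hB p) fun q => hH q p
  by_cases hH0 : meanCurvature x N p₀ = 0
  · refine Or.inr (hx.isIsometric_euclideanHyperplane (fun p v => ?_) fun p => ?_)
    · rw [hN, hH0, zero_div, zero_smul]
    · exact (hlast p).1 (by rw [hH p p₀, hH0])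
  · have hκ : meanCurvature x N p₀ / n ≠ 0 := div_ne_zero hH0 (by positivity)
    -- The Gauss equation in Lorentzian space gives a hypersurface with `A = κI` the curvature
    -- `-κ²`, here with `κ = H/n`.
    refine Or.inl ⟨-(meanCurvature x N p₀ / n) ^ 2, by
      have : 0 < (meanCurvature x N p₀ / n) ^ 2 := by positivity
      linarith, hx.isIsometric_hyperbolicSpace (by omega) hκ hN fun p v => ?_⟩
    exact (hlast p).2 (by rw [hH p p₀]; exact hH0) v
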